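/- **Theorem 1.1 (Difference estimates).** Let $m>5/2$ be an integer, let $c_0>0$ and $T>0$, and let $\mathbb P$ denote the Leray projection, i.e. the orthogonal projection of $L^2(\mathbb R^3;\mathbb R^3)$ onto divergence-free fields. For each $c\ge c_0$ let $u^c_0,B^c_0,E^c_0\in H^m(\mathbb R^3;\mathbb R^3)$ be divergence free. Suppose that $(u^c_0,B^c_0)\to(u_0,B_0)$ in $L^2$ as $c\to\infty$ for some $(u_0,B_0)\in H^m$, and that $\sup_{c\ge c_0}\|E^c_0\|_{H^1}<\infty$. For each $c\ge c_0$ let $(u^c,B^c,E^c)\in C([0,T];H^m(\mathbb R^3))$, with initial data $(u^c_0,B^c_0,E^c_0)$, solve the incompressible Euler–Maxwell system with Ohm's law $$\partial_t u+(u\cdot\nabla)u+\nabla p=j\times B,\qquad \tfrac1c\partial_tE-\nabla\times B=-j,\qquad \tfrac1c\partial_tB+\nabla\times E=0,$$ $$j=cE+\mathbb P(u\times B),\qquad \operatorname{div}u=\operatorname{div}E=\operatorname{div}B=\operatorname{div}j=0,$$ with current $j^c=cE^c+\mathbb P(u^c\times B^c)$. Let $(\bar u,\bar B)\in C([0,T];H^m(\mathbb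 R^3))$, with initial data $(u_0,B_0)$, solve the MHD system $$\partial_tu+(u\cdot\nabla)u+\nabla p=(\nabla\times B)\times B,\qquad \partial_tB-\Delta B=\nabla\times(u\times B),\qquad \operatorname{div}u=\operatorname{div}B=0,$$ and set $\bar E=\mathbb P(\nabla\times\bar B-\bar u\times\bar B)$, $\bar j=\nabla\times\bar B$. Assume that there are constants $M,\overline M>0$ with, for all $c\ge c_0$, $$\int_0^T\|B^c(t)\|_{L^\infty}^2\,dt+\int_0^T\|j^c(t)\|_{L^\infty}\,dt\le M,$$ and $$\sup_{t\in[0,T]}\big(\|\bar u(t)\|_{H^m}+\|\bar B(t)\|_{H^m}\big)+\Big(\int_0^T\|\nabla\bar B(t)\|_{H^m}^2\,dt\Big)^{1/2}\le\overline M .$$ Put $$\mathcal E^c_0=\|u^c_0-u_0\|_{L^2}+\|B^c_0-B_0\|_{L^2}+\frac1{c^2}\big(\|cE^c_0-\bar E(0)\|_{H^1}+1\big).$$ Then there is a constant $C>0$, depending only on $T$, $M$ and $\overline M$, such that for every $p\in[1,\infty]$ and all $c\ge c_0$ $$\|(u^c,B^c)-(\bar u,\bar B)\|_{L^p(0,T;L^2)}\le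 C\,\mathcal E^c_0,$$ $$\big\|cE^c-\big(\bar E+e^{-c^2t}(cE^c_0-\bar E(0))\big)\big\|_{L^p(0,T;L^2)}\le C\,(1+c^{1-2/p})\,\mathcal E^c_0$$ (with $2/p=0$ if $p=\infty$). If moreover, for the given $p$, $\|B^c\|_{L^p(0,T;L^\infty)}\le M$ for all $c\ge c_0$, then also $$\big\|j^c-\big(\bar j+e^{-c^2t}(cE^c_0-\bar E(0))\big)\big\|_{L^p(0,T;L^2)}\le C\,(1+c^{1-2/p})\,\mathcal E^c_0\qquad\text{for all }c\ge c_0 .$$ -/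

import Mathlib

open MeasureTheory Filter Topology Set
open scoped ENNReal SchwartzMap LineDeriv FourierTransform Matrix

noncomputable section

namespace EulerMaxwell

/-- Physical space `ℝ³` with its Euclidean norm. -/
abbrev V : Type := EuclideanSpace ℝ (Fin 3)

/-- Square integrable real vector fields, `L²(ℝ³; ℝ³)`. -/
abbrev L2 : Type := Lp V 2 (volume : Measure V)

/-- The `i`-th standard basis vector of `ℝ³`. -/
def basisVec (i : Fin 3) : V := EuclideanSpace.single i 1

/-- The `i`-th component of a vector, as a complex number. -/
def coordC (i : Fin 3) : V →L[ℝ] ℂ :=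
  Complex.ofRealCLM.comp (EuclideanSpace.proj i : V →L[ℝ] ℝ)

/-- The `i`-th component `f_i` of `f ∈ L²(ℝ³; ℝ³)`, as an element of `L²(ℝ³; ℂ)`. -/
def component (i : Fin 3) : L2 →L[ℝ] Lp ℂ 2 (volume : Measure V) :=
  (coordC i).compLpL 2 volume

/-- The `i`-th component `f_i` of `f ∈ L²(ℝ³; ℝ³)`, as a tempered distribution. -/
def distrib (i : Fin 3) : L2 →L[ℝ] 𝓢'(V, ℂ) :=
  ((Lp.toTemperedDistributionCLM ℂ (volume : Measure V) 2).restrictScalars ℝ).comp (component i)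

/-- The Sobolev norm `‖f‖_{H^s} = ‖(1 - Δ)^{s/2} f‖_{L²}`, with value `∞` when `f ∉ H^s`.
The Fourier transform is normalised with the kernel `exp (-2πi x·ξ)`. -/
def hNorm (s : ℝ) (f : L2) : ℝ≥0∞ :=
  (∑ i, ∫⁻ ξ : V, ENNReal.ofReal ((1 + (2 * Real.pi * ‖ξ‖) ^ 2) ^ s)
    * ‖(𝓕 (component i f) : Lp ℂ 2 (volume : Measure V)) ξ‖ₑ ^ 2) ^ (1 / 2 : ℝ)

/-- `f ∈ H^s(ℝ³; ℝ³)`. -/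
def MemH (s : ℝ) (f : L2) : Prop := hNorm s f < ∞

/-- `f ∈ C([0,T]; H^s)`. -/
def ContH (s T : ℝ) (f : ℝ → L2) : Prop :=
  ∀ t ∈ Icc 0 T, MemH s (f t) ∧
    Tendsto (fun r => hNorm s (f r - f t)) (𝓝[Icc 0 T] t) (𝓝 0)

/-- `g ∈ L²` is the distributional partial derivative `∂_k f`. -/
def IsPartial (k : Fin 3) (f g : L2) : Prop :=
  ∀ i, ∂_{basisVec k} (distrib i f) = distrib i g

open Classical in
/-- The distributional partial derivative `∂_k f` when it belongs to `L²` (for instance when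
`f ∈ H¹`), in which case it is unique; the value is `0` for all other fields. -/
def pd (k : Fin 3) (f : L2) : L2 :=
  if h : ∃ g, IsPartial k f g then h.choose else 0

open Classical in
/-- The element of `L²` given by a square integrable function; `0` for other functions. -/
def toL2 (f : V → V) : L2 :=
  if h : MemLp f 2 (volume : Measure V) then h.toLp f else 0

/-- The curl `∇ × f`. -/
def curl (f : L2) : L2 :=
  toL2 fun x => !₂[pd 1 f x 2 - pd 2 f x 1, pd 2 f x 0 - pd 0 f x 2, pd 0 f x 1 - pd 1 f x 0]

/-- The Laplacian `Δ f`. -/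
def lap (f : L2) : L2 := ∑ k, pd k (pd k f)

/-- The pointwise cross product `f × g`. -/
def cross (f g : L2) : L2 :=
  toL2 fun x => WithLp.toLp 2 ((f x).ofLp ⨯₃ (g x).ofLp)

/-- The advection term `(f · ∇) g`. -/
def adv (f g : L2) : L2 :=
  toL2 fun x => ∑ k, f x k • pd k g x

/-- `G ∈ L²` is the distributional gradient `∇p`. -/
def IsGradient (p : 𝓢'(V, ℂ)) (G : L2) : Prop :=
  ∀ k, ∂_{basisVec k} p = distrib k G

/-- The distributional divergence `div f`. -/
def divg : L2 →L[ℝ] 𝓢'(V, ℂ) :=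
  ∑ i, (LineDeriv.lineDerivOpCLM ℝ 𝓢'(V, ℂ) (basisVec i)).comp (distrib i)

/-- The closed subspace of divergence free fields in `L²(ℝ³; ℝ³)`. -/
abbrev divFree : Submodule ℝ L2 := divg.ker

instance : CompleteSpace divFree := divg.isClosed_ker.completeSpace_coe

/-- The Leray projection `ℙ = I + ∇(-Δ)⁻¹div`, that is, the orthogonal projection of
`L²(ℝ³; ℝ³)` onto the divergence free fields. -/
def leray : L2 →L[ℝ] L2 := divFree.starProjection

/-- The electric current `j = cE + ℙ(u × B)` at one instant. -/
def current (c : ℝ) (u E B : L2) : L2 := c • E + leray (cross u B)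

/-- `Ē = ℙ(∇ × B̄ - ū × B̄)` at one instant. -/
def eBar (u B : L2) : L2 := leray (curl B - cross u B)

/-- `f` is differentiable in time on `[0,T]`, as a map into `L²`, with derivative `f'`
(one-sided at the end points). -/
def HasTimeDeriv (T : ℝ) (f f' : ℝ → L2) : Prop :=
  ∀ t ∈ Icc 0 T, HasDerivWithinAt f (f' t) (Icc 0 T) t

/-- `(u, B, E) ∈ C([0,T]; H^m)` solves the incompressible Euler-Maxwell system with Ohm's law,
with speed of light `c`, conductivity `1` and initial data `(u₀, B₀, E₀)`. -/
structure IsEulerMaxwellSolution (m : ℕ) (c T : ℝ) (u B E : ℝ → L2) (u₀ B₀ E₀ : L2) : Prop where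
  cont_u : ContH m T u
  cont_B : ContH m T B
  cont_E : ContH m T E
  init_u : u 0 = u₀
  init_B : B 0 = B₀
  init_E : E 0 = E₀
  div_u : ∀ t ∈ Icc 0 T, divg (u t) = 0
  div_B : ∀ t ∈ Icc 0 T, divg (B t) = 0
  div_E : ∀ t ∈ Icc 0 T, divg (E t) = 0
  div_j : ∀ t ∈ Icc 0 T, divg (current c (u t) (E t) (B t)) = 0
  /-- `∂ₜu + (u·∇)u + ∇p = j × B` for some scalar pressure `p`. -/
  euler : ∃ (u' gradp : ℝ → L2) (p : ℝ → 𝓢'(V, ℂ)), HasTimeDeriv T u u' ∧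
    ∀ t ∈ Icc 0 T, IsGradient (p t) (gradp t) ∧
      u' t + adv (u t) (u t) + gradp t = cross (current c (u t) (E t) (B t)) (B t)
  /-- `(1/c) ∂ₜE - ∇ × B = -j`. -/
  ampere : ∃ E' : ℝ → L2, HasTimeDeriv T E E' ∧
    ∀ t ∈ Icc 0 T, (1 / c) • E' t - curl (B t) = -current c (u t) (E t) (B t)
  /-- `(1/c) ∂ₜB + ∇ × E = 0`. -/
  faraday : ∃ B' : ℝ → L2, HasTimeDeriv T B B' ∧
    ∀ t ∈ Icc 0 T, (1 / c) • B' t + curl (E t) = 0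

/-- `(u, B) ∈ C([0,T]; H^m)` solves the magnetohydrodynamic system with initial data
`(u₀, B₀)`. -/
structure IsMHDSolution (m : ℕ) (T : ℝ) (u B : ℝ → L2) (u₀ B₀ : L2) : Prop where
  cont_u : ContH m T u
  cont_B : ContH m T B
  init_u : u 0 = u₀
  init_B : B 0 = B₀
  div_u : ∀ t ∈ Icc 0 T, divg (u t) = 0
  div_B : ∀ t ∈ Icc 0 T, divg (B t) = 0
  /-- `∂ₜu + (u·∇)u + ∇p = (∇ × B) × B` for some scalar pressure `p`. -/
  momentum : ∃ (u' gradp : ℝ → L2) (p : ℝ → 𝓢'(V, ℂ)), HasTimeDeriv T u u' ∧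
    ∀ t ∈ Icc 0 T, IsGradient (p t) (gradp t) ∧
      u' t + adv (u t) (u t) + gradp t = cross (curl (B t)) (B t)
  /-- `∂ₜB - ΔB = ∇ × (u × B)`. -/
  induction_eq : ∃ B' : ℝ → L2, HasTimeDeriv T B B' ∧
    ∀ t ∈ Icc 0 T, B' t - lap (B t) = curl (cross (u t) (B t))

/-- The assumptions on the family of initial data `(u₀ᶜ, B₀ᶜ, E₀ᶜ)`, `c ≥ c₀`, and on the limit
data `(u₀, B₀)`. -/
structure InitialCondition (m : ℕ) (c₀ : ℝ) (u₀c B₀c E₀c : ℝ → L2) (u₀ B₀ : L2) : Prop where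
  mem_c : ∀ c, c₀ ≤ c → MemH m (u₀c c) ∧ MemH m (B₀c c) ∧ MemH m (E₀c c)
  div_c : ∀ c, c₀ ≤ c → divg (u₀c c) = 0 ∧ divg (B₀c c) = 0 ∧ divg (E₀c c) = 0
  mem : MemH m u₀ ∧ MemH m B₀
  tendsto_u : Tendsto u₀c atTop (𝓝 u₀)
  tendsto_B : Tendsto B₀c atTop (𝓝 B₀)
  bound_E : (⨆ c ∈ Ici c₀, hNorm 1 (E₀c c)) < ∞

/-- The norm of `L^∞(ℝ³)`. -/
def linfNorm (f : L2) : ℝ≥0∞ := eLpNorm f ∞ (volume : Measure V)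

/-- The norm of `L^p(0,T; L²(ℝ³))`. -/
def lpL2Norm (p : ℝ≥0∞) (T : ℝ) (f : ℝ → L2) : ℝ≥0∞ :=
  eLpNorm f p (volume.restrict (Ioo 0 T))

/-- The norm of the pair `(f, g)` in `L^p(0,T; L²(ℝ³))`. -/
def lpL2PairNorm (p : ℝ≥0∞) (T : ℝ) (f g : ℝ → L2) : ℝ≥0∞ :=
  eLpNorm (fun t => Real.sqrt (‖f t‖ ^ 2 + ‖g t‖ ^ 2)) p (volume.restrict (Ioo 0 T))

/-- The norm of `L^p(0,T; L^∞(ℝ³))`. -/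
def lpLinfNorm (p : ℝ≥0∞) (T : ℝ) (f : ℝ → L2) : ℝ≥0∞ :=
  eLpNorm (fun t => linfNorm (f t)) p (volume.restrict (Ioo 0 T))

/-- `∫₀ᵀ ‖B‖²_{L^∞} dt + ∫₀ᵀ ‖j‖_{L^∞} dt ≤ M`. -/
def EMBound (c T M : ℝ) (u B E : ℝ → L2) : Prop :=
  (∫⁻ t in Ioo 0 T, linfNorm (B t) ^ 2)
    + ∫⁻ t in Ioo 0 T, linfNorm (current c (u t) (E t) (B t)) ≤ ENNReal.ofReal M

/-- `sup_{[0,T]} (‖u‖_{H^m} + ‖B‖_{H^m}) + (∫₀ᵀ ‖∇B‖²_{H^m} dt)^{1/2} ≤ M`. -/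
def MHDBound (m : ℕ) (T M : ℝ) (u B : ℝ → L2) : Prop :=
  (⨆ t ∈ Icc 0 T, (hNorm m (u t) + hNorm m (B t)))
    + (∫⁻ t in Ioo 0 T, ∑ k, hNorm m (pd k (B t)) ^ 2) ^ (1 / 2 : ℝ) ≤ ENNReal.ofReal M

/-- `‖u₀ᶜ - u₀‖_{L²} + ‖B₀ᶜ - B₀‖_{L²} + c⁻² (‖c E₀ᶜ - Ē(0)‖_{H¹} + 1)`, where
`Ē(0) = ℙ(∇ × B₀ - u₀ × B₀)`. -/
def initialError (c : ℝ) (u₀c B₀c E₀c u₀ B₀ : L2) : ℝ≥0∞ :=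
  ‖u₀c - u₀‖ₑ + ‖B₀c - B₀‖ₑ
    + ENNReal.ofReal (1 / c ^ 2) * (hNorm 1 (c • E₀c - eBar u₀ B₀) + 1)

/-- The factor `1 + c^{1 - 2/p}`, where `2/p = 0` for `p = ∞`. -/
def rateFactor (c : ℝ) (p : ℝ≥0∞) : ℝ := 1 + c ^ (1 - 2 * (p⁻¹).toReal)

end EulerMaxwell

end

open EulerMaxwell

open EulerMaxwell

noncomputable section

namespace EulerMaxwell

/-! ### Scalar fields -/

/-! The proof is a modulated energy argument. Put w = u - ū, b = B - B̄, ε₀ = cE₀ - Ē(0), s(t) =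
exp(-c²t), and remove the initial layer from the electric field and the current: η = cE - Ē - sε₀
and J = j - ∇×B̄ - sε₀. As ∇×B̄ is divergence free, the limit obeys the same Ohm law j̄ = Ē +
ℙ(ū×B̄), so J - η = ℙ(w×B + ū×b) contains no factor c (`errJ_eq`).

Differentiate X = ‖w‖² + ‖b‖² + c⁻²‖η‖². The pressure gradients are orthogonal to w, transport by u
is skew symmetric, and the terms ⟨∇×b, η⟩ coming from Faraday's and Ampère's laws cancel. The layer
satisfies c⁻²∂ₜ(sε₀) = -sε₀, which compensates its share of the current. What Ampère's law leaves is
-⟨η, J⟩, that is -‖J‖² up to the harmless J - η. The other terms carry the coefficients ‖j‖_∞, ‖B‖_∞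
and H³ bounds of the limit, or are sources: c⁻²∂ₜĒ, and the layer acting on w and b
(`energy_deriv`).

Let e be the initial error. Then c⁻² ≤ e and ∫ s‖ε₀‖_{H¹} dt ≤ c⁻²‖ε₀‖_{H¹} ≤ e, so the sources fit
into X' + ‖J‖² ≤ a(X + e²) with ∫a bounded by T and the two given bounds (`absorb_dissipation`).
`gronwall_dissipation` yields X ≤ Ce² and ∫‖J‖² ≤ Ce². Hence w and b are O(e), while ‖η‖ ≤ Cce at
each time and η = O(e) in L² in time. Interpolating these two (`eLpNorm_le_rateFactor`) produces 1 +
c^{1-2/p}. The current is η + (J - η), and the last term is where the L^p(L^∞) bound on B enters.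

The analysis behind this is the embedding H² ⊂ L^∞ (`linfNorm_le`), a calculus of L² derivatives
done on the Fourier side or by testing, and the time derivative of Ē. The latter is obtained only
weakly, by moving the curl onto test fields; `HasWeakDerivWithinAt.norm_sq` shows that this suffices
to differentiate ‖η‖². -/

/-- Locally integrable functions with the same pairings with real test functions coincide. -/
theorem ae_eq_of_forall_schwartz {f g : V → ℂ} (hf : LocallyIntegrable f) (hg : LocallyIntegrable g)
    (h : ∀ u : 𝓢(V, ℂ), ∫ x, u x * f x = ∫ x, u x * g x) : f =ᵐ[volume] g := by
  refine ae_eq_of_integral_contDiff_smul_eq hf hg fun φ hφ hc => ?_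
  have h₁ : HasCompactSupport (Complex.ofRealCLM ∘ φ) := hc.comp_left rfl
  have h₂ : ContDiff ℝ (⊤ : ℕ∞) (Complex.ofRealCLM ∘ φ) := by fun_prop
  simpa using h (h₁.toSchwartzMap h₂)

theorem toTemperedDistribution_injective :
    Function.Injective (Lp.toTemperedDistribution : Lp ℂ 2 (volume : Measure V) → 𝓢'(V, ℂ)) :=
  LinearMap.ker_eq_bot.1 (Lp.ker_toTemperedDistributionCLM_eq_bot (F := ℂ) (p := 2)
    (μ := (volume : Measure V)))

theorem locallyIntegrable_Lp (f : Lp ℂ 2 (volume : Measure V)) : LocallyIntegrable f :=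
  (Lp.memLp f).locallyIntegrable (by norm_num)

theorem locallyIntegrable_mul_Lp {a : V → ℂ} (ha : Continuous a)
    (f : Lp ℂ 2 (volume : Measure V)) : LocallyIntegrable (fun x => a x * f x) := by
  intro x
  obtain ⟨s, hs, hx⟩ := exists_compact_mem_nhds x
  refine ⟨s, hx, ?_⟩
  exact (((locallyIntegrable_Lp f).integrableOn_isCompact hs).continuousOn_mul
    ha.continuousOn hs)

theorem hasTemperateGrowth_inner (m : V) :
    (fun x : V => (Complex.ofReal (inner ℝ x m))).HasTemperateGrowth := by fun_prop

/-- The symbol of the derivative in the direction `m`. -/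
def dsym (m ξ : V) : ℂ := 2 * Real.pi * Complex.I * (inner ℝ ξ m : ℝ)

theorem continuous_dsym (m : V) : Continuous (dsym m) := by
  unfold dsym; fun_prop

/-- The identity is kept as a pairing with test functions, because the symbol times an L² function
need not be in L². -/
theorem fourier_lineDeriv_apply (f : Lp ℂ 2 (volume : Measure V)) (m : V) (u : 𝓢(V, ℂ)) :
    𝓕 (∂_{m} (f : 𝓢'(V, ℂ))) u =
      ∫ ξ, u ξ * (dsym m ξ * (𝓕 f : Lp ℂ 2 (volume : Measure V)) ξ) := by
  rw [TemperedDistribution.fourier_lineDerivOp_eq, Lp.fourier_toTemperedDistribution_eq]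
  change (2 * Real.pi * Complex.I) • (TemperedDistribution.smulLeftCLM ℂ
    (fun x : V => (Complex.ofReal (inner ℝ x m)))
    ((𝓕 f : Lp ℂ 2 (volume : Measure V)) : 𝓢'(V, ℂ))) u = _
  rw [TemperedDistribution.smulLeftCLM_apply_apply, Lp.toTemperedDistribution_apply,
    ← integral_smul]
  refine integral_congr_ae (ae_of_all _ fun ξ => ?_)
  simp only [SchwartzMap.smulLeftCLM_apply_apply (hasTemperateGrowth_inner m), smul_eq_mul, dsym]
  ring

/-- Distributional derivatives of `L²` functions in terms of the Fourier transform. -/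
theorem lineDeriv_eq_iff_fourier (f g : Lp ℂ 2 (volume : Measure V)) (m : V) :
    ∂_{m} (f : 𝓢'(V, ℂ)) = (g : 𝓢'(V, ℂ)) ↔
      (𝓕 g : Lp ℂ 2 (volume : Measure V)) =ᵐ[volume]
        fun ξ => dsym m ξ * (𝓕 f : Lp ℂ 2 (volume : Measure V)) ξ := by
  have key := fourier_lineDeriv_apply f m
  have key' : ∀ u : 𝓢(V, ℂ), 𝓕 (g : 𝓢'(V, ℂ)) u =
      ∫ ξ, u ξ * (𝓕 g : Lp ℂ 2 (volume : Measure V)) ξ := by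
    intro u
    rw [Lp.fourier_toTemperedDistribution_eq, Lp.toTemperedDistribution_apply]
    simp
  constructor
  · intro h
    refine ae_eq_of_forall_schwartz (locallyIntegrable_Lp _)
      (locallyIntegrable_mul_Lp (continuous_dsym m) _) fun u => ?_
    rw [← key, ← key', h]
  · intro h
    have : 𝓕 (∂_{m} (f : 𝓢'(V, ℂ))) = 𝓕 (g : 𝓢'(V, ℂ)) := by
      ext u
      rw [key, key']
      refine integral_congr_ae ?_
      filter_upwards [h] with ξ hξ
      rw [hξ]
    have h2 := congrArg (fun T : 𝓢'(V, ℂ) => 𝓕⁻ T) this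
    simpa using h2

/-! ### Components and Fourier coefficients of vector fields -/

theorem component_coe (i : Fin 3) (f : L2) :
    (component i f : V → ℂ) =ᵐ[volume] fun x => ((f x i : ℝ) : ℂ) := by
  filter_upwards [(coordC i).coeFn_compLpL (p := 2) (μ := volume) f] with x hx
  exact hx

/-- The Fourier transform of the `i`-th component. -/
abbrev ft (i : Fin 3) (f : L2) : Lp ℂ 2 (volume : Measure V) := 𝓕 (component i f)

theorem distrib_def (i : Fin 3) (f : L2) :
    distrib i f = (component i f : 𝓢'(V, ℂ)) := rfl

theorem component_ext {f g : L2} (h : ∀ i, component i f = component i g) : f = g := by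
  apply Lp.ext
  filter_upwards [component_coe 0 f, component_coe 1 f, component_coe 2 f,
    component_coe 0 g, component_coe 1 g, component_coe 2 g] with x h0 h1 h2 k0 k1 k2
  ext i
  rw [h] at h0 h1 h2
  fin_cases i
  · exact_mod_cast h0.symm.trans k0
  · exact_mod_cast h1.symm.trans k1
  · exact_mod_cast h2.symm.trans k2

theorem ft_injective_of_ae {f g : L2} (h : ∀ i, ft i f =ᵐ[volume] ft i g) : f = g := by
  refine component_ext fun i => ?_
  have : ft i f = ft i g := Lp.ext (h i)
  have h2 := congrArg (fun T : Lp ℂ 2 (volume : Measure V) => 𝓕⁻ T) this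
  simpa [ft] using h2

theorem ft_add (i : Fin 3) (f g : L2) : ft i (f + g) = ft i f + ft i g := by
  simp only [ft, map_add]; exact FourierTransform.fourier_add _ _

theorem ft_smul (i : Fin 3) (r : ℝ) (f : L2) : ft i (r • f) = (r : ℂ) • ft i f := by
  have : component i (r • f) = (r : ℂ) • component i f := by
    rw [map_smul]; rfl
  simp only [ft, this]; exact FourierTransform.fourier_smul _ _

theorem inner_L2_eq (f g : L2) :
    ((inner ℝ f g : ℝ) : ℂ) = ∑ i, inner ℂ (component i f) (component i g) := by
  have hint : ∀ i, Integrable (fun x => inner ℂ (component i f x) (component i g x)) volume :=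
    fun i => L2.integrable_inner _ _
  simp only [L2.inner_def]
  rw [← integral_finsetSum _ fun i _ => hint i, ← integral_complex_ofReal]
  refine integral_congr_ae ?_
  filter_upwards [component_coe 0 f, component_coe 1 f, component_coe 2 f,
    component_coe 0 g, component_coe 1 g, component_coe 2 g] with x h0 h1 h2 k0 k1 k2
  simp only [Fin.sum_univ_three, h0, h1, h2, k0, k1, k2, PiLp.inner_apply]
  simp

/-- Plancherel's theorem for vector fields. -/
theorem inner_L2_eq_ft (f g : L2) :
    ((inner ℝ f g : ℝ) : ℂ) = ∫ ξ, ∑ i, (starRingEnd ℂ (ft i f ξ)) * ft i g ξ := by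
  have e : ∀ i ξ, (starRingEnd ℂ (ft i f ξ)) * ft i g ξ = inner ℂ (ft i f ξ) (ft i g ξ) :=
    fun i ξ => by rw [RCLike.inner_apply, mul_comm]
  simp only [e]
  rw [inner_L2_eq, integral_finsetSum _ fun i _ => L2.integrable_inner (𝕜 := ℂ) (ft i f) (ft i g)]
  refine Finset.sum_congr rfl fun i _ => ?_
  rw [← Lp.inner_fourier_eq, L2.inner_def]

theorem inner_L2_congr_ft {f g f' g' : L2}
    (h : ∀ᵐ ξ, ∑ i, (starRingEnd ℂ (ft i f ξ)) * ft i g ξ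
      = ∑ i, (starRingEnd ℂ (ft i f' ξ)) * ft i g' ξ) : inner ℝ f g = inner ℝ f' g' := by
  have : ((inner ℝ f g : ℝ) : ℂ) = (inner ℝ f' g' : ℝ) := by
    rw [inner_L2_eq_ft, inner_L2_eq_ft]; exact integral_congr_ae h
  exact_mod_cast this

/-! ### Partial derivatives -/

theorem inner_basisVec (k : Fin 3) (ξ : V) : inner ℝ ξ (basisVec k) = ξ k := by
  simp [basisVec, EuclideanSpace.inner_single_right]

theorem dsym_basisVec (k : Fin 3) (ξ : V) :
    dsym (basisVec k) ξ = 2 * Real.pi * Complex.I * (ξ k : ℝ) := by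
  rw [dsym, inner_basisVec]

theorem isPartial_iff {k : Fin 3} {f g : L2} : IsPartial k f g ↔
    ∀ i, ft i g =ᵐ[volume] fun ξ => dsym (basisVec k) ξ * ft i f ξ :=
  forall_congr' fun _ => lineDeriv_eq_iff_fourier _ _ _

theorem IsPartial.unique {k : Fin 3} {f g g' : L2} (h : IsPartial k f g) (h' : IsPartial k f g') :
    g = g' :=
  component_ext fun i => toTemperedDistribution_injective ((h i).symm.trans (h' i))

theorem IsPartial.pd_eq {k : Fin 3} {f g : L2} (h : IsPartial k f g) : pd k f = g := by
  have hex : ∃ g, IsPartial k f g := ⟨g, h⟩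
  rw [pd, dif_pos hex]
  exact hex.choose_spec.unique h

theorem IsPartial.add {k : Fin 3} {f f' g g' : L2} (h : IsPartial k f f') (h' : IsPartial k g g') :
    IsPartial k (f + g) (f' + g') := fun i => by
  rw [map_add, map_add, LineDeriv.lineDerivOp_add, h i, h' i]

theorem IsPartial.smul {k : Fin 3} {f f' : L2} (r : ℝ) (h : IsPartial k f f') :
    IsPartial k (r • f) (r • f') := fun i => by
  rw [map_smul, map_smul, LineDeriv.lineDerivOp_smul, h i]

theorem IsPartial.neg {k : Fin 3} {f f' : L2} (h : IsPartial k f f') :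
    IsPartial k (-f) (-f') := by
  simpa using h.smul (-1)

theorem IsPartial.sub {k : Fin 3} {f f' g g' : L2} (h : IsPartial k f f') (h' : IsPartial k g g') :
    IsPartial k (f - g) (f' - g') := by
  simpa [sub_eq_add_neg] using h.add h'.neg

theorem isPartial_zero (k : Fin 3) : IsPartial k 0 0 := fun i => by simp

theorem IsPartial.sum {ι : Type*} {k : Fin 3} {f f' : ι → L2} (s : Finset ι)
    (h : ∀ i ∈ s, IsPartial k (f i) (f' i)) : IsPartial k (∑ i ∈ s, f i) (∑ i ∈ s, f' i) := by
  classical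
  induction s using Finset.induction_on with
  | empty => simpa using isPartial_zero k
  | insert a s ha ih =>
    rw [Finset.sum_insert ha, Finset.sum_insert ha]
    exact (h a (by simp)).add (ih fun i hi => h i (by simp [hi]))

/-- Integration by parts. -/
theorem IsPartial.inner_eq {k : Fin 3} {f f' g g' : L2} (h : IsPartial k f f')
    (h' : IsPartial k g g') : inner ℝ f' g = -inner ℝ f g' := by
  rw [← inner_neg_left]
  refine inner_L2_congr_ft ?_
  have hneg : ∀ i, ft i (-f) =ᵐ[volume] fun ξ => - ft i f ξ := fun i => by
    have h1 : ft i (-f) = (-1 : ℂ) • ft i f := by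
      have := ft_smul i (-1) f
      simpa using this
    rw [h1]
    filter_upwards [Lp.coeFn_smul (-1 : ℂ) (ft i f)] with ξ hξ
    rw [hξ]; simp
  have e1 : ∀ᵐ ξ, ∀ i, ft i f' ξ = dsym (basisVec k) ξ * ft i f ξ :=
    ae_all_iff.2 (isPartial_iff.1 h)
  have e2 : ∀ᵐ ξ, ∀ i, ft i g' ξ = dsym (basisVec k) ξ * ft i g ξ :=
    ae_all_iff.2 (isPartial_iff.1 h')
  have e3 : ∀ᵐ ξ, ∀ i, ft i (-f) ξ = -ft i f ξ := ae_all_iff.2 hneg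
  filter_upwards [e1, e2, e3] with ξ h1 h2 h3
  refine Finset.sum_congr rfl fun i _ => ?_
  -- The symbol is purely imaginary, so conjugation changes its sign; this is the sign of
  -- integration by parts.
  rw [h1, h2, h3, dsym_basisVec]
  simp only [map_mul, map_neg, Complex.conj_ofReal, Complex.conj_I, map_ofNat]
  ring

/-- Continuous linear images of fields, acting on values. -/
abbrev mapL (L : V →L[ℝ] V) : L2 →L[ℝ] L2 := L.compLpL 2 volume

theorem mapL_coe (L : V →L[ℝ] V) (f : L2) : mapL L f =ᵐ[volume] fun x => L (f x) :=
  L.coeFn_compLpL f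

theorem component_mapL (L : V →L[ℝ] V) (i : Fin 3) (f : L2) :
    component i (mapL L f) = ∑ j, (L (basisVec j) i : ℝ) • component j f := by
  apply Lp.ext
  have hs : ∀ j, ((L (basisVec j) i : ℝ) • component j f : Lp ℂ 2 (volume : Measure V))
      =ᵐ[volume] fun x => ((L (basisVec j) i : ℝ) : ℂ) * (f x j : ℝ) := fun j => by
    filter_upwards [Lp.coeFn_smul (L (basisVec j) i : ℝ) (component j f), component_coe j f]
      with x hx hx'
    rw [hx, Pi.smul_apply, hx', Complex.real_smul]
  rw [Fin.sum_univ_three]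
  filter_upwards [component_coe i (mapL L f), mapL_coe L f, hs 0, hs 1, hs 2,
    Lp.coeFn_add ((L (basisVec 0) i : ℝ) • component 0 f + (L (basisVec 1) i : ℝ) • component 1 f)
      ((L (basisVec 2) i : ℝ) • component 2 f),
    Lp.coeFn_add ((L (basisVec 0) i : ℝ) • component 0 f)
      ((L (basisVec 1) i : ℝ) • component 1 f)] with x h1 h2 h3 h4 h5 h6 h7
  rw [h1, h2, h6, Pi.add_apply, h7, Pi.add_apply, h3, h4, h5]
  have hfx : f x = f x 0 • basisVec 0 + f x 1 • basisVec 1 + f x 2 • basisVec 2 := by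
    ext j; fin_cases j <;> simp [basisVec]
  conv_lhs => rw [hfx]
  simp only [map_add, map_smul, PiLp.add_apply, PiLp.smul_apply, smul_eq_mul]
  push_cast
  ring

theorem IsPartial.mapL {k : Fin 3} {f f' : L2} (L : V →L[ℝ] V) (h : IsPartial k f f') :
    IsPartial k (mapL L f) (mapL L f') := fun i => by
  have e : ∀ g : L2, distrib i (EulerMaxwell.mapL L g) = ∑ j, (L (basisVec j) i : ℝ) • distrib j g := by
    intro g
    change (Lp.toTemperedDistributionCLM ℂ (volume : Measure V) 2).restrictScalars ℝ
      (component i (EulerMaxwell.mapL L g)) = _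
    rw [component_mapL, map_sum]
    simp only [map_smul]
    rfl
  rw [e, e, LineDeriv.lineDerivOp_sum]
  refine Finset.sum_congr rfl fun j _ => ?_
  rw [LineDeriv.lineDerivOp_smul, h j]

/-! ### Sobolev norms -/

/-- The weight `(1 + |2πξ|²)^s` of the Sobolev norm. -/
def wt (s : ℝ) (ξ : V) : ℝ := (1 + (2 * Real.pi * ‖ξ‖) ^ 2) ^ s

theorem wt_base_ge (ξ : V) : 1 ≤ 1 + (2 * Real.pi * ‖ξ‖) ^ 2 := by nlinarith [sq_nonneg (2 * Real.pi * ‖ξ‖)]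

theorem wt_pos (s : ℝ) (ξ : V) : 0 < wt s ξ := Real.rpow_pos_of_pos (by linarith [wt_base_ge ξ]) _

theorem wt_mono {s s' : ℝ} (h : s ≤ s') (ξ : V) : wt s ξ ≤ wt s' ξ :=
  Real.rpow_le_rpow_of_exponent_le (wt_base_ge ξ) h

theorem wt_add (s s' : ℝ) (ξ : V) : wt (s + s') ξ = wt s ξ * wt s' ξ :=
  Real.rpow_add (by linarith [wt_base_ge ξ]) _ _

theorem wt_zero (ξ : V) : wt 0 ξ = 1 := Real.rpow_zero _

theorem wt_one (ξ : V) : wt 1 ξ = 1 + (2 * Real.pi * ‖ξ‖) ^ 2 := Real.rpow_one _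

theorem continuous_wt (s : ℝ) : Continuous (wt s) := by
  unfold wt
  exact Continuous.rpow_const (by fun_prop) fun ξ => Or.inl (by linarith [wt_base_ge ξ])

/-- The square of the Sobolev norm. -/
def hSq (s : ℝ) (f : L2) : ℝ≥0∞ :=
  ∑ i, ∫⁻ ξ : V, ENNReal.ofReal (wt s ξ) * ‖ft i f ξ‖ₑ ^ 2

theorem hNorm_eq (s : ℝ) (f : L2) : hNorm s f = hSq s f ^ (1 / 2 : ℝ) := rfl

theorem hNorm_le_of_hSq_le {s s' : ℝ} {f g : L2} (h : hSq s f ≤ hSq s' g) :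
    hNorm s f ≤ hNorm s' g := by
  rw [hNorm_eq, hNorm_eq]; gcongr

theorem hNorm_mono {s s' : ℝ} (h : s ≤ s') (f : L2) : hNorm s f ≤ hNorm s' f := by
  refine hNorm_le_of_hSq_le (Finset.sum_le_sum fun i _ => lintegral_mono fun ξ => ?_)
  gcongr
  exact wt_mono h ξ

theorem MemH.mono {s s' : ℝ} (h : s ≤ s') {f : L2} (hf : MemH s' f) : MemH s f :=
  (hNorm_mono h f).trans_lt hf

theorem norm_dsym_sq_le (k : Fin 3) (ξ : V) : ‖dsym (basisVec k) ξ‖ ^ 2 ≤ wt 1 ξ := by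
  have h1 : ‖dsym (basisVec k) ξ‖ = 2 * Real.pi * |ξ k| := by
    rw [dsym_basisVec]; simp [abs_of_pos Real.pi_pos]
  rw [h1, wt_one]
  have h2 : |ξ k| ≤ ‖ξ‖ := by simpa using PiLp.norm_apply_le ξ k
  have : 2 * Real.pi * |ξ k| ≤ 2 * Real.pi * ‖ξ‖ := by gcongr
  nlinarith [pow_le_pow_left₀ (by positivity) this 2]

theorem enorm_dsym_sq_le (k : Fin 3) (ξ : V) :
    ‖dsym (basisVec k) ξ‖ₑ ^ 2 ≤ ENNReal.ofReal (wt 1 ξ) := by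
  rw [← ofReal_norm, ← ENNReal.ofReal_pow (norm_nonneg _)]
  exact ENNReal.ofReal_le_ofReal (norm_dsym_sq_le k ξ)

theorem IsPartial.hNorm_le {k : Fin 3} {f g : L2} (h : IsPartial k f g) (s : ℝ) :
    hNorm s g ≤ hNorm (s + 1) f := by
  refine hNorm_le_of_hSq_le (Finset.sum_le_sum fun i _ => ?_)
  have : ∀ᵐ ξ, ENNReal.ofReal (wt s ξ) * ‖ft i g ξ‖ₑ ^ 2
      ≤ ENNReal.ofReal (wt (s + 1) ξ) * ‖ft i f ξ‖ₑ ^ 2 := by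
    filter_upwards [isPartial_iff.1 h i] with ξ hξ
    rw [hξ, enorm_mul, mul_pow, wt_add, ENNReal.ofReal_mul (wt_pos s ξ).le, mul_assoc]
    gcongr
    exact enorm_dsym_sq_le k ξ
  exact lintegral_mono_ae this

theorem lintegral_enorm_ft_sq (i : Fin 3) (f : L2) :
    ∫⁻ ξ, ‖ft i f ξ‖ₑ ^ 2 = ‖component i f‖ₑ ^ 2 := by
  have h1 : ‖component i f‖ₑ = ‖ft i f‖ₑ := by
    rw [← ofReal_norm, ← ofReal_norm, Lp.norm_fourier_eq]
  rw [h1, Lp.enorm_def, eLpNorm_eq_lintegral_rpow_enorm_toReal (by norm_num) (by norm_num)]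
  rw [← ENNReal.rpow_natCast, ← ENNReal.rpow_mul]
  simp

theorem norm_sq_eq_sum (f : L2) : ‖f‖ ^ 2 = ∑ i, ‖component i f‖ ^ 2 := by
  have h := inner_L2_eq f f
  rw [real_inner_self_eq_norm_sq] at h
  simp only [inner_self_eq_norm_sq_to_K] at h
  exact Complex.ofReal_injective (h.trans (by push_cast; rfl))

theorem enorm_sq_eq_hSq (f : L2) : ‖f‖ₑ ^ 2 = hSq 0 f := by
  simp only [hSq, wt_zero, ENNReal.ofReal_one, one_mul, lintegral_enorm_ft_sq]
  rw [← ofReal_norm, ← ENNReal.ofReal_pow (norm_nonneg _), norm_sq_eq_sum,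
    ENNReal.ofReal_sum_of_nonneg fun i _ => by positivity]
  refine Finset.sum_congr rfl fun i _ => ?_
  rw [← ofReal_norm, ENNReal.ofReal_pow (norm_nonneg _)]

theorem hNorm_zero (f : L2) : hNorm 0 f = ‖f‖ₑ := by
  rw [hNorm_eq, ← enorm_sq_eq_hSq, ← ENNReal.rpow_natCast, ← ENNReal.rpow_mul]
  simp

theorem enorm_le_hNorm {s : ℝ} (hs : 0 ≤ s) (f : L2) : ‖f‖ₑ ≤ hNorm s f := by
  rw [← hNorm_zero]; exact hNorm_mono hs f

theorem MemH.hSq_lt {s : ℝ} {f : L2} (h : MemH s f) : hSq s f < ∞ := by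
  rw [MemH, hNorm_eq] at h
  contrapose! h
  rw [top_le_iff.1 h]
  simp

theorem MemH.lintegral_lt {s : ℝ} {f : L2} (h : MemH s f) (i : Fin 3) :
    ∫⁻ ξ : V, ENNReal.ofReal (wt s ξ) * ‖ft i f ξ‖ₑ ^ 2 < ∞ :=
  (ENNReal.sum_lt_top.1 h.hSq_lt) i (Finset.mem_univ i)

/-- The distributional derivative of a real function is real. -/
theorem im_eq_zero_of_lineDeriv {f g : Lp ℂ 2 (volume : Measure V)} {m : V}
    (h : ∂_{m} (f : 𝓢'(V, ℂ)) = (g : 𝓢'(V, ℂ))) (hf : ∀ᵐ x, (f x).im = 0) :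
    ∀ᵐ x, (g x).im = 0 := by
  have hloc : LocallyIntegrable (fun x => (g x).im) volume := by
    intro x
    obtain ⟨s, hs, hx⟩ := locallyIntegrable_Lp g x
    exact ⟨s, hs, hx.im⟩
  refine ae_eq_zero_of_integral_contDiff_smul_eq_zero hloc fun φ hφ hc => ?_
  have h₁ : HasCompactSupport (Complex.ofRealCLM ∘ φ) := hc.comp_left rfl
  have h₂ : ContDiff ℝ (⊤ : ℕ∞) (Complex.ofRealCLM ∘ φ) := by fun_prop
  set u : 𝓢(V, ℂ) := h₁.toSchwartzMap h₂ with hu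
  have hux : ∀ x, u x = (φ x : ℂ) := fun x => rfl
  have hdu : ∀ x, ((∂_{m} u) x).im = 0 := by
    intro x
    have hd : HasFDerivAt (Complex.ofRealCLM ∘ φ) (Complex.ofRealCLM.comp (fderiv ℝ φ x)) x :=
      Complex.ofRealCLM.hasFDerivAt.comp x (hφ.differentiable (by simp) x).hasFDerivAt
    rw [SchwartzMap.lineDerivOp_apply_eq_fderiv]
    change ((fderiv ℝ (Complex.ofRealCLM ∘ φ) x) m).im = 0
    rw [hd.fderiv]
    simp
  have e1 : ∫ x, u x • g x = -∫ x, (∂_{m} u) x • f x := by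
    have := congrArg (fun T : 𝓢'(V, ℂ) => T u) h
    simp only [TemperedDistribution.lineDerivOp_apply_apply, Lp.toTemperedDistribution_apply]
      at this
    rw [← this, ← integral_neg]
    simp
  have hint : Integrable (fun x => u x • g x) volume := by
    have := (u.memLp 2 volume).integrable_mul (Lp.memLp g)
    exact this
  have hint' : Integrable (fun x => (∂_{m} u) x • f x) volume := by
    have := ((∂_{m} u).memLp 2 volume).integrable_mul (Lp.memLp f)
    exact this
  calc ∫ x, φ x • (g x).im = ∫ x, (u x • g x).im := by
        refine integral_congr_ae (ae_of_all _ fun x => ?_)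
        simp [hux]
    _ = (∫ x, u x • g x).im := integral_im hint
    _ = -(∫ x, (∂_{m} u) x • f x).im := by rw [e1]; simp
    _ = -∫ x, ((∂_{m} u) x • f x).im := congrArg Neg.neg (integral_im hint').symm
    _ = 0 := by
        rw [neg_eq_zero, ← integral_zero V ℝ]
        refine integral_congr_ae ?_
        filter_upwards [hf] with x hx
        simp [hdu x, hx]

theorem exists_component_eq {g : Fin 3 → Lp ℂ 2 (volume : Measure V)}
    (hg : ∀ i, ∀ᵐ x, (g i x).im = 0) : ∃ G : L2, ∀ i, component i G = g i := by
  have hm : MemLp (fun x => (WithLp.toLp 2 fun i => (g i x).re : V)) 2 volume := by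
    exact MemLp.of_eval_piLp fun i => (Lp.memLp (g i)).re
  refine ⟨hm.toLp _, fun i => Lp.ext ?_⟩
  filter_upwards [component_coe i (hm.toLp _), hm.coeFn_toLp, hg i] with x h1 h2 h3
  rw [h1, h2]
  apply Complex.ext <;> simp [h3]

/-- The symbol times the transform is in L² by the H¹ bound, and its inverse transform is the
derivative. That produces complex functions; `im_eq_zero_of_lineDeriv` is needed to reassemble them
into a real field. -/
theorem exists_isPartial {f : L2} (hf : MemH 1 f) (k : Fin 3) : ∃ g, IsPartial k f g := by
  have hm : ∀ i, MemLp (fun ξ => dsym (basisVec k) ξ * ft i f ξ) 2 volume := fun i => by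
    refine ⟨(continuous_dsym _).aestronglyMeasurable.mul (Lp.aestronglyMeasurable _), ?_⟩
    rw [eLpNorm_lt_top_iff_lintegral_rpow_enorm_lt_top (by norm_num) (by norm_num)]
    refine lt_of_le_of_lt (lintegral_mono fun ξ => ?_) (hf.lintegral_lt i)
    simp only [ENNReal.toReal_ofNat, ENNReal.rpow_ofNat, enorm_mul, mul_pow]
    gcongr
    exact enorm_dsym_sq_le k ξ
  have hd : ∀ i, ∂_{basisVec k} (component i f : 𝓢'(V, ℂ)) =
      ((𝓕⁻ ((hm i).toLp _) : Lp ℂ 2 (volume : Measure V)) : 𝓢'(V, ℂ)) := fun i => by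
    rw [lineDeriv_eq_iff_fourier, FourierTransform.fourier_fourierInv_eq]
    exact (hm i).coeFn_toLp
  obtain ⟨G, hG⟩ := exists_component_eq (g := fun i => 𝓕⁻ ((hm i).toLp _)) fun i => by
    refine im_eq_zero_of_lineDeriv (hd i) ?_
    filter_upwards [component_coe i f] with x hx
    simp [hx]
  refine ⟨G, fun i => ?_⟩
  rw [distrib_def, distrib_def, hG i, hd i]

theorem isPartial_pd {f : L2} (hf : MemH 1 f) (k : Fin 3) : IsPartial k f (pd k f) := by
  obtain ⟨g, hg⟩ := exists_isPartial hf k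
  rwa [hg.pd_eq]

/-! ### The Sobolev embedding -/

/-- The L² inverse transform is defined abstractly; for integrable data it is given by the integral
formula, from which a pointwise bound can be read off. -/
theorem fourierInv_integral_coe (f : Lp ℂ 2 (volume : Measure V)) (hf : Integrable f volume) :
    (𝓕⁻ f : Lp ℂ 2 (volume : Measure V)) =ᵐ[volume] (𝓕⁻ (f : V → ℂ) : V → ℂ) := by
  have hcont : Continuous (𝓕⁻ (f : V → ℂ) : V → ℂ) :=
    VectorFourier.fourierIntegral_continuous Real.continuous_fourierChar
      (by exact (continuous_inner (𝕜 := ℝ) (E := V)).neg) hf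
  refine ae_eq_of_forall_schwartz (locallyIntegrable_Lp _) hcont.locallyIntegrable fun u => ?_
  have h1 := congrArg (fun T : 𝓢'(V, ℂ) => T u) (Lp.fourierInv_toTemperedDistribution_eq f)
  simp only [TemperedDistribution.fourierInv_apply, Lp.toTemperedDistribution_apply] at h1
  simp only [smul_eq_mul] at h1
  rw [← h1, SchwartzMap.fourierInv_coe]
  have h2 := VectorFourier.integral_fourierIntegral_smul_eq_flip (μ := (volume : Measure V))
    (ν := (volume : Measure V)) (e := Real.fourierChar) (L := -(innerₗ V))
    (f := (u : V → ℂ)) (g := (f : V → ℂ)) Real.continuous_fourierChar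
    (by exact (continuous_inner (𝕜 := ℝ) (E := V)).neg) u.integrable hf
  have hflip : (-(innerₗ V)).flip = -(innerₗ V) := by
    ext x y; simp [real_inner_comm]
  rw [hflip] at h2
  exact h2

/-- The weight decays like |ξ|⁻⁴, and 4 exceeds the dimension 3. -/
theorem lintegral_wt_neg_two_lt : ∫⁻ ξ : V, ENNReal.ofReal (wt (-2) ξ) < ∞ := by
  have hi := integrable_rpow_neg_one_add_norm_sq (E := V) (μ := volume) (r := 4)
    (by simp; norm_num)
  refine lt_of_le_of_lt (lintegral_mono fun ξ => ?_) hi.lintegral_lt_top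
  apply ENNReal.ofReal_le_ofReal
  rw [wt, show (-4 / 2 : ℝ) = -2 by norm_num]
  refine Real.rpow_le_rpow_of_nonpos (by positivity) ?_ (by norm_num)
  have : 1 ≤ 2 * Real.pi := by linarith [Real.pi_gt_three]
  have h2 : ‖ξ‖ ≤ 2 * Real.pi * ‖ξ‖ := le_mul_of_one_le_left (norm_nonneg _) this
  gcongr

/-- Cauchy–Schwarz after splitting 1 into the weights of exponents -1 and 1. -/
theorem lintegral_enorm_ft_le (i : Fin 3) (f : L2) :
    ∫⁻ ξ, ‖ft i f ξ‖ₑ ≤ (∫⁻ ξ : V, ENNReal.ofReal (wt (-2) ξ)) ^ (1 / 2 : ℝ) * hNorm 2 f := by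
  have hh := ENNReal.lintegral_mul_le_Lp_mul_Lq (volume : Measure V)
    (Real.HolderConjugate.two_two)
    (f := fun ξ => ENNReal.ofReal (wt (-1) ξ))
    (g := fun ξ => ENNReal.ofReal (wt 1 ξ) * ‖ft i f ξ‖ₑ)
    (continuous_wt _).measurable.ennreal_ofReal.aemeasurable
    ((continuous_wt _).measurable.ennreal_ofReal.aemeasurable.mul
      (Lp.aestronglyMeasurable _).enorm)
  have e1 : ∀ ξ, ((fun ξ => ENNReal.ofReal (wt (-1) ξ)) * fun ξ => ENNReal.ofReal (wt 1 ξ)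
      * ‖ft i f ξ‖ₑ) ξ = ‖ft i f ξ‖ₑ := fun ξ => by
    simp only [Pi.mul_apply]
    rw [← mul_assoc, ← ENNReal.ofReal_mul (wt_pos _ _).le, ← wt_add]
    simp [wt_zero]
  have e2 : ∀ s ξ, ENNReal.ofReal (wt s ξ) ^ (2 : ℝ) = ENNReal.ofReal (wt (s + s) ξ) :=
    fun s ξ => by
      rw [wt_add, ENNReal.ofReal_mul (wt_pos _ _).le, ← sq]; simp
  rw [lintegral_congr e1] at hh
  refine hh.trans ?_
  simp only [ENNReal.mul_rpow_of_nonneg _ _ (zero_le_two : (0 : ℝ) ≤ 2), e2]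
  rw [show (-1 + -1 : ℝ) = -2 by norm_num, show (1 + 1 : ℝ) = 2 by norm_num]
  gcongr
  rw [hNorm_eq]
  gcongr
  simp only [ENNReal.rpow_ofNat]
  exact Finset.single_le_sum (f := fun i => ∫⁻ ξ : V, ENNReal.ofReal (wt 2 ξ) * ‖ft i f ξ‖ₑ ^ 2)
    (fun _ _ => zero_le) (Finset.mem_univ i)

/-- The constant of the embedding of `H²` into `L^∞`. -/
def sobolevConst : ℝ := 3 * ((∫⁻ ξ : V, ENNReal.ofReal (wt (-2) ξ)) ^ (1 / 2 : ℝ)).toReal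

theorem sobolevConst_nonneg : 0 ≤ sobolevConst := by unfold sobolevConst; positivity

/-- The transform of an H² field is integrable, so Fourier inversion bounds each component by the L¹
norm of its transform. The factor 3 in `sobolevConst` sums the components. -/
theorem linfNorm_le {f : L2} (hf : MemH 2 f) :
    linfNorm f ≤ ENNReal.ofReal sobolevConst * hNorm 2 f := by
  set K := (∫⁻ ξ : V, ENNReal.ofReal (wt (-2) ξ)) ^ (1 / 2 : ℝ) with hK
  have hKtop : K ≠ ∞ := (ENNReal.rpow_lt_top_of_nonneg (by norm_num) lintegral_wt_neg_two_lt.ne).ne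
  have hC : ENNReal.ofReal sobolevConst = 3 * K := by
    rw [sobolevConst, ENNReal.ofReal_mul (by norm_num), ENNReal.ofReal_toReal hKtop]; simp
  have hfin : ∀ i, ∫⁻ ξ, ‖ft i f ξ‖ₑ < ∞ := fun i =>
    (lintegral_enorm_ft_le i f).trans_lt (ENNReal.mul_lt_top hKtop.lt_top hf)
  have hcomp : ∀ i, ∀ᵐ x, ‖component i f x‖ₑ ≤ K * hNorm 2 f := fun i => by
    have hint : Integrable (ft i f) volume := ⟨Lp.aestronglyMeasurable _, hfin i⟩
    have h1 := fourierInv_integral_coe (ft i f) hint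
    rw [FourierTransform.fourierInv_fourier_eq] at h1
    filter_upwards [h1] with x hx
    rw [hx]
    refine le_trans ?_ (lintegral_enorm_ft_le i f)
    rw [Real.fourierInv_eq]
    refine (enorm_integral_le_lintegral_enorm _).trans (lintegral_mono fun ξ => ?_)
    rw [← ofReal_norm, ← ofReal_norm, Circle.norm_smul]
  refine eLpNormEssSup_le_of_ae_enorm_bound ?_ |> (by rw [linfNorm, eLpNorm_exponent_top]; exact ·)
  filter_upwards [hcomp 0, hcomp 1, hcomp 2, component_coe 0 f, component_coe 1 f,
    component_coe 2 f] with x h0 h1 h2 c0 c1 c2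
  rw [c0] at h0
  rw [c1] at h1
  rw [c2] at h2
  have hfx : f x = f x 0 • basisVec 0 + f x 1 • basisVec 1 + f x 2 • basisVec 2 := by
    ext j; fin_cases j <;> simp [basisVec]
  have hb : ∀ (r : ℝ) j, ‖r • basisVec j‖ₑ = ‖(r : ℂ)‖ₑ := fun r j => by
    rw [← ofReal_norm, ← ofReal_norm, norm_smul]; simp [basisVec]
  calc ‖f x‖ₑ ≤ ‖f x 0 • basisVec 0‖ₑ + ‖f x 1 • basisVec 1‖ₑ + ‖f x 2 • basisVec 2‖ₑ := by
        conv_lhs => rw [hfx]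
        exact (enorm_add_le _ _).trans (by gcongr; exact enorm_add_le _ _)
    _ ≤ K * hNorm 2 f + K * hNorm 2 f + K * hNorm 2 f := by
        rw [hb, hb, hb]; gcongr
    _ = ENNReal.ofReal sobolevConst * hNorm 2 f := by rw [hC]; ring

/-! ### Products of fields -/

/-- The field is essentially bounded. -/
def Bdd (f : L2) : Prop := linfNorm f < ∞

/-- The real number `‖f‖_{L^∞}`. -/
def linf (f : L2) : ℝ := (linfNorm f).toReal

theorem linf_nonneg (f : L2) : 0 ≤ linf f := ENNReal.toReal_nonneg

theorem Bdd.memLp {f : L2} (h : Bdd f) : MemLp f ∞ volume := ⟨Lp.aestronglyMeasurable f, h⟩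

theorem Bdd.ae_norm_le {f : L2} (h : Bdd f) : ∀ᵐ x, ‖f x‖ ≤ linf f := by
  have h2 : ∀ᵐ x, ‖f x‖ₑ ≤ linfNorm f := by
    simp only [linfNorm, eLpNorm_exponent_top]; exact ae_le_eLpNormEssSup
  filter_upwards [h2] with x hx
  rw [← ofReal_norm] at hx
  exact (ENNReal.ofReal_le_iff_le_toReal h.ne).1 hx

theorem Bdd.sub {f g : L2} (hf : Bdd f) (hg : Bdd g) : Bdd (f - g) := by
  rw [Bdd, linfNorm, eLpNorm_congr_ae (Lp.coeFn_sub f g)]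
  exact (hf.memLp.sub hg.memLp).2

/-- Once some L² class agrees almost everywhere with the function, the default value 0 of `toL2` is
excluded. -/
theorem toL2_eq {h : V → V} {F : L2} (e : h =ᵐ[volume] F) : toL2 h = F := by
  have hm : MemLp h 2 volume := (Lp.memLp F).ae_eq e.symm
  rw [toL2, dif_pos hm]
  exact Lp.ext (hm.coeFn_toLp.trans e)

/-- The field `β(f, g)` for a bilinear map `β`. -/
def prod (β : V →L[ℝ] V →L[ℝ] V) (f g : L2) : L2 := toL2 fun x => β (f x) (g x)

theorem prod_flip (β : V →L[ℝ] V →L[ℝ] V) (f g : L2) : prod β.flip f g = prod β g f := rfl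

theorem prod_coe_of_memLp {β : V →L[ℝ] V →L[ℝ] V} {f g : L2}
    (h : MemLp (fun x => β (f x) (g x)) 2 volume) :
    prod β f g =ᵐ[volume] fun x => β (f x) (g x) := by
  rw [prod, toL2, dif_pos h]; exact h.coeFn_toLp

theorem Bdd.memLp_right {g : L2} (hg : Bdd g) (β : V →L[ℝ] V →L[ℝ] V) (f : L2) :
    MemLp (fun x => β (f x) (g x)) 2 volume :=
  β.memLp_of_bilin 2 (Lp.memLp f) hg.memLp

theorem Bdd.memLp_left {f : L2} (hf : Bdd f) (β : V →L[ℝ] V →L[ℝ] V) (g : L2) :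
    MemLp (fun x => β (f x) (g x)) 2 volume :=
  β.memLp_of_bilin 2 hf.memLp (Lp.memLp g)

theorem Bdd.prod_right {g : L2} (hg : Bdd g) (β : V →L[ℝ] V →L[ℝ] V) (f : L2) :
    prod β f g =ᵐ[volume] fun x => β (f x) (g x) := prod_coe_of_memLp (hg.memLp_right β f)

theorem Bdd.prod_left {f : L2} (hf : Bdd f) (β : V →L[ℝ] V →L[ℝ] V) (g : L2) :
    prod β f g =ᵐ[volume] fun x => β (f x) (g x) := prod_coe_of_memLp (hf.memLp_left β g)

theorem Bdd.norm_prod_right_le {g : L2} (hg : Bdd g) (β : V →L[ℝ] V →L[ℝ] V) (f : L2) :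
    ‖prod β f g‖ ≤ ‖β‖ * linf g * ‖f‖ := by
  refine Lp.norm_le_mul_norm_of_ae_le_mul ?_
  filter_upwards [hg.prod_right β f, hg.ae_norm_le] with x h1 h2
  rw [h1]
  calc ‖β (f x) (g x)‖ ≤ ‖β‖ * ‖f x‖ * ‖g x‖ := β.le_opNorm₂ _ _
    _ ≤ ‖β‖ * ‖f x‖ * linf g := by gcongr
    _ = _ := by ring

theorem Bdd.norm_prod_left_le {f : L2} (hf : Bdd f) (β : V →L[ℝ] V →L[ℝ] V) (g : L2) :
    ‖prod β f g‖ ≤ ‖β‖ * linf f * ‖g‖ := by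
  rw [← prod_flip, ← ContinuousLinearMap.opNorm_flip β]
  exact hf.norm_prod_right_le β.flip g

/-- Multiplication by a bounded field, as a bounded operator of `L²`. -/
def prodL (β : V →L[ℝ] V →L[ℝ] V) {g : L2} (hg : Bdd g) : L2 →L[ℝ] L2 :=
  LinearMap.mkContinuous
    { toFun := fun f => prod β f g
      map_add' := fun f₁ f₂ => Lp.ext (by
        filter_upwards [hg.prod_right β (f₁ + f₂), hg.prod_right β f₁, hg.prod_right β f₂,
          Lp.coeFn_add f₁ f₂, Lp.coeFn_add (prod β f₁ g) (prod β f₂ g)] with x h1 h2 h3 h4 h5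
        rw [h1, h5, Pi.add_apply, h2, h3, h4]; simp)
      map_smul' := fun r f => Lp.ext (by
        filter_upwards [hg.prod_right β (r • f), hg.prod_right β f,
          Lp.coeFn_smul r f, Lp.coeFn_smul r (prod β f g)] with x h1 h2 h3 h4
        rw [h1, RingHom.id_apply, h4, Pi.smul_apply, h2, h3]; simp) }
    (‖β‖ * linf g) (hg.norm_prod_right_le β)

theorem prodL_apply (β : V →L[ℝ] V →L[ℝ] V) {g : L2} (hg : Bdd g) (f : L2) :
    prodL β hg f = prod β f g := rfl

theorem prod_sub_left (β : V →L[ℝ] V →L[ℝ] V) {g : L2} (hg : Bdd g) (f₁ f₂ : L2) :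
    prod β (f₁ - f₂) g = prod β f₁ g - prod β f₂ g := map_sub (prodL β hg) f₁ f₂

theorem prod_sub_right (β : V →L[ℝ] V →L[ℝ] V) {f : L2} (hf : Bdd f) (g₁ g₂ : L2) :
    prod β f (g₁ - g₂) = prod β f g₁ - prod β f g₂ := prod_sub_left β.flip hf g₁ g₂

/-- The bilinear map `β'` with `⟪β a b, c⟫ = ⟪a, β' b c⟫`. -/
def adjB (β : V →L[ℝ] V →L[ℝ] V) : V →L[ℝ] V →L[ℝ] V :=
  LinearMap.mkContinuous₂
    (LinearMap.mk₂ ℝ (fun b c => ContinuousLinearMap.adjoint (β.flip b) c)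
      (by intros; simp) (by intros; simp) (by intros; simp) (by intros; simp)) ‖β‖ (by
    intro b c
    calc ‖ContinuousLinearMap.adjoint (β.flip b) c‖
        ≤ ‖ContinuousLinearMap.adjoint (β.flip b)‖ * ‖c‖ := ContinuousLinearMap.le_opNorm _ _
      _ = ‖β.flip b‖ * ‖c‖ := by rw [LinearIsometryEquiv.norm_map]
      _ ≤ ‖β.flip‖ * ‖b‖ * ‖c‖ := by gcongr; exact ContinuousLinearMap.le_opNorm _ _
      _ = _ := by rw [ContinuousLinearMap.opNorm_flip])

theorem inner_adjB (β : V →L[ℝ] V →L[ℝ] V) (a b c : V) :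
    inner ℝ (β a b) c = inner ℝ a (adjB β b c) := by
  change _ = inner ℝ a (ContinuousLinearMap.adjoint (β.flip b) c)
  rw [ContinuousLinearMap.adjoint_inner_right]; rfl

theorem inner_prod_eq {β : V →L[ℝ] V →L[ℝ] V} {f g h : L2}
    (h1 : MemLp (fun x => β (f x) (g x)) 2 volume)
    (h2 : MemLp (fun x => adjB β (g x) (h x)) 2 volume) :
    inner ℝ (prod β f g) h = inner ℝ f (prod (adjB β) g h) := by
  rw [L2.inner_def, L2.inner_def]
  refine integral_congr_ae ?_
  filter_upwards [prod_coe_of_memLp h1, prod_coe_of_memLp h2] with x e1 e2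
  rw [e1, e2, inner_adjB]

/-! ### Test fields -/

/-- The class in `L²` of a Schwartz field. -/
abbrev tst (φ : 𝓢(V, V)) : L2 := φ.toLp 2 volume

theorem tst_coe (φ : 𝓢(V, V)) : tst φ =ᵐ[volume] φ := φ.coeFn_toLp 2 volume

theorem bdd_tst (φ : 𝓢(V, V)) : Bdd (tst φ) := by
  rw [Bdd, linfNorm, eLpNorm_congr_ae (tst_coe φ)]
  exact (φ.memLp_top volume).2

theorem lineDeriv_postcomp {E F : Type*} [NormedAddCommGroup E] [NormedSpace ℝ E]
    [NormedAddCommGroup F] [NormedSpace ℝ F] (L : E →L[ℝ] F) (φ : 𝓢(V, E)) (m : V) :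
    ∂_{m} (φ.postcompCLM L) = (∂_{m} φ).postcompCLM L := by
  ext x
  rw [SchwartzMap.postcompCLM_apply, SchwartzMap.lineDerivOp_apply_eq_fderiv,
    SchwartzMap.lineDerivOp_apply_eq_fderiv]
  have h : HasFDerivAt (fun y => L (φ y)) (L.comp (fderiv ℝ φ x)) x :=
    L.hasFDerivAt.comp x φ.differentiableAt.hasFDerivAt
  have h2 : fderiv ℝ (φ.postcompCLM L) x = L.comp (fderiv ℝ φ x) := h.fderiv
  rw [h2]; rfl

theorem component_tst (i : Fin 3) (φ : 𝓢(V, V)) :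
    component i (tst φ) = (φ.postcompCLM (coordC i)).toLp 2 volume := by
  apply Lp.ext
  filter_upwards [component_coe i (tst φ), tst_coe φ,
    (φ.postcompCLM (coordC i)).coeFn_toLp 2 volume] with x h1 h2 h3
  rw [h1, h2, h3]; rfl

theorem isPartial_tst (k : Fin 3) (φ : 𝓢(V, V)) :
    IsPartial k (tst φ) (tst (∂_{basisVec k} φ)) := fun i => by
  rw [distrib_def, distrib_def, component_tst, component_tst, Lp.toTemperedDistribution_toLp_eq,
    Lp.toTemperedDistribution_toLp_eq, TemperedDistribution.lineDerivOp_toTemperedDistributionCLM_eq,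
    lineDeriv_postcomp]

theorem inner_postcomp_smul (F : L2) (u : 𝓢(V, ℂ)) (i : Fin 3) (ℓ : ℂ →L[ℝ] ℝ) :
    inner ℝ F (tst (u.postcompCLM (ℓ.smulRight (basisVec i)))) = ∫ x, ℓ (u x) * F x i := by
  rw [L2.inner_def]
  refine integral_congr_ae ?_
  filter_upwards [tst_coe (u.postcompCLM (ℓ.smulRight (basisVec i)))] with x hx
  rw [hx, SchwartzMap.postcompCLM_apply, ContinuousLinearMap.smulRight_apply, inner_smul_right,
    inner_basisVec]

/-- A complex scalar test function splits into two real vector test fields directed along a basis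
vector, so real inner products determine the components as distributions. -/
theorem integral_mul_component (F : L2) (u : 𝓢(V, ℂ)) (i : Fin 3) :
    ∫ x, u x * component i F x =
      (inner ℝ F (tst (u.postcompCLM (Complex.reCLM.smulRight (basisVec i)))) : ℝ)
      + Complex.I * (inner ℝ F (tst (u.postcompCLM (Complex.imCLM.smulRight (basisVec i)))) : ℝ) := by
  have hint : Integrable (fun x => u x * component i F x) volume :=
    (u.memLp 2 volume).integrable_mul (Lp.memLp (component i F))
  rw [inner_postcomp_smul, inner_postcomp_smul]
  have hre : (∫ x, u x * component i F x).re = ∫ x, Complex.reCLM (u x) * F x i := by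
    have h1 : ∫ x, (u x * component i F x).re = (∫ x, u x * component i F x).re := integral_re hint
    rw [← h1]
    refine integral_congr_ae ?_
    filter_upwards [component_coe i F] with x hx
    rw [hx]; simp
  have him : (∫ x, u x * component i F x).im = ∫ x, Complex.imCLM (u x) * F x i := by
    have h1 : ∫ x, (u x * component i F x).im = (∫ x, u x * component i F x).im := integral_im hint
    rw [← h1]
    refine integral_congr_ae ?_
    filter_upwards [component_coe i F] with x hx
    rw [hx]; simp
  rw [← hre, ← him, mul_comm Complex.I]
  exact (Complex.re_add_im _).symm

/-- Partial derivatives can be tested against Schwartz fields. -/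
theorem isPartial_of_forall_tst {k : Fin 3} {F G : L2}
    (h : ∀ φ : 𝓢(V, V), inner ℝ F (tst (∂_{basisVec k} φ)) = -inner ℝ G (tst φ)) :
    IsPartial k F G := fun i => by
  ext u
  rw [distrib_def, distrib_def, TemperedDistribution.lineDerivOp_apply_apply,
    Lp.toTemperedDistribution_apply, Lp.toTemperedDistribution_apply]
  have e1 : ∫ x, (-∂_{basisVec k} u) x • component i F x
      = -∫ x, (∂_{basisVec k} u) x * component i F x := by
    rw [← integral_neg]; simp
  have e2 : ∫ x, u x • component i G x = ∫ x, u x * component i G x := rfl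
  rw [e1, e2, integral_mul_component, integral_mul_component, ← lineDeriv_postcomp,
    ← lineDeriv_postcomp, h, h]
  push_cast
  ring

theorem prod_tst (β : V →L[ℝ] V →L[ℝ] V) (φ ψ : 𝓢(V, V)) :
    prod β (tst φ) (tst ψ) = tst (SchwartzMap.pairing β φ ψ) := by
  apply Lp.ext
  filter_upwards [(bdd_tst φ).prod_left β (tst ψ), tst_coe φ, tst_coe ψ,
    tst_coe (SchwartzMap.pairing β φ ψ)] with x h1 h2 h3 h4
  rw [h1, h2, h3, h4, SchwartzMap.pairing_apply_apply]

theorem lineDeriv_pairing (β : V →L[ℝ] V →L[ℝ] V) (φ ψ : 𝓢(V, V)) (m : V) :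
    ∂_{m} (SchwartzMap.pairing β φ ψ) =
      SchwartzMap.pairing β (∂_{m} φ) ψ + SchwartzMap.pairing β φ (∂_{m} ψ) := by
  ext1 x
  rw [SchwartzMap.lineDerivOp_apply_eq_fderiv]
  have h := β.hasFDerivAt_of_bilinear (φ.differentiableAt (x := x)).hasFDerivAt
    (ψ.differentiableAt (x := x)).hasFDerivAt
  have h2 : fderiv ℝ (SchwartzMap.pairing β φ ψ) x = _ := h.fderiv
  rw [h2]
  simp only [add_apply, SchwartzMap.pairing_apply_apply,
    SchwartzMap.lineDerivOp_apply_eq_fderiv]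
  simp [add_comm]

/-! ### The product rule -/

theorem IsPartial.prod_tst {k : Fin 3} {g g' : L2} (hg : IsPartial k g g')
    (β : V →L[ℝ] V →L[ℝ] V) (φ : 𝓢(V, V)) :
    IsPartial k (prod β g (tst φ)) (prod β g' (tst φ) + prod β g (tst (∂_{basisVec k} φ))) := by
  refine isPartial_of_forall_tst fun ψ => ?_
  -- The Schwartz factor is moved onto the test field by the adjoint bilinear map; the product rule
  -- for Schwartz fields then does the work.
  have key := hg.inner_eq (isPartial_tst k (SchwartzMap.pairing (adjB β) φ ψ))
  have ad : ∀ (f : L2) (φ ψ : 𝓢(V, V)), inner ℝ (prod β f (tst φ)) (tst ψ)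
      = inner ℝ f (tst (SchwartzMap.pairing (adjB β) φ ψ)) := fun f φ ψ => by
    rw [inner_prod_eq ((bdd_tst φ).memLp_right β f) ((bdd_tst φ).memLp_left _ _),
      EulerMaxwell.prod_tst]
  have hadd : tst (SchwartzMap.pairing (adjB β) (∂_{basisVec k} φ) ψ
      + SchwartzMap.pairing (adjB β) φ (∂_{basisVec k} ψ))
      = tst (SchwartzMap.pairing (adjB β) (∂_{basisVec k} φ) ψ)
      + tst (SchwartzMap.pairing (adjB β) φ (∂_{basisVec k} ψ)) :=
    map_add (SchwartzMap.toLpCLM ℝ V 2 (volume : Measure V)) _ _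
  rw [lineDeriv_pairing, hadd, inner_add_right] at key
  rw [inner_add_left, ad, ad, ad]
  linarith

theorem IsPartial.prod {k : Fin 3} {f f' g g' : L2} (hf : IsPartial k f f') (hg : IsPartial k g g')
    (bf : Bdd f) (bg : Bdd g) (β : V →L[ℝ] V →L[ℝ] V) :
    IsPartial k (prod β f g) (prod β f' g + prod β f g') := by
  refine isPartial_of_forall_tst fun ψ => ?_
  -- Now `g` itself is moved onto the test field: its product with a Schwartz field is already known
  -- to be differentiable, so it may serve as the partner of `f` in the integration by parts.
  have key := hf.inner_eq (hg.prod_tst (adjB β) ψ)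
  rw [inner_add_right] at key
  rw [inner_add_left, inner_prod_eq (bf.memLp_left _ _) (bg.memLp_left _ _),
    inner_prod_eq (bg.memLp_right _ _) (bg.memLp_left _ _),
    inner_prod_eq (bf.memLp_left _ _) ((bdd_tst ψ).memLp_right _ _)]
  linarith

/-! ### Cross products, advection and curl -/

theorem norm_cross_le (a b : V) : ‖(WithLp.toLp 2 (a.ofLp ⨯₃ b.ofLp) : V)‖ ≤ ‖a‖ * ‖b‖ := by
  refine le_of_sq_le_sq ?_ (by positivity)
  rw [mul_pow, EuclideanSpace.norm_sq_eq, EuclideanSpace.norm_sq_eq, EuclideanSpace.norm_sq_eq]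
  simp only [Fin.sum_univ_three, Real.norm_eq_abs, sq_abs, cross_apply]
  simp only [Matrix.cons_val_zero, Matrix.cons_val_one, Matrix.cons_val]
  -- Lagrange's identity: |a×b|² + (a·b)² = |a|²|b|².
  nlinarith [sq_nonneg (a 0 * b 0 + a 1 * b 1 + a 2 * b 2)]

/-- The cross product as a continuous bilinear map. -/
def crossB : V →L[ℝ] V →L[ℝ] V :=
  LinearMap.mkContinuous₂
    (LinearMap.mk₂ ℝ (fun a b : V => (WithLp.toLp 2 (a.ofLp ⨯₃ b.ofLp) : V))
      (by intros; simp) (by intros; simp) (by intros; simp) (by intros; simp)) 1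
    (by intro a b; rw [one_mul]; exact norm_cross_le a b)

theorem crossB_apply (a b : V) : crossB a b = WithLp.toLp 2 (a.ofLp ⨯₃ b.ofLp) := rfl

theorem norm_crossB_le : ‖crossB‖ ≤ 1 := LinearMap.mkContinuous₂_norm_le _ zero_le_one _

theorem cross_eq (f g : L2) : cross f g = prod crossB f g := rfl

/-- The bilinear map `(a, b) ↦ a_k b`. -/
def advB (k : Fin 3) : V →L[ℝ] V →L[ℝ] V :=
  (ContinuousLinearMap.lsmul ℝ ℝ).comp (EuclideanSpace.proj k : V →L[ℝ] ℝ)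

theorem advB_apply (k : Fin 3) (a b : V) : advB k a b = a k • b := rfl

theorem norm_advB_le (k : Fin 3) : ‖advB k‖ ≤ 1 := by
  refine ContinuousLinearMap.opNorm_le_bound₂ _ zero_le_one fun a b => ?_
  rw [advB_apply, norm_smul, one_mul]
  gcongr
  exact PiLp.norm_apply_le a k

theorem coeFn_finset_sum {ι : Type*} (s : Finset ι) (F : ι → L2) :
    (∑ i ∈ s, F i : L2) =ᵐ[volume] fun x => ∑ i ∈ s, F i x := by
  classical
  induction s using Finset.induction_on with
  | empty => simpa using! Lp.coeFn_zero V 2 (volume : Measure V)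
  | insert a s ha ih =>
    rw [Finset.sum_insert ha]
    filter_upwards [Lp.coeFn_add (F a) (∑ i ∈ s, F i), ih] with x h1 h2
    rw [h1, Pi.add_apply, h2, Finset.sum_insert ha]

theorem adv_eq {f g : L2} (h : ∀ k, MemLp (fun x => advB k (f x) (pd k g x)) 2 volume) :
    adv f g = ∑ k, prod (advB k) f (pd k g) := by
  refine toL2_eq ?_
  have h2 : ∀ᵐ x, ∀ k, prod (advB k) f (pd k g) x = advB k (f x) (pd k g x) :=
    ae_all_iff.2 fun k => prod_coe_of_memLp (h k)
  filter_upwards [h2, coeFn_finset_sum Finset.univ fun k => prod (advB k) f (pd k g)] with x e1 e2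
  rw [e2]
  simp only [e1, advB_apply]

/-- The matrix of the cross product with the `k`-th basis vector. -/
def rot (k : Fin 3) : V →L[ℝ] V := crossB (basisVec k)

theorem norm_rot_le (k : Fin 3) : ‖rot k‖ ≤ 1 := by
  refine ((crossB.le_opNorm (basisVec k)).trans ?_)
  have : ‖basisVec k‖ = 1 := by simp [basisVec]
  rw [this, mul_one]; exact norm_crossB_le

theorem rot_zero_apply (a : V) : rot 0 a = !₂[0, -a 2, a 1] := by
  ext i; fin_cases i <;> simp [rot, crossB_apply, cross_apply, basisVec]
theorem rot_one_apply (a : V) : rot 1 a = !₂[a 2, 0, -a 0] := by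
  ext i; fin_cases i <;> simp [rot, crossB_apply, cross_apply, basisVec]
theorem rot_two_apply (a : V) : rot 2 a = !₂[-a 1, a 0, 0] := by
  ext i; fin_cases i <;> simp [rot, crossB_apply, cross_apply, basisVec]

theorem inner_rot (k : Fin 3) (a b : V) : inner ℝ (rot k a) b = -inner ℝ a (rot k b) := by
  fin_cases k <;>
    simp [rot_zero_apply, rot_one_apply, rot_two_apply, PiLp.inner_apply, Fin.sum_univ_three]

/-- In the form Σ eₖ × ∂ₖf the curl is a sum of constant matrices applied to derivatives, to which
the product rule and integration by parts apply term by term. -/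
theorem curl_eq (f : L2) : curl f = ∑ k, mapL (rot k) (pd k f) := by
  refine toL2_eq ?_
  have h2 : ∀ᵐ x, ∀ k, mapL (rot k) (pd k f) x = rot k (pd k f x) :=
    ae_all_iff.2 fun k => mapL_coe _ _
  filter_upwards [h2, coeFn_finset_sum Finset.univ fun k => mapL (rot k) (pd k f)] with x e1 e2
  rw [e2]
  simp only [e1, Fin.sum_univ_three, rot_zero_apply, rot_one_apply, rot_two_apply]
  ext i
  fin_cases i <;> simp <;> ring

/-- All first partial derivatives belong to `L²`. -/
def HasPd (f : L2) : Prop := ∀ k, IsPartial k f (pd k f)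

theorem MemH.hasPd {f : L2} (h : MemH 1 f) : HasPd f := isPartial_pd h

theorem hasPd_of {f : L2} {f' : Fin 3 → L2} (h : ∀ k, IsPartial k f (f' k)) : HasPd f :=
  fun k => by rw [(h k).pd_eq]; exact h k

theorem HasPd.sub {f g : L2} (hf : HasPd f) (hg : HasPd g) : HasPd (f - g) :=
  hasPd_of fun k => (hf k).sub (hg k)

theorem HasPd.mapL {f : L2} (hf : HasPd f) (L : V →L[ℝ] V) : HasPd (mapL L f) :=
  hasPd_of fun k => (hf k).mapL L

theorem HasPd.sum {ι : Type*} {f : ι → L2} {s : Finset ι} (h : ∀ i ∈ s, HasPd (f i)) :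
    HasPd (∑ i ∈ s, f i) := hasPd_of fun k => IsPartial.sum s fun i hi => h i hi k

theorem pd_sub {f g : L2} (hf : HasPd f) (hg : HasPd g) (k : Fin 3) :
    pd k (f - g) = pd k f - pd k g := ((hf k).sub (hg k)).pd_eq

theorem curl_sub {f g : L2} (hf : HasPd f) (hg : HasPd g) : curl (f - g) = curl f - curl g := by
  simp only [curl_eq, pd_sub hf hg, map_sub, Finset.sum_sub_distrib]

theorem norm_mapL_le (L : V →L[ℝ] V) (hL : ‖L‖ ≤ 1) (f : L2) : ‖mapL L f‖ ≤ ‖f‖ := by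
  have h : ‖mapL L f‖ ≤ 1 * ‖f‖ := by
    refine Lp.norm_le_mul_norm_of_ae_le_mul ?_
    filter_upwards [mapL_coe L f] with x hx
    rw [hx]
    exact (L.le_opNorm _).trans (by gcongr)
  simpa using h

theorem norm_curl_le (f : L2) : ‖curl f‖ ≤ ∑ k, ‖pd k f‖ := by
  rw [curl_eq]
  exact (norm_sum_le _ _).trans (Finset.sum_le_sum fun k _ => norm_mapL_le _ (norm_rot_le k) _)

theorem inner_mapL_rot (k : Fin 3) (f g : L2) :
    inner ℝ (mapL (rot k) f) g = -inner ℝ f (mapL (rot k) g) := by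
  rw [L2.inner_def, L2.inner_def, ← integral_neg]
  refine integral_congr_ae ?_
  filter_upwards [mapL_coe (rot k) f, mapL_coe (rot k) g] with x h1 h2
  rw [h1, h2, inner_rot]

/-- The curl is symmetric because two signs cancel: one from the skew matrix eₖ×, one from
integration by parts. -/
theorem inner_curl {f g : L2} (hf : HasPd f) (hg : HasPd g) :
    inner ℝ (curl f) g = inner ℝ f (curl g) := by
  rw [curl_eq, curl_eq, sum_inner, inner_sum]
  refine Finset.sum_congr rfl fun k _ => ?_
  rw [inner_mapL_rot, (hf k).inner_eq ((hg k).mapL (rot k)), neg_neg]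

theorem component_curl_zero (f : L2) : component 0 (curl f) = component 2 (pd 1 f) - component 1 (pd 2 f) := by
  rw [curl_eq, Fin.sum_univ_three]
  simp only [map_add, component_mapL, Fin.sum_univ_three, rot_zero_apply, rot_one_apply,
    rot_two_apply, basisVec]
  simp
  abel
theorem component_curl_one (f : L2) : component 1 (curl f) = component 0 (pd 2 f) - component 2 (pd 0 f) := by
  rw [curl_eq, Fin.sum_univ_three]
  simp only [map_add, component_mapL, Fin.sum_univ_three, rot_zero_apply, rot_one_apply,
    rot_two_apply, basisVec]
  simp
  abel
theorem component_curl_two (f : L2) : component 2 (curl f) = component 1 (pd 0 f) - component 0 (pd 1 f) := by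
  rw [curl_eq, Fin.sum_univ_three]
  simp only [map_add, component_mapL, Fin.sum_univ_three, rot_zero_apply, rot_one_apply,
    rot_two_apply, basisVec]
  simp
  abel

theorem ft_curl {f : L2} (hf : HasPd f) : ∀ᵐ ξ,
    ft 0 (curl f) ξ = dsym (basisVec 1) ξ * ft 2 f ξ - dsym (basisVec 2) ξ * ft 1 f ξ ∧
    ft 1 (curl f) ξ = dsym (basisVec 2) ξ * ft 0 f ξ - dsym (basisVec 0) ξ * ft 2 f ξ ∧
    ft 2 (curl f) ξ = dsym (basisVec 0) ξ * ft 1 f ξ - dsym (basisVec 1) ξ * ft 0 f ξ := by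
  have hs : ∀ a b : Lp ℂ 2 (volume : Measure V), (𝓕 (a - b) : Lp ℂ 2 (volume : Measure V))
      =ᵐ[volume] fun ξ => (𝓕 a : Lp ℂ 2 (volume : Measure V)) ξ
        - (𝓕 b : Lp ℂ 2 (volume : Measure V)) ξ := fun a b => by
    have e : (𝓕 (a - b) : Lp ℂ 2 (volume : Measure V)) = 𝓕 a - 𝓕 b :=
      map_sub (Lp.fourierTransformₗᵢ V ℂ) a b
    rw [e]; exact Lp.coeFn_sub _ _
  have h : ∀ᵐ ξ, ∀ k i, ft i (pd k f) ξ = dsym (basisVec k) ξ * ft i f ξ :=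
    ae_all_iff.2 fun k => ae_all_iff.2 fun i => isPartial_iff.1 (hf k) i
  have c0 := hs (component 2 (pd 1 f)) (component 1 (pd 2 f))
  have c1 := hs (component 0 (pd 2 f)) (component 2 (pd 0 f))
  have c2 := hs (component 1 (pd 0 f)) (component 0 (pd 1 f))
  rw [← component_curl_zero] at c0
  rw [← component_curl_one] at c1
  rw [← component_curl_two] at c2
  filter_upwards [h, c0, c1, c2] with ξ h h0 h1 h2
  exact ⟨by rw [← h, ← h]; exact h0, by rw [← h, ← h]; exact h1, by rw [← h, ← h]; exact h2⟩

/-! ### Divergence and gradients -/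

theorem integrable_mul_dsym_mul (f : Lp ℂ 2 (volume : Measure V)) (m : V) (u : 𝓢(V, ℂ)) :
    Integrable (fun ξ => u ξ * (dsym m ξ * f ξ)) volume := by
  have h1 := (((SchwartzMap.smulLeftCLM ℂ (fun x : V => (Complex.ofReal (inner ℝ x m))) u).memLp 2
    volume).integrable_mul (Lp.memLp f)).const_mul (2 * Real.pi * Complex.I)
  refine h1.congr (ae_of_all _ fun ξ => ?_)
  simp only [Pi.mul_apply, SchwartzMap.smulLeftCLM_apply_apply (hasTemperateGrowth_inner m),
    smul_eq_mul, dsym]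
  ring

theorem divg_apply (f : L2) : divg f = ∑ i, ∂_{basisVec i} (distrib i f) := by
  simp [divg]

theorem fourier_divg_apply (f : L2) (u : 𝓢(V, ℂ)) :
    𝓕 (divg f) u = ∫ ξ, u ξ * ∑ i, dsym (basisVec i) ξ * ft i f ξ := by
  have h1 : 𝓕 (divg f) = ∑ i, 𝓕 (∂_{basisVec i} (distrib i f)) := by
    rw [divg_apply]; exact map_sum (FourierTransform.fourierCLM ℂ 𝓢'(V, ℂ)) _ _
  rw [h1, sum_apply]
  simp only [distrib_def, fourier_lineDeriv_apply, Finset.mul_sum]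
  rw [integral_finsetSum _ fun i _ => integrable_mul_dsym_mul _ _ u]

theorem divg_eq_zero_iff (f : L2) :
    divg f = 0 ↔ ∀ᵐ ξ, ∑ i, dsym (basisVec i) ξ * ft i f ξ = 0 := by
  constructor
  · intro h
    have hloc : LocallyIntegrable (fun ξ => ∑ i, dsym (basisVec i) ξ * ft i f ξ) volume := by
      have := locallyIntegrable_finsetSum Finset.univ
        fun i _ => locallyIntegrable_mul_Lp (continuous_dsym (basisVec i)) (ft i f)
      exact this
    refine ae_eq_of_forall_schwartz hloc locallyIntegrable_zero fun u => ?_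
    rw [← fourier_divg_apply, h]
    have : 𝓕 (0 : 𝓢'(V, ℂ)) = 0 := map_zero (FourierTransform.fourierCLM ℂ 𝓢'(V, ℂ))
    rw [this]; simp
  · intro h
    have : 𝓕 (divg f) = 0 := by
      ext u
      rw [fourier_divg_apply]
      have e : ∫ ξ, u ξ * ∑ i, dsym (basisVec i) ξ * ft i f ξ = ∫ ξ : V, (0 : ℂ) := by
        refine integral_congr_ae ?_
        filter_upwards [h] with ξ hξ
        rw [hξ, mul_zero]
      rw [e]; simp
    have h2 := congrArg (fun T : 𝓢'(V, ℂ) => 𝓕⁻ T) this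
    simp only [FourierTransform.fourierInv_fourier_eq] at h2
    rw [h2]; exact map_zero (FourierTransform.fourierInvCLM ℂ 𝓢'(V, ℂ))

theorem divg_curl {f : L2} (hf : HasPd f) : divg (curl f) = 0 := by
  rw [divg_eq_zero_iff]
  filter_upwards [ft_curl hf] with ξ h
  rw [Fin.sum_univ_three, h.1, h.2.1, h.2.2]
  ring

theorem leray_eq_self {f : L2} (h : divg f = 0) : leray f = f :=
  Submodule.starProjection_eq_self_iff.2 h

theorem norm_leray_le (f : L2) : ‖leray f‖ ≤ ‖f‖ := Submodule.norm_starProjection_apply_le _ f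

theorem inner_leray (f g : L2) : inner ℝ (leray f) g = inner ℝ f (leray g) :=
  Submodule.inner_starProjection_left_eq_right _ f g

theorem lineDeriv_comm (p : 𝓢'(V, ℂ)) (m n : V) : ∂_{m} (∂_{n} p) = ∂_{n} (∂_{m} p) := by
  have h : 𝓕 (∂_{m} (∂_{n} p)) = 𝓕 (∂_{n} (∂_{m} p)) := by
    simp only [TemperedDistribution.fourier_lineDerivOp_eq, map_smul]
    rw [TemperedDistribution.smulLeftCLM_smulLeftCLM_apply (hasTemperateGrowth_inner n)
      (hasTemperateGrowth_inner m), TemperedDistribution.smulLeftCLM_smulLeftCLM_apply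
      (hasTemperateGrowth_inner m) (hasTemperateGrowth_inner n),
      mul_comm (fun x : V => (Complex.ofReal (inner ℝ x n)))]
  have h2 := congrArg (fun T : 𝓢'(V, ℂ) => 𝓕⁻ T) h
  simpa using h2

/-- A gradient is curl free since second derivatives commute. Only the transform of the L² field `G`
is evaluated pointwise; `p` is merely a distribution. -/
theorem IsGradient.ft_eq {p : 𝓢'(V, ℂ)} {G : L2} (h : IsGradient p G) (j k : Fin 3) :
    ∀ᵐ ξ, dsym (basisVec j) ξ * ft k G ξ = dsym (basisVec k) ξ * ft j G ξ := by
  have hd : ∂_{basisVec j} (distrib k G) = ∂_{basisVec k} (distrib j G) := by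
    rw [← h, ← h, lineDeriv_comm]
  refine ae_eq_of_forall_schwartz (locallyIntegrable_mul_Lp (continuous_dsym _) _)
    (locallyIntegrable_mul_Lp (continuous_dsym _) _) fun u => ?_
  rw [← fourier_lineDeriv_apply, ← fourier_lineDeriv_apply]
  exact congrArg (fun T : 𝓢'(V, ℂ) => 𝓕 T u) hd

/-- Gradients are orthogonal to divergence free fields. -/
theorem IsGradient.inner_eq_zero {p : 𝓢'(V, ℂ)} {G w : L2} (h : IsGradient p G)
    (hw : divg w = 0) : inner ℝ w G = 0 := by
  have h0 : ((inner ℝ w G : ℝ) : ℂ) = 0 := by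
    rw [inner_L2_eq_ft, ← integral_zero V ℂ]
    refine integral_congr_ae ?_
    have hg : ∀ᵐ ξ, ∀ j k, dsym (basisVec j) ξ * ft k G ξ = dsym (basisVec k) ξ * ft j G ξ :=
      ae_all_iff.2 fun j => ae_all_iff.2 fun k => h.ft_eq j k
    have hne : ∀ᵐ ξ : V, ξ ≠ 0 := by
      simp [ae_iff]
    filter_upwards [hg, (divg_eq_zero_iff w).1 hw, hne] with ξ hg hw hne
    have hpi : (2 * Real.pi * Complex.I : ℂ) ≠ 0 := by
      simp [Real.pi_ne_zero]
    simp only [dsym_basisVec] at hg hw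
    have hg' : ∀ j k, ((ξ j : ℝ) : ℂ) * ft k G ξ = (ξ k : ℝ) * ft j G ξ := fun j k => by
      have := hg j k
      apply mul_left_cancel₀ hpi
      linear_combination this
    have hw' : ((ξ 0 : ℝ) : ℂ) * ft 0 w ξ + (ξ 1 : ℝ) * ft 1 w ξ + (ξ 2 : ℝ) * ft 2 w ξ = 0 := by
      rw [Fin.sum_univ_three] at hw
      apply mul_left_cancel₀ hpi
      rw [mul_zero, ← hw]; ring
    have hw2 := congrArg (starRingEnd ℂ) hw'
    simp only [map_add, map_mul, Complex.conj_ofReal, map_zero] at hw2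
    -- After multiplication by a nonvanishing coordinate ξⱼ, the relation ξⱼGₖ = ξₖGⱼ turns the
    -- integrand into Gⱼ times the conjugate of ξ·w, which is zero.
    have : ∃ j, ξ j ≠ 0 := by
      by_contra! hcon
      exact hne (by ext j; simpa using hcon j)
    obtain ⟨j, hj⟩ := this
    have hjc : ((ξ j : ℝ) : ℂ) ≠ 0 := by exact_mod_cast hj
    apply mul_left_cancel₀ hjc
    rw [Fin.sum_univ_three, mul_zero]
    linear_combination (starRingEnd ℂ (ft 0 w ξ)) * hg' j 0 + (starRingEnd ℂ (ft 1 w ξ)) * hg' j 1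
      + (starRingEnd ℂ (ft 2 w ξ)) * hg' j 2 + ft j G ξ * hw2
  exact_mod_cast h0

/-- On the Fourier side ∇×∇× differs from -Δ by ∇div, which vanishes here. -/
theorem curl_curl {f : L2} (hf : HasPd f) (hf2 : ∀ k, HasPd (pd k f)) (hdiv : divg f = 0) :
    curl (curl f) = -lap f := by
  have hc : HasPd (curl f) := by
    rw [curl_eq]; exact HasPd.sum fun k _ => (hf2 k).mapL _
  have hl : ∀ i, ft i (-lap f) =ᵐ[volume] fun ξ => -∑ k, dsym (basisVec k) ξ ^ 2 * ft i f ξ := by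
    intro i
    have e : ft i (-lap f) = -(ft i (pd 0 (pd 0 f)) + ft i (pd 1 (pd 1 f)) + ft i (pd 2 (pd 2 f))) := by
      have h : ∀ g, ft i (-g) = -ft i g := fun g => by simpa using ft_smul i (-1) g
      rw [h, lap, Fin.sum_univ_three, ft_add, ft_add]
    rw [e]
    have h1 : ∀ᵐ ξ, ∀ k, ft i (pd k f) ξ = dsym (basisVec k) ξ * ft i f ξ :=
      ae_all_iff.2 fun k => isPartial_iff.1 (hf k) i
    have h2 : ∀ᵐ ξ, ∀ k, ft i (pd k (pd k f)) ξ = dsym (basisVec k) ξ * ft i (pd k f) ξ :=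
      ae_all_iff.2 fun k => isPartial_iff.1 (hf2 k k) i
    filter_upwards [h1, h2, Lp.coeFn_neg (ft i (pd 0 (pd 0 f)) + ft i (pd 1 (pd 1 f))
      + ft i (pd 2 (pd 2 f))), Lp.coeFn_add (ft i (pd 0 (pd 0 f)) + ft i (pd 1 (pd 1 f)))
      (ft i (pd 2 (pd 2 f))), Lp.coeFn_add (ft i (pd 0 (pd 0 f))) (ft i (pd 1 (pd 1 f)))]
      with ξ h1 h2 h3 h4 h5
    rw [h3, Pi.neg_apply, h4, Pi.add_apply, h5, Pi.add_apply, h2, h2, h2, h1, h1, h1,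
      Fin.sum_univ_three]
    ring
  have hl' : ∀ᵐ ξ, ∀ i, ft i (-lap f) ξ = -∑ k, dsym (basisVec k) ξ ^ 2 * ft i f ξ :=
    ae_all_iff.2 hl
  have key : ∀ᵐ ξ, ∀ i, ft i (curl (curl f)) ξ = ft i (-lap f) ξ := by
    filter_upwards [hl', ft_curl hc, ft_curl hf, (divg_eq_zero_iff f).1 hdiv] with ξ h1 h2 h3 h4
    rw [Fin.sum_univ_three] at h4
    intro i
    rw [h1, Fin.sum_univ_three]
    fin_cases i
    · simp only [Fin.zero_eta, h2.1, h3.2.1, h3.2.2]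
      linear_combination dsym (basisVec 0) ξ * h4
    · simp only [Fin.mk_one, h2.2.1, h3.1, h3.2.2]
      linear_combination dsym (basisVec 1) ξ * h4
    · simp only [Fin.reduceFinMk, h2.2.2, h3.1, h3.2.1]
      linear_combination dsym (basisVec 2) ξ * h4
  exact ft_injective_of_ae fun i => key.mono fun ξ h => h i

/-- Turns the distributional constraint into a pointwise one, as the skew symmetry of advection
requires. -/
theorem sum_pd_eq_zero {u : L2} (hu : HasPd u) (hdiv : divg u = 0) :
    ∀ᵐ x, ∑ k, pd k u x k = 0 := by
  have h1 : distrib 0 (pd 0 u) + distrib 1 (pd 1 u) + distrib 2 (pd 2 u) = 0 := by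
    rw [divg_apply, Fin.sum_univ_three, hu 0 0, hu 1 1, hu 2 2] at hdiv
    exact hdiv
  have h2 : component 0 (pd 0 u) + component 1 (pd 1 u) + component 2 (pd 2 u) = 0 := by
    apply toTemperedDistribution_injective
    have e : ∀ f : Lp ℂ 2 (volume : Measure V), (f : 𝓢'(V, ℂ))
      = Lp.toTemperedDistributionCLM ℂ (volume : Measure V) 2 f := fun _ => rfl
    rw [e, e, map_add, map_add, map_zero]
    exact h1
  have h3 := Lp.coeFn_add (component 0 (pd 0 u) + component 1 (pd 1 u)) (component 2 (pd 2 u))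
  rw [h2] at h3
  filter_upwards [h3, Lp.coeFn_add (component 0 (pd 0 u)) (component 1 (pd 1 u)),
    component_coe 0 (pd 0 u), component_coe 1 (pd 1 u), component_coe 2 (pd 2 u),
    Lp.coeFn_zero ℂ 2 (volume : Measure V)] with x e1 e2 c0 c1 c2 z
  rw [z, Pi.add_apply, e2, Pi.add_apply, c0, c1, c2] at e1
  rw [Fin.sum_univ_three]
  have e3 := e1.symm
  rw [Pi.zero_apply] at e3
  exact_mod_cast e3

/-- The advection by a divergence free field is skew symmetric. -/
theorem inner_adv_self {u w : L2} (hu : HasPd u) (hw : HasPd w) (bu : Bdd u) (bw : Bdd w)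
    (hdiv : divg u = 0) : inner ℝ w (∑ k, prod (advB k) u (pd k w)) = 0 := by
  have h1 : ∀ k, inner ℝ (pd k w) (prod (advB k) u w) =
      -inner ℝ w (prod (advB k) (pd k u) w + prod (advB k) u (pd k w)) := fun k =>
    (hw k).inner_eq ((hu k).prod (hw k) bu bw (advB k))
  have h2 : ∀ k, inner ℝ (pd k w) (prod (advB k) u w) = inner ℝ w (prod (advB k) u (pd k w)) := by
    intro k
    rw [L2.inner_def, L2.inner_def]
    refine integral_congr_ae ?_
    filter_upwards [bu.prod_left (advB k) w, bu.prod_left (advB k) (pd k w)] with x e1 e2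
    rw [e1, e2, advB_apply, advB_apply, inner_smul_right, inner_smul_right, real_inner_comm]
  have h3 : inner ℝ w (∑ k, prod (advB k) (pd k u) w) = 0 := by
    have : ∑ k, prod (advB k) (pd k u) w = 0 := by
      apply Lp.ext
      have ha : ∀ᵐ x, ∀ k, prod (advB k) (pd k u) w x = advB k (pd k u x) (w x) :=
        ae_all_iff.2 fun k => bw.prod_right (advB k) (pd k u)
      filter_upwards [coeFn_finset_sum Finset.univ fun k => prod (advB k) (pd k u) w, ha,
        sum_pd_eq_zero hu hdiv, Lp.coeFn_zero V 2 (volume : Measure V)] with x e1 e2 e3 e4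
      rw [e1, e4]
      simp only [e2, advB_apply]
      rw [← Finset.sum_smul, e3, zero_smul, Pi.zero_apply]
    rw [this, inner_zero_right]
  -- Integration by parts returns the same term with the opposite sign; what remains sums over k to
  -- the divergence of `u`.
  have h4 : ∀ k, 2 * inner ℝ w (prod (advB k) u (pd k w)) =
      -inner ℝ w (prod (advB k) (pd k u) w) := fun k => by
    have := h1 k
    rw [h2, inner_add_right] at this
    linarith
  rw [inner_sum] at h3 ⊢
  have h5 : 2 * ∑ k, inner ℝ w (prod (advB k) u (pd k w)) = 0 := by
    rw [Finset.mul_sum, Finset.sum_congr rfl fun k _ => h4 k, Finset.sum_neg_distrib, h3, neg_zero]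
  linarith

/-! ### Weak differentiability of curves in a Hilbert space -/

section Weak

variable {H : Type*} [NormedAddCommGroup H] [InnerProductSpace ℝ H]

/-- The curve `f` is Lipschitz at `t` within `s` and weakly differentiable there. -/
structure HasWeakDerivWithinAt (f : ℝ → H) (f' : H) (s : Set ℝ) (t : ℝ) : Prop where
  isBigO : (fun r => f r - f t) =O[𝓝[s] t] fun r => r - t
  deriv_inner : ∀ φ, HasDerivWithinAt (fun r => inner ℝ (f r) φ) (inner ℝ f' φ) s t

theorem isBigO_sub_of_hasDerivWithinAt {f : ℝ → H} {f' : H} {s : Set ℝ} {t : ℝ}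
    (h : HasDerivWithinAt f f' s t) : (fun r => f r - f t) =O[𝓝[s] t] fun r => r - t := by
  have h1 := (hasDerivWithinAt_iff_isLittleO.1 h).isBigO
  have h2 : (fun r : ℝ => (r - t) • f') =O[𝓝[s] t] fun r => r - t :=
    Asymptotics.IsBigO.of_bound ‖f'‖ (Eventually.of_forall fun r => by
      rw [norm_smul, mul_comm])
  exact (h1.add h2).congr_left fun r => by abel

theorem hasWeakDerivWithinAt_of_hasDerivWithinAt {f : ℝ → H} {f' : H} {s : Set ℝ} {t : ℝ}
    (h : HasDerivWithinAt f f' s t) : HasWeakDerivWithinAt f f' s t where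
  isBigO := isBigO_sub_of_hasDerivWithinAt h
  deriv_inner φ := by
    have := h.inner ℝ (hasDerivWithinAt_const t s φ)
    simpa using this

theorem HasWeakDerivWithinAt.sub {f g : ℝ → H} {f' g' : H} {s : Set ℝ} {t : ℝ}
    (hf : HasWeakDerivWithinAt f f' s t) (hg : HasWeakDerivWithinAt g g' s t) :
    HasWeakDerivWithinAt (fun r => f r - g r) (f' - g') s t where
  isBigO := by
    refine (hf.isBigO.sub hg.isBigO).congr_left fun r => ?_
    abel
  deriv_inner φ := by
    simp only [inner_sub_left]
    exact (hf.deriv_inner φ).sub (hg.deriv_inner φ)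

theorem HasWeakDerivWithinAt.map_symmetric {f : ℝ → H} {f' : H} {s : Set ℝ} {t : ℝ}
    (hf : HasWeakDerivWithinAt f f' s t) (P : H →L[ℝ] H)
    (hP : ∀ x y, inner ℝ (P x) y = inner ℝ x (P y)) :
    HasWeakDerivWithinAt (fun r => P (f r)) (P f') s t where
  isBigO := by
    simp only [← map_sub]
    exact (P.isBigO_comp _ _).trans hf.isBigO
  deriv_inner φ := by
    simp only [hP]
    exact hf.deriv_inner (P φ)

/-- Expand ‖f(r)‖² = 2⟨f(r), f(t)⟩ + ‖f(r) - f(t)‖² - ‖f(t)‖². The first term is differentiable by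
weak differentiability, and the second is O((r - t)²) by the Lipschitz bound, so strong
differentiability is not needed. -/
theorem HasWeakDerivWithinAt.norm_sq {f : ℝ → H} {f' : H} {s : Set ℝ} {t : ℝ}
    (hf : HasWeakDerivWithinAt f f' s t) :
    HasDerivWithinAt (fun r => ‖f r‖ ^ 2) (2 * inner ℝ (f t) f') s t := by
  have h1 : HasDerivWithinAt (fun r => ‖f r - f t‖ ^ 2) 0 s t := by
    rw [hasDerivWithinAt_iff_isLittleO]
    have h2 : (fun r => ‖f r - f t‖ * ‖f r - f t‖) =O[𝓝[s] t] fun r => (r - t) * (r - t) :=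
      hf.isBigO.norm_left.mul hf.isBigO.norm_left
    have h3 : (fun r : ℝ => (r - t) * (r - t)) =o[𝓝[s] t] fun r => (r - t) := by
      have h4 : (fun r : ℝ => r - t) =o[𝓝[s] t] fun _ => (1 : ℝ) := by
        rw [Asymptotics.isLittleO_one_iff]
        have : Tendsto (fun r : ℝ => r - t) (𝓝 t) (𝓝 (t - t)) :=
          (continuous_id.sub continuous_const).tendsto t
        rw [sub_self] at this
        exact this.mono_left nhdsWithin_le_nhds
      simpa using h4.mul_isBigO (Asymptotics.isBigO_refl (fun r : ℝ => r - t) (𝓝[s] t))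
    refine (h2.trans_isLittleO h3).congr_left fun r => ?_
    simp [sq]
  have h5 := (((hf.deriv_inner (f t)).const_mul 2).add h1).sub_const (‖f t‖ ^ 2)
  rw [add_zero, real_inner_comm] at h5
  refine h5.congr_of_eventuallyEq (Eventually.of_forall fun r => ?_) ?_
  · simp only [Pi.add_apply]
    rw [norm_sub_sq_real]; ring
  · simp only [Pi.add_apply]
    rw [real_inner_self_eq_norm_sq]; simp; ring

/-- Weak differentiability can be tested on a dense set when the derivatives are bounded. -/
theorem hasWeakDerivWithinAt_of_dense {D : Set H} (hD : Dense D) {f f' : ℝ → H} {s : Set ℝ}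
    (hs : Convex ℝ s) {K : ℝ} (hK : ∀ t ∈ s, ‖f' t‖ ≤ K)
    (h : ∀ φ ∈ D, ∀ t ∈ s, HasDerivWithinAt (fun r => inner ℝ (f r) φ) (inner ℝ (f' t) φ) s t)
    {t : ℝ} (ht : t ∈ s) : HasWeakDerivWithinAt f (f' t) s t := by
  have hK0 : 0 ≤ K := (norm_nonneg _).trans (hK t ht)
  -- The mean value inequality bounds the pairing with φ ∈ D by K‖φ‖|r - t|; density extends this to
  -- every φ, and then φ = f(r) - f(t) is chosen.
  have lip : ∀ r ∈ s, ‖f r - f t‖ ≤ K * ‖r - t‖ := by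
    intro r hr
    have h1 : ∀ φ, ‖inner ℝ (f r - f t) φ‖ ≤ K * ‖φ‖ * ‖r - t‖ := by
      intro φ
      refine hD.induction (P := fun φ => ‖inner ℝ (f r - f t) φ‖ ≤ K * ‖φ‖ * ‖r - t‖)
        (fun φ hφ => ?_) (isClosed_le (by fun_prop) (by fun_prop)) φ
      have h2 := hs.norm_image_sub_le_of_norm_hasDerivWithin_le (h φ hφ) (C := K * ‖φ‖)
        (fun x hx => (norm_inner_le_norm _ _).trans (by gcongr; exact hK x hx)) ht hr
      rwa [← inner_sub_left] at h2
    have h2 := h1 (f r - f t)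
    rw [real_inner_self_eq_norm_sq, Real.norm_of_nonneg (sq_nonneg _)] at h2
    rcases eq_or_lt_of_le (norm_nonneg (f r - f t)) with h0 | h0
    · rw [← h0]; positivity
    · refine le_of_mul_le_mul_right ?_ h0
      linarith
  refine ⟨?_, fun φ => ?_⟩
  · exact Asymptotics.IsBigO.of_bound K (eventually_mem_nhdsWithin.mono lip)
  rw [hasDerivWithinAt_iff_isLittleO, Asymptotics.isLittleO_iff]
  intro ε hε
  -- With this radius, replacing φ by ψ costs at most ε/4 in the difference quotient and ε/4 in the
  -- derivative, leaving ε/2 for ψ itself.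
  obtain ⟨ψ, hψ, hd⟩ := Metric.dense_iff.1 hD φ (ε / (4 * (K + 1))) (by positivity)
  have hdist : ‖φ - ψ‖ ≤ ε / (4 * (K + 1)) := by
    rw [← dist_eq_norm, dist_comm]; exact (Metric.mem_ball.1 hψ).le
  have h3 := Asymptotics.isLittleO_iff.1 (hasDerivWithinAt_iff_isLittleO.1 (h ψ hd t ht))
    (c := ε / 2) (by positivity)
  filter_upwards [h3, eventually_mem_nhdsWithin] with r hr hrs
  have e : inner ℝ (f r) φ - inner ℝ (f t) φ - (r - t) • inner ℝ (f' t) φ =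
      (inner ℝ (f r) ψ - inner ℝ (f t) ψ - (r - t) • inner ℝ (f' t) ψ)
      + (inner ℝ (f r - f t) (φ - ψ) - (r - t) * inner ℝ (f' t) (φ - ψ)) := by
    simp only [inner_sub_left, inner_sub_right, smul_eq_mul]; ring
  rw [e]
  have b1 : ‖(inner ℝ (f r - f t) (φ - ψ) : ℝ)‖ ≤ K * ‖r - t‖ * (ε / (4 * (K + 1))) :=
    (norm_inner_le_norm _ _).trans (mul_le_mul (lip r hrs) hdist (norm_nonneg _) (by positivity))
  have b2 : ‖(r - t) * (inner ℝ (f' t) (φ - ψ) : ℝ)‖ ≤ K * ‖r - t‖ * (ε / (4 * (K + 1))) := by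
    rw [norm_mul, mul_comm K, mul_assoc]
    refine mul_le_mul_of_nonneg_left ?_ (norm_nonneg _)
    exact (norm_inner_le_norm _ _).trans (mul_le_mul (hK t ht) hdist (norm_nonneg _) hK0)
  have b3 : K * ‖r - t‖ * (ε / (4 * (K + 1))) ≤ ε / 4 * ‖r - t‖ := by
    have : K * (ε / (4 * (K + 1))) ≤ ε / 4 := by
      rw [mul_div_assoc', div_le_div_iff₀ (by positivity) (by norm_num)]
      nlinarith
    nlinarith [norm_nonneg (r - t)]
  have b4 := norm_sub_le (inner ℝ (f r - f t) (φ - ψ) : ℝ) ((r - t) * (inner ℝ (f' t) (φ - ψ) : ℝ))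
  refine (norm_add_le _ _).trans ?_
  linarith

end Weak

/-! ### Fields in `H³` -/

/-- The Sobolev norm of `H³` as a real number. -/
def n3 (f : L2) : ℝ := (hNorm 3 f).toReal

theorem MemH.memH_pd {s : ℝ} {f : L2} (hf : MemH (s + 1) f) (hs : 0 ≤ s) (k : Fin 3) :
    MemH s (pd k f) :=
  ((isPartial_pd (hf.mono (by linarith)) k).hNorm_le s).trans_lt hf

theorem MemH.bdd {f : L2} (hf : MemH 2 f) : Bdd f :=
  (linfNorm_le hf).trans_lt (ENNReal.mul_lt_top ENNReal.ofReal_lt_top hf)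

theorem MemH.linf_le {f : L2} (hf : MemH 2 f) : linf f ≤ sobolevConst * (hNorm 2 f).toReal := by
  rw [linf, ← ENNReal.toReal_ofReal sobolevConst_nonneg, ← ENNReal.toReal_mul]
  exact ENNReal.toReal_mono (ENNReal.mul_lt_top ENNReal.ofReal_lt_top hf).ne (linfNorm_le hf)

theorem MemH.norm_le {s : ℝ} (hs : 0 ≤ s) {f : L2} (hf : MemH s f) : ‖f‖ ≤ (hNorm s f).toReal := by
  rw [← toReal_enorm]
  exact ENNReal.toReal_mono hf.ne (enorm_le_hNorm hs f)

theorem MemH.toReal_pd_le {s : ℝ} {f : L2} (hf : MemH (s + 1) f) (hs : 0 ≤ s) (k : Fin 3) :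
    (hNorm s (pd k f)).toReal ≤ (hNorm (s + 1) f).toReal :=
  ENNReal.toReal_mono hf.ne ((isPartial_pd (hf.mono (by linarith)) k).hNorm_le s)

/-- The regularity and the bounds provided by the `H³` norm. -/
structure Reg3 (R : ℝ) (f : L2) : Prop where
  hasPd : HasPd f
  hasPd_pd : ∀ k, HasPd (pd k f)
  hasPd_pd_pd : ∀ k l, HasPd (pd l (pd k f))
  bdd : Bdd f
  bdd_pd : ∀ k, Bdd (pd k f)
  linf_le : linf f ≤ sobolevConst * R
  linf_pd_le : ∀ k, linf (pd k f) ≤ sobolevConst * R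
  norm_pd_le : ∀ k, ‖pd k f‖ ≤ R
  norm_pd_pd_le : ∀ k l, ‖pd l (pd k f)‖ ≤ R
  norm_pd_pd_pd_le : ∀ k l j, ‖pd j (pd l (pd k f))‖ ≤ R

theorem MemH.reg3 {f : L2} (hf : MemH 3 f) {R : ℝ} (hR : n3 f ≤ R) : Reg3 R f := by
  have h1 : ∀ k, MemH 2 (pd k f) := fun k => MemH.memH_pd (by norm_num; exact hf) (by norm_num) k
  have h2 : ∀ k l, MemH 1 (pd l (pd k f)) := fun k l =>
    MemH.memH_pd (by norm_num; exact h1 k) (by norm_num) l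
  have h3 : ∀ k l j, MemH 0 (pd j (pd l (pd k f))) := fun k l j =>
    MemH.memH_pd (by norm_num; exact h2 k l) le_rfl j
  have r1 : ∀ k, (hNorm 2 (pd k f)).toReal ≤ R := fun k => by
    have := MemH.toReal_pd_le (s := 2) (f := f) (by norm_num; exact hf) (by norm_num) k
    norm_num at this
    exact this.trans hR
  have r2 : ∀ k l, (hNorm 1 (pd l (pd k f))).toReal ≤ R := fun k l => by
    have := MemH.toReal_pd_le (s := 1) (f := pd k f) (by norm_num; exact h1 k) (by norm_num) l
    norm_num at this
    exact this.trans (r1 k)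
  have r3 : ∀ k l j, (hNorm 0 (pd j (pd l (pd k f)))).toReal ≤ R := fun k l j => by
    have := MemH.toReal_pd_le (s := 0) (f := pd l (pd k f)) (by norm_num; exact h2 k l) le_rfl j
    norm_num at this
    exact this.trans (r2 k l)
  have hS := sobolevConst_nonneg
  have m2 : MemH 2 f := hf.mono (by norm_num)
  exact
    { hasPd := (hf.mono (by norm_num)).hasPd
      hasPd_pd := fun k => ((h1 k).mono (by norm_num)).hasPd
      hasPd_pd_pd := fun k l => (h2 k l).hasPd
      bdd := m2.bdd
      bdd_pd := fun k => (h1 k).bdd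
      linf_le := m2.linf_le.trans (mul_le_mul_of_nonneg_left
        ((ENNReal.toReal_mono hf.ne (hNorm_mono (by norm_num) f)).trans hR) hS)
      linf_pd_le := fun k => (h1 k).linf_le.trans (mul_le_mul_of_nonneg_left (r1 k) hS)
      norm_pd_le := fun k => ((h1 k).norm_le (by norm_num)).trans (r1 k)
      norm_pd_pd_le := fun k l => ((h2 k l).norm_le (by norm_num)).trans (r2 k l)
      norm_pd_pd_pd_le := fun k l j => ((h3 k l j).norm_le le_rfl).trans (r3 k l j) }

theorem Reg3.hasPd_curl {R : ℝ} {f : L2} (h : Reg3 R f) : HasPd (curl f) := by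
  rw [curl_eq]; exact HasPd.sum fun k _ => (h.hasPd_pd k).mapL _

theorem Bdd.norm_cross_right_le {g : L2} (hg : Bdd g) (f : L2) : ‖cross f g‖ ≤ linf g * ‖f‖ := by
  refine (hg.norm_prod_right_le crossB f).trans ?_
  have := linf_nonneg g
  have := norm_crossB_le
  gcongr
  nlinarith

theorem Bdd.norm_cross_left_le {f : L2} (hf : Bdd f) (g : L2) : ‖cross f g‖ ≤ linf f * ‖g‖ := by
  refine (hf.norm_prod_left_le crossB g).trans ?_
  have := linf_nonneg f
  have := norm_crossB_le
  gcongr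
  nlinarith

theorem Bdd.norm_advB_left_le {f : L2} (hf : Bdd f) (k : Fin 3) (g : L2) :
    ‖prod (advB k) f g‖ ≤ linf f * ‖g‖ := by
  refine (hf.norm_prod_left_le (advB k) g).trans ?_
  have := linf_nonneg f
  have := norm_advB_le k
  gcongr
  nlinarith

theorem Bdd.norm_advB_right_le {g : L2} (hg : Bdd g) (k : Fin 3) (f : L2) :
    ‖prod (advB k) f g‖ ≤ linf g * ‖f‖ := by
  refine (hg.norm_prod_right_le (advB k) f).trans ?_
  have := linf_nonneg g
  have := norm_advB_le k
  gcongr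
  nlinarith

theorem isPartial_cross {k : Fin 3} {f f' g g' : L2} (hf : IsPartial k f f') (hg : IsPartial k g g')
    (bf : Bdd f) (bg : Bdd g) : IsPartial k (cross f g) (cross f' g + cross f g') :=
  hf.prod hg bf bg crossB

/-- The field `∇ × B - u × B`, whose Leray projection is the electric field of the limit. -/
def ohm (u B : L2) : L2 := curl B - cross u B

theorem eBar_eq (u B : L2) : eBar u B = leray (ohm u B) := rfl

/-- The second derivatives of `ohm u B` are bounded in terms of the `H³` norms. -/
theorem ohm_reg {R : ℝ} (hR : 0 ≤ R) {u B : L2} (hu : Reg3 R u) (hB : Reg3 R B) :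
    HasPd (cross u B) ∧ HasPd (ohm u B) ∧ HasPd (curl (ohm u B)) ∧
      ‖curl (ohm u B)‖ ≤ 3 * (3 * R + 2 * (sobolevConst * R * R)) ∧
      ‖curl (curl (ohm u B))‖ ≤ 9 * (3 * R + 4 * (sobolevConst * R * R)) := by
  have hS := sobolevConst_nonneg
  have c1 : ∀ k, IsPartial k (cross u B) (cross (pd k u) B + cross u (pd k B)) := fun k =>
    isPartial_cross (hu.hasPd k) (hB.hasPd k) hu.bdd hB.bdd
  have c2 : ∀ k l, IsPartial l (cross (pd k u) B + cross u (pd k B))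
      ((cross (pd l (pd k u)) B + cross (pd k u) (pd l B))
        + (cross (pd l u) (pd k B) + cross u (pd l (pd k B)))) := fun k l =>
    (isPartial_cross (hu.hasPd_pd k l) (hB.hasPd l) (hu.bdd_pd k) hB.bdd).add
      (isPartial_cross (hu.hasPd l) (hB.hasPd_pd k l) hu.bdd (hB.bdd_pd k))
  have d1 : ∀ k, IsPartial k (curl B) (∑ j, mapL (rot j) (pd k (pd j B))) := fun k => by
    rw [curl_eq]; exact IsPartial.sum _ fun j _ => (hB.hasPd_pd j k).mapL _
  have d2 : ∀ k l, IsPartial l (∑ j, mapL (rot j) (pd k (pd j B)))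
      (∑ j, mapL (rot j) (pd l (pd k (pd j B)))) := fun k l =>
    IsPartial.sum _ fun j _ => (hB.hasPd_pd_pd j k l).mapL _
  have hF : ∀ k, IsPartial k (ohm u B) _ := fun k => (d1 k).sub (c1 k)
  have hF2 : ∀ k l, IsPartial l (pd k (ohm u B)) _ := fun k l => by
    rw [(hF k).pd_eq]; exact (d2 k l).sub (c2 k l)
  have hFpd : ∀ k, HasPd (pd k (ohm u B)) := fun k => hasPd_of (hF2 k)
  have hsum : ∀ (F : Fin 3 → L2), (∀ j, ‖F j‖ ≤ R) → ‖∑ j, mapL (rot j) (F j)‖ ≤ 3 * R := by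
    intro F h
    refine (norm_sum_le _ _).trans ?_
    have : ∀ j, ‖mapL (rot j) (F j)‖ ≤ R := fun j =>
      (norm_mapL_le _ (norm_rot_le j) _).trans (h j)
    rw [Fin.sum_univ_three]
    linarith [this 0, this 1, this 2]
  have hcl : ∀ f g : L2, Bdd f → linf f ≤ sobolevConst * R → ‖g‖ ≤ R →
      ‖cross f g‖ ≤ sobolevConst * R * R := fun f g bf h1 h2 =>
    (bf.norm_cross_left_le g).trans (mul_le_mul h1 h2 (norm_nonneg _) (by positivity))
  have hcr : ∀ f g : L2, Bdd g → linf g ≤ sobolevConst * R → ‖f‖ ≤ R →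
      ‖cross f g‖ ≤ sobolevConst * R * R := fun f g bg h1 h2 =>
    (bg.norm_cross_right_le f).trans (mul_le_mul h1 h2 (norm_nonneg _) (by positivity))
  -- The curl contributes 3R. The product rule contributes two terms for one derivative and four for
  -- two; in each of them some factor carries at most one derivative and is therefore bounded, H³
  -- embedding into W^{1,∞}.
  have n1 : ∀ k, ‖pd k (ohm u B)‖ ≤ 3 * R + 2 * (sobolevConst * R * R) := fun k => by
    rw [(hF k).pd_eq]
    refine (norm_sub_le _ _).trans ?_
    have := hsum _ fun j => hB.norm_pd_pd_le j k
    have h1 := norm_add_le (cross (pd k u) B) (cross u (pd k B))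
    have h2 := hcr (pd k u) B hB.bdd hB.linf_le (hu.norm_pd_le k)
    have h3 := hcl u (pd k B) hu.bdd hu.linf_le (hB.norm_pd_le k)
    linarith
  have n2 : ∀ k l, ‖pd l (pd k (ohm u B))‖ ≤ 3 * R + 4 * (sobolevConst * R * R) := fun k l => by
    rw [(hF2 k l).pd_eq]
    refine (norm_sub_le _ _).trans ?_
    have := hsum _ fun j => hB.norm_pd_pd_pd_le j k l
    have h0 := norm_add_le (cross (pd l (pd k u)) B + cross (pd k u) (pd l B))
      (cross (pd l u) (pd k B) + cross u (pd l (pd k B)))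
    have h1 := norm_add_le (cross (pd l (pd k u)) B) (cross (pd k u) (pd l B))
    have h1' := norm_add_le (cross (pd l u) (pd k B)) (cross u (pd l (pd k B)))
    have h2 := hcr (pd l (pd k u)) B hB.bdd hB.linf_le (hu.norm_pd_pd_le k l)
    have h3 := hcl (pd k u) (pd l B) (hu.bdd_pd k) (hu.linf_pd_le k) (hB.norm_pd_le l)
    have h4 := hcl (pd l u) (pd k B) (hu.bdd_pd l) (hu.linf_pd_le l) (hB.norm_pd_le k)
    have h5 := hcl u (pd l (pd k B)) hu.bdd hu.linf_le (hB.norm_pd_pd_le k l)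
    linarith
  have hcurl : ∀ l, IsPartial l (curl (ohm u B)) (∑ k, mapL (rot k) (pd l (pd k (ohm u B)))) :=
    fun l => by rw [curl_eq]; exact IsPartial.sum _ fun k _ => (hFpd k l).mapL _
  refine ⟨hasPd_of c1, hasPd_of hF, hasPd_of hcurl, ?_, ?_⟩
  · refine (norm_curl_le _).trans ?_
    rw [Fin.sum_univ_three]
    linarith [n1 0, n1 1, n1 2]
  · refine (norm_curl_le _).trans ?_
    have : ∀ l, ‖pd l (curl (ohm u B))‖ ≤ 3 * (3 * R + 4 * (sobolevConst * R * R)) := fun l => by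
      rw [(hcurl l).pd_eq]
      refine (norm_sum_le _ _).trans ?_
      have h : ∀ k, ‖mapL (rot k) (pd l (pd k (ohm u B)))‖ ≤ 3 * R + 4 * (sobolevConst * R * R) :=
        fun k => (norm_mapL_le _ (norm_rot_le k) _).trans (n2 k l)
      rw [Fin.sum_univ_three]
      linarith [h 0, h 1, h 2]
    rw [Fin.sum_univ_three]
    linarith [this 0, this 1, this 2]

/-! ### Curves of fields -/

theorem ContH.continuousOn {s T : ℝ} (hs : 0 ≤ s) {f : ℝ → L2} (h : ContH s T f) :
    ContinuousOn f (Icc 0 T) := by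
  intro t ht
  rw [ContinuousWithinAt, tendsto_iff_edist_tendsto_0]
  refine tendsto_of_tendsto_of_tendsto_of_le_of_le tendsto_const_nhds (h t ht).2
    (fun _ => zero_le) fun r => ?_
  rw [edist_eq_enorm_sub]
  exact enorm_le_hNorm hs _

theorem ContH.tendsto_linf {s T : ℝ} (hs : 2 ≤ s) {f : ℝ → L2} (h : ContH s T f) {t : ℝ}
    (ht : t ∈ Icc 0 T) : Tendsto (fun r => linf (f r - f t)) (𝓝[Icc 0 T] t) (𝓝 0) := by
  have h1 : Tendsto (fun r => sobolevConst * (hNorm s (f r - f t)).toReal) (𝓝[Icc 0 T] t) (𝓝 0) := by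
    have := ((ENNReal.tendsto_toReal ENNReal.zero_ne_top).comp (h t ht).2).const_mul sobolevConst
    simpa using this
  refine tendsto_of_tendsto_of_tendsto_of_le_of_le' tendsto_const_nhds h1
    (Eventually.of_forall fun r => linf_nonneg _) ?_
  filter_upwards [(h t ht).2.eventually_lt_const ENNReal.zero_lt_top] with r hr
  have hm : MemH s (f r - f t) := hr
  exact (hm.mono hs).linf_le.trans (mul_le_mul_of_nonneg_left
    (ENNReal.toReal_mono hm.ne (hNorm_mono hs _)) sobolevConst_nonneg)

/-- The cross product is not a bounded bilinear map of L², so the usual rule is unavailable. With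
one factor frozen it is a bounded operator; the remaining product of increments is at most ‖B(r) -
B(t)‖_∞ ‖u(r) - u(t)‖, an o(1) times an O(r - t). -/
theorem hasDerivWithinAt_cross {u B : ℝ → L2} {u' B' : L2} {s : Set ℝ} {t : ℝ} (hts : t ∈ s)
    (hu : HasDerivWithinAt u u' s t) (hB : HasDerivWithinAt B B' s t)
    (bu : ∀ r ∈ s, Bdd (u r)) (bB : ∀ r ∈ s, Bdd (B r))
    (hlim : Tendsto (fun r => linf (B r - B t)) (𝓝[s] t) (𝓝 0)) :
    HasDerivWithinAt (fun r => cross (u r) (B r)) (cross u' (B t) + cross (u t) B') s t := by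
  have h1 : HasDerivWithinAt (fun r => prod crossB (u r) (B t)) (prod crossB u' (B t)) s t :=
    (prodL crossB (bB t hts)).hasFDerivAt.comp_hasDerivWithinAt t hu
  have h2 : HasDerivWithinAt (fun r => prod crossB (u t) (B r)) (prod crossB (u t) B') s t :=
    (prodL crossB.flip (bu t hts)).hasFDerivAt.comp_hasDerivWithinAt t hB
  have h3 : HasDerivWithinAt (fun r => cross (u r - u t) (B r - B t)) 0 s t := by
    rw [hasDerivWithinAt_iff_isLittleO]
    have h4 : (fun r => linf (B r - B t) * ‖u r - u t‖) =o[𝓝[s] t] fun r => 1 * (r - t) :=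
      ((Asymptotics.isLittleO_one_iff ℝ).2 hlim).mul_isBigO (isBigO_sub_of_hasDerivWithinAt hu).norm_left
    simp only [one_mul] at h4
    refine Asymptotics.IsBigO.trans_isLittleO ?_ h4
    refine Asymptotics.IsBigO.of_bound 1 ?_
    filter_upwards [eventually_mem_nhdsWithin] with r hr
    have h0 : cross (u t - u t) (B t - B t) = 0 := by
      rw [← norm_le_zero_iff]
      have := ((bB t hts).sub (bB t hts)).norm_cross_right_le (u t - u t)
      simpa using this
    rw [h0, sub_zero, smul_zero, sub_zero, one_mul, Real.norm_of_nonneg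
      (mul_nonneg (linf_nonneg _) (norm_nonneg _))]
    exact ((bB r hr).sub (bB t hts)).norm_cross_right_le _
  have h4 := ((h1.add h2).add h3).sub_const (cross (u t) (B t))
  rw [add_zero] at h4
  have key : ∀ r ∈ s, cross (u r) (B r) = prod crossB (u r) (B t) + prod crossB (u t) (B r)
      + cross (u r - u t) (B r - B t) - cross (u t) (B t) := fun r hr => by
    have e : cross (u r - u t) (B r - B t) = cross (u r) (B r) - cross (u r) (B t)
        - (cross (u t) (B r) - cross (u t) (B t)) := by
      simp only [cross_eq]
      rw [prod_sub_left _ ((bB r hr).sub (bB t hts)), prod_sub_right _ (bu r hr),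
        prod_sub_right _ (bu t hts)]
    rw [e]
    simp only [cross_eq]
    abel
  exact h4.congr key (key t hts)

theorem dense_hasPd : Dense {φ : L2 | HasPd φ} := by
  have h : DenseRange (SchwartzMap.toLpCLM ℝ V 2 (volume : Measure V)) :=
    SchwartzMap.denseRange_toLpCLM (by norm_num)
  refine h.mono ?_
  rintro _ ⟨φ, rfl⟩
  exact hasPd_of fun k => isPartial_tst k φ

theorem prod_sub_right_of_bdd (β : V →L[ℝ] V →L[ℝ] V) (f : L2) {g₁ g₂ : L2} (h₁ : Bdd g₁)
    (h₂ : Bdd g₂) : prod β f (g₁ - g₂) = prod β f g₁ - prod β f g₂ := Lp.ext (by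
  filter_upwards [(h₁.sub h₂).prod_right β f, h₁.prod_right β f, h₂.prod_right β f,
    Lp.coeFn_sub g₁ g₂, Lp.coeFn_sub (prod β f g₁) (prod β f g₂)] with x e1 e2 e3 e4 e5
  rw [e1, e5, Pi.sub_apply, e2, e3, e4]; simp)

/-! ### The limit system -/

theorem divg_eq_zero_of_leray {f : L2} (h : leray f = f) : divg f = 0 :=
  Submodule.starProjection_eq_self_iff.1 h

/-- The constraint reads ℙf = f; differentiating it and using uniqueness of the derivative gives ℙf'
= f'. -/
theorem divg_deriv {T : ℝ} (hT : 0 < T) {f : ℝ → L2} {f' : L2} {t : ℝ} (ht : t ∈ Icc 0 T)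
    (hf : HasDerivWithinAt f f' (Icc 0 T) t) (hdiv : ∀ r ∈ Icc 0 T, divg (f r) = 0) :
    divg f' = 0 := by
  have h1 : HasDerivWithinAt (fun r => leray (f r)) (leray f') (Icc 0 T) t :=
    leray.hasFDerivAt.comp_hasDerivWithinAt t hf
  have h2 : HasDerivWithinAt f (leray f') (Icc 0 T) t :=
    h1.congr (fun r hr => (leray_eq_self (hdiv r hr)).symm) (leray_eq_self (hdiv t ht)).symm
  exact divg_eq_zero_of_leray ((uniqueDiffOn_Icc hT t ht).eq_deriv _ h2 hf)

theorem adv_eq_of_bdd {u : L2} (hu : Bdd u) (v : L2) :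
    adv u v = ∑ k, prod (advB k) u (pd k v) := adv_eq fun _ => hu.memLp_left _ _

theorem norm_curl_le_of_reg {R : ℝ} {f : L2} (hf : Reg3 R f) : ‖curl f‖ ≤ 3 * R := by
  refine (norm_curl_le f).trans ?_
  rw [Fin.sum_univ_three]
  linarith [hf.norm_pd_le 0, hf.norm_pd_le 1, hf.norm_pd_le 2]

/-- A bound for the time derivative of `Ē`. -/
def eBarDerivBound (R : ℝ) : ℝ :=
  9 * (3 * R + 4 * (sobolevConst * R * R)) + (sobolevConst * R * (6 * (sobolevConst * R * R))
    + sobolevConst * R * (3 * (3 * R + 2 * (sobolevConst * R * R))))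

theorem eBarDerivBound_nonneg {R : ℝ} (hR : 0 ≤ R) : 0 ≤ eBarDerivBound R := by
  have := sobolevConst_nonneg
  unfold eBarDerivBound; positivity

section MHD

variable {m : ℕ} {T R : ℝ} {u B : ℝ → L2} {u₀ B₀ : L2}

/-- Since ΔB = -∇×∇×B for a divergence free field, the induction equation takes the form of
Faraday's law with electric field `ohm u B`. -/
theorem IsMHDSolution.deriv_B (h : IsMHDSolution m T u B u₀ B₀) (hR : 0 ≤ R)
    (ru : ∀ t ∈ Icc 0 T, Reg3 R (u t)) (rB : ∀ t ∈ Icc 0 T, Reg3 R (B t)) :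
    HasTimeDeriv T B (fun t => -curl (ohm (u t) (B t))) := by
  obtain ⟨B', hB, e⟩ := h.induction_eq
  intro t ht
  have h1 : B' t = -curl (ohm (u t) (B t)) := by
    have e1 := e t ht
    have hc := curl_curl (rB t ht).hasPd (rB t ht).hasPd_pd (h.div_B t ht)
    rw [ohm, curl_sub (rB t ht).hasPd_curl (ohm_reg hR (ru t ht) (rB t ht)).1, hc]
    rw [sub_eq_iff_eq_add] at e1
    rw [e1]; abel
  have h2 := hB t ht
  rw [h1] at h2
  exact h2

/-- Pairing the equation with the divergence free u' removes the pressure, so ‖u'‖ is at most the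
norm of the Lorentz force minus the advection; each of the two contributes 3 to the factor 6. -/
theorem IsMHDSolution.norm_deriv_u_le (h : IsMHDSolution m T u B u₀ B₀) (hT : 0 < T) (hR : 0 ≤ R)
    (ru : ∀ t ∈ Icc 0 T, Reg3 R (u t)) (rB : ∀ t ∈ Icc 0 T, Reg3 R (B t)) {t : ℝ}
    (ht : t ∈ Icc 0 T) {u' : L2} (hu : HasDerivWithinAt u u' (Icc 0 T) t) :
    ‖u'‖ ≤ 6 * (sobolevConst * R * R) := by
  have hS := sobolevConst_nonneg
  obtain ⟨v', gradp, p, hv, e⟩ := h.momentum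
  have huv : u' = v' t := (uniqueDiffOn_Icc hT t ht).eq_deriv _ hu (hv t ht)
  obtain ⟨hg, e⟩ := e t ht
  rw [← huv] at e
  have hdiv := divg_deriv hT ht hu h.div_u
  have h1 : inner ℝ u' u' = inner ℝ u' (cross (curl (B t)) (B t) - adv (u t) (u t)) := by
    have h2 : u' = cross (curl (B t)) (B t) - adv (u t) (u t) - gradp t := by
      rw [← e]; abel
    have h3 := hg.inner_eq_zero hdiv
    calc inner ℝ u' u' = inner ℝ u' (cross (curl (B t)) (B t) - adv (u t) (u t) - gradp t) := by
          rw [← h2]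
      _ = _ := by rw [inner_sub_right, h3, sub_zero]
  have h2 : ‖cross (curl (B t)) (B t) - adv (u t) (u t)‖ ≤ 6 * (sobolevConst * R * R) := by
    refine (norm_sub_le _ _).trans ?_
    have a1 : ‖cross (curl (B t)) (B t)‖ ≤ sobolevConst * R * (3 * R) :=
      ((rB t ht).bdd.norm_cross_right_le _).trans
        (mul_le_mul (rB t ht).linf_le (norm_curl_le_of_reg (rB t ht)) (norm_nonneg _)
          (by positivity))
    have a2 : ‖adv (u t) (u t)‖ ≤ 3 * (sobolevConst * R * R) := by
      rw [adv_eq_of_bdd (ru t ht).bdd]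
      refine (norm_sum_le _ _).trans ?_
      have : ∀ k, ‖prod (advB k) (u t) (pd k (u t))‖ ≤ sobolevConst * R * R := fun k =>
        ((ru t ht).bdd.norm_advB_left_le k _).trans
          (mul_le_mul (ru t ht).linf_le ((ru t ht).norm_pd_le k) (norm_nonneg _) (by positivity))
      rw [Fin.sum_univ_three]
      linarith [this 0, this 1, this 2]
    linarith
  rw [real_inner_self_eq_norm_sq] at h1
  have h3 := real_inner_le_norm u' (cross (curl (B t)) (B t) - adv (u t) (u t))
  rcases eq_or_lt_of_le (norm_nonneg u') with h0 | h0
  · rw [← h0]; positivity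
  · refine le_of_mul_le_mul_left ?_ h0
    nlinarith

/-- The electric field of the limit is Lipschitz and weakly differentiable in time. -/
theorem IsMHDSolution.eBar_deriv (h : IsMHDSolution m T u B u₀ B₀) (hm : 3 ≤ m) (hT : 0 < T)
    (hR : 0 ≤ R) (ru : ∀ t ∈ Icc 0 T, Reg3 R (u t)) (rB : ∀ t ∈ Icc 0 T, Reg3 R (B t)) {t : ℝ}
    (ht : t ∈ Icc 0 T) : ∃ e' : L2, ‖e'‖ ≤ eBarDerivBound R ∧
      HasWeakDerivWithinAt (fun r => eBar (u r) (B r)) e' (Icc 0 T) t := by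
  have hS := sobolevConst_nonneg
  have hB := h.deriv_B hR ru rB
  obtain ⟨u', gradp, p, hu, -⟩ := h.momentum
  -- `B` is differentiable in L², which does not differentiate ∇×B directly. Against a test field
  -- the curl is moved to the test field, the curve is differentiated, and the curl is moved back
  -- onto the derivative.
  have hcurl : HasWeakDerivWithinAt (fun r => curl (B r)) (-curl (curl (ohm (u t) (B t))))
      (Icc 0 T) t := by
    refine hasWeakDerivWithinAt_of_dense dense_hasPd (convex_Icc 0 T)
      (f' := fun t => -curl (curl (ohm (u t) (B t))))
      (K := 9 * (3 * R + 4 * (sobolevConst * R * R))) (fun r hr => ?_) (fun φ hφ r hr => ?_) ht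
    · rw [norm_neg]; exact (ohm_reg hR (ru r hr) (rB r hr)).2.2.2.2
    · have h1 : HasDerivWithinAt (fun r => inner ℝ (B r) (curl φ))
          (inner ℝ (-curl (ohm (u r) (B r))) (curl φ)) (Icc 0 T) r := by
        have := (hB r hr).inner ℝ (hasDerivWithinAt_const r (Icc 0 T) (curl φ))
        simpa using this
      rw [inner_neg_left, ← inner_curl (ohm_reg hR (ru r hr) (rB r hr)).2.2.1 hφ,
        ← inner_neg_left] at h1
      exact h1.congr (fun q hq => inner_curl (rB q hq).hasPd hφ) (inner_curl (rB r hr).hasPd hφ)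
  have hcross := hasDerivWithinAt_cross ht (hu t ht) (hB t ht) (fun r hr => (ru r hr).bdd)
    (fun r hr => (rB r hr).bdd) (h.cont_B.tendsto_linf (by exact_mod_cast (by omega : 2 ≤ m)) ht)
  refine ⟨_, ?_, (hcurl.sub (hasWeakDerivWithinAt_of_hasDerivWithinAt hcross)).map_symmetric leray
    inner_leray⟩
  refine (norm_leray_le _).trans ((norm_sub_le _ _).trans ?_)
  unfold eBarDerivBound
  have reg := ohm_reg hR (ru t ht) (rB t ht)
  have a1 : ‖cross (u' t) (B t)‖ ≤ sobolevConst * R * (6 * (sobolevConst * R * R)) :=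
    ((rB t ht).bdd.norm_cross_right_le _).trans
      (mul_le_mul (rB t ht).linf_le (h.norm_deriv_u_le hT hR ru rB ht (hu t ht)) (norm_nonneg _)
        (by positivity))
  have a2 : ‖cross (u t) (-curl (ohm (u t) (B t)))‖
      ≤ sobolevConst * R * (3 * (3 * R + 2 * (sobolevConst * R * R))) :=
    ((ru t ht).bdd.norm_cross_left_le _).trans
      (mul_le_mul (ru t ht).linf_le (by rw [norm_neg]; exact reg.2.2.2.1) (norm_nonneg _)
        (by positivity))
  rw [norm_neg]
  gcongr
  · exact reg.2.2.2.2
  · exact (norm_add_le _ _).trans (add_le_add a1 a2)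

end MHD

/-! ### The energy identity -/

section Energy

variable {m : ℕ} {c T R : ℝ} {u B E ubar Bbar : ℝ → L2} {u₀c B₀c E₀c u₀ B₀ : L2}

/-- The error of the electric field, with the initial layer removed. -/
def errE (c : ℝ) (E ubar Bbar : ℝ → L2) (ε₀ : L2) (t : ℝ) : L2 :=
  c • E t - (eBar (ubar t) (Bbar t) + Real.exp (-c ^ 2 * t) • ε₀)

/-- The error of the current, with the initial layer removed. -/
def errJ (c : ℝ) (u B E Bbar : ℝ → L2) (ε₀ : L2) (t : ℝ) : L2 :=
  current c (u t) (E t) (B t) - (curl (Bbar t) + Real.exp (-c ^ 2 * t) • ε₀)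

/-- The modulated energy. -/
def modEnergy (c : ℝ) (u B E ubar Bbar : ℝ → L2) (ε₀ : L2) (t : ℝ) : ℝ :=
  ‖u t - ubar t‖ ^ 2 + ‖B t - Bbar t‖ ^ 2 + 1 / c ^ 2 * ‖errE c E ubar Bbar ε₀ t‖ ^ 2

theorem IsEulerMaxwellSolution.bdd (h : IsEulerMaxwellSolution m c T u B E u₀c B₀c E₀c)
    (hm : 3 ≤ m) {t : ℝ} (ht : t ∈ Icc 0 T) :
    HasPd (u t) ∧ HasPd (B t) ∧ HasPd (E t) ∧ Bdd (u t) ∧ Bdd (B t) := by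
  have h2 : (2 : ℝ) ≤ m := by exact_mod_cast (by omega : 2 ≤ m)
  have h1 : (1 : ℝ) ≤ m := by linarith
  exact ⟨((h.cont_u t ht).1.mono h1).hasPd, ((h.cont_B t ht).1.mono h1).hasPd,
    ((h.cont_E t ht).1.mono h1).hasPd, ((h.cont_u t ht).1.mono h2).bdd,
    ((h.cont_B t ht).1.mono h2).bdd⟩

/-- The field ∇×B̄ is divergence free, hence its own projection, so both systems satisfy the same
Ohm law; the layers cancel in the difference. -/
theorem errJ_eq {ε₀ : L2} {t : ℝ} (bB : Bdd (B t)) (bu : Bdd (ubar t)) (rB : HasPd (Bbar t)) :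
    errJ c u B E Bbar ε₀ t = errE c E ubar Bbar ε₀ t
      + leray (cross (u t - ubar t) (B t) + cross (ubar t) (B t - Bbar t)) := by
  have h1 : cross (u t - ubar t) (B t) + cross (ubar t) (B t - Bbar t)
      = cross (u t) (B t) - cross (ubar t) (Bbar t) := by
    simp only [cross_eq]
    rw [prod_sub_left _ bB, prod_sub_right _ bu]
    abel
  rw [h1, errJ, errE, eBar, map_sub, map_sub, leray_eq_self (divg_curl rB), current]
  abel

theorem norm_errJ_sub_errE_le {ε₀ : L2} {t : ℝ} (bB : Bdd (B t)) (ru : Reg3 R (ubar t))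
    (rB : HasPd (Bbar t)) : ‖errJ c u B E Bbar ε₀ t - errE c E ubar Bbar ε₀ t‖
      ≤ linf (B t) * ‖u t - ubar t‖ + sobolevConst * R * ‖B t - Bbar t‖ := by
  rw [errJ_eq bB ru.bdd rB, add_sub_cancel_left]
  refine (norm_leray_le _).trans ((norm_add_le _ _).trans (add_le_add ?_ ?_))
  · exact bB.norm_cross_right_le _
  · exact (ru.bdd.norm_cross_left_le _).trans
      (mul_le_mul_of_nonneg_right ru.linf_le (norm_nonneg _))

/-- The pressures drop out because w is divergence free. Writing the advection difference as u·∇w +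
w·∇ū removes its first part by skew symmetry. The Lorentz force is split so that b is paired with j,
and j - j̄ with the bounded B̄. -/
theorem velocity_work (hT : 0 < T) (hem : IsEulerMaxwellSolution m c T u B E u₀c B₀c E₀c)
    (hmhd : IsMHDSolution m T ubar Bbar u₀ B₀) (hm : 3 ≤ m)
    (ru : ∀ t ∈ Icc 0 T, Reg3 R (ubar t)) (rB : ∀ t ∈ Icc 0 T, Reg3 R (Bbar t)) {t : ℝ}
    (ht : t ∈ Icc 0 T) {u' v' : L2} (hu : HasDerivWithinAt u u' (Icc 0 T) t)
    (hv : HasDerivWithinAt ubar v' (Icc 0 T) t) :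
    inner ℝ (u t - ubar t) (u' - v') =
      inner ℝ (u t - ubar t) (cross (current c (u t) (E t) (B t)) (B t - Bbar t))
      + inner ℝ (u t - ubar t)
          (cross (current c (u t) (E t) (B t) - curl (Bbar t)) (Bbar t))
      - inner ℝ (u t - ubar t) (∑ k, prod (advB k) (u t - ubar t) (pd k (ubar t))) := by
  obtain ⟨pu, pB, pE, bu, bB⟩ := hem.bdd hm ht
  obtain ⟨a', g, p, ha, e⟩ := hem.euler
  obtain ⟨b', gb, pb, hb, eb⟩ := hmhd.momentum
  obtain ⟨hg, e⟩ := e t ht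
  obtain ⟨hgb, eb⟩ := eb t ht
  rw [← (uniqueDiffOn_Icc hT t ht).eq_deriv _ hu (ha t ht)] at e
  rw [← (uniqueDiffOn_Icc hT t ht).eq_deriv _ hv (hb t ht)] at eb
  have hw : divg (u t - ubar t) = 0 := by
    rw [map_sub, hem.div_u t ht, hmhd.div_u t ht, sub_zero]
  have e1 : u' = cross (current c (u t) (E t) (B t)) (B t) - adv (u t) (u t) - g t := by
    rw [← e]; abel
  have e2 : v' = cross (curl (Bbar t)) (Bbar t) - adv (ubar t) (ubar t) - gb t := by
    rw [← eb]; abel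
  have c1 : cross (current c (u t) (E t) (B t)) (B t) - cross (curl (Bbar t)) (Bbar t) =
      cross (current c (u t) (E t) (B t)) (B t - Bbar t)
      + cross (current c (u t) (E t) (B t) - curl (Bbar t)) (Bbar t) := by
    simp only [cross_eq]
    rw [prod_sub_right_of_bdd _ _ bB (rB t ht).bdd, prod_sub_left _ (rB t ht).bdd]
    abel
  have c2 : adv (u t) (u t) - adv (ubar t) (ubar t) =
      (∑ k, prod (advB k) (u t) (pd k (u t - ubar t)))
      + ∑ k, prod (advB k) (u t - ubar t) (pd k (ubar t)) := by
    rw [adv_eq_of_bdd bu, adv_eq_of_bdd (ru t ht).bdd, ← Finset.sum_sub_distrib,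
      ← Finset.sum_add_distrib]
    refine Finset.sum_congr rfl fun k _ => ?_
    rw [pd_sub pu (ru t ht).hasPd, prod_sub_right _ bu, prod_sub_left _ ((ru t ht).bdd_pd k)]
    abel
  have c3 : u' - v' = (cross (current c (u t) (E t) (B t)) (B t) - cross (curl (Bbar t)) (Bbar t))
      - (adv (u t) (u t) - adv (ubar t) (ubar t)) - g t + gb t := by
    rw [e1, e2]; abel
  rw [c3, c1, c2, inner_add_right, inner_sub_right, inner_sub_right, inner_add_right,
    inner_add_right, hg.inner_eq_zero hw, hgb.inner_eq_zero hw,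
    inner_adv_self pu (pu.sub (ru t ht).hasPd) bu (bu.sub (ru t ht).bdd) (hem.div_u t ht)]
  ring

/-- The curl of b is divergence free, so in the pairing with it `ohm` may be replaced by its
projection Ē. -/
theorem magnetic_work (hc : 0 < c) (hT : 0 < T)
    (hem : IsEulerMaxwellSolution m c T u B E u₀c B₀c E₀c)
    (hmhd : IsMHDSolution m T ubar Bbar u₀ B₀) (hm : 3 ≤ m) (hR : 0 ≤ R)
    (ru : ∀ t ∈ Icc 0 T, Reg3 R (ubar t)) (rB : ∀ t ∈ Icc 0 T, Reg3 R (Bbar t)) {t : ℝ}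
    (ht : t ∈ Icc 0 T) {a' b' : L2} (ha : HasDerivWithinAt B a' (Icc 0 T) t)
    (hb : HasDerivWithinAt Bbar b' (Icc 0 T) t) :
    inner ℝ (B t - Bbar t) (a' - b') =
      -inner ℝ (curl (B t - Bbar t)) (c • E t - eBar (ubar t) (Bbar t)) := by
  obtain ⟨pu, pB, pE, bu, bB⟩ := hem.bdd hm ht
  obtain ⟨q', hq, e⟩ := hem.faraday
  have e := e t ht
  rw [← (uniqueDiffOn_Icc hT t ht).eq_deriv _ ha (hq t ht)] at e
  have e1 : a' = -(c • curl (E t)) := by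
    have : c • ((1 / c) • a' + curl (E t)) = 0 := by rw [e, smul_zero]
    rw [smul_add, smul_smul, mul_one_div_cancel hc.ne', one_smul] at this
    exact eq_neg_of_add_eq_zero_left this
  have e2 : b' = -curl (ohm (ubar t) (Bbar t)) :=
    (uniqueDiffOn_Icc hT t ht).eq_deriv _ hb (hmhd.deriv_B hR ru rB t ht)
  have pb : HasPd (B t - Bbar t) := pB.sub (rB t ht).hasPd
  have h1 : inner ℝ (curl (B t - Bbar t)) (eBar (ubar t) (Bbar t)) =
      inner ℝ (B t - Bbar t) (curl (ohm (ubar t) (Bbar t))) := by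
    rw [eBar_eq, ← inner_leray, leray_eq_self (divg_curl pb),
      inner_curl pb (ohm_reg hR (ru t ht) (rB t ht)).2.1]
  rw [e1, e2, inner_sub_right, inner_sub_right, h1, inner_neg_right, inner_neg_right,
    inner_smul_right, inner_smul_right, inner_curl pb pE]
  ring

-- The derivative exists at every time, but the inequality needs a bounded current: `linf` has the
-- default value 0 on unbounded fields. The terms on the right are, in order: j acting on b, j - j̄
-- acting on B̄, transport of ū by w, the layer in Faraday's law, the gap J - η, and ∂ₜĒ.
set_option maxHeartbeats 800000 in
theorem energy_deriv (hc : 0 < c) (hT : 0 < T)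
    (hem : IsEulerMaxwellSolution m c T u B E u₀c B₀c E₀c)
    (hmhd : IsMHDSolution m T ubar Bbar u₀ B₀) (hm : 3 ≤ m) (hR : 0 ≤ R)
    (ru : ∀ t ∈ Icc 0 T, Reg3 R (ubar t)) (rB : ∀ t ∈ Icc 0 T, Reg3 R (Bbar t))
    {ε₀ : L2} (hε : HasPd ε₀) {t : ℝ} (ht : t ∈ Icc 0 T) :
    ∃ X' : ℝ, HasDerivWithinAt (modEnergy c u B E ubar Bbar ε₀) X' (Icc 0 T) t ∧
      (Bdd (current c (u t) (E t) (B t)) →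
        X' + 2 * ‖errJ c u B E Bbar ε₀ t‖ ^ 2 ≤ 2 *
          (linf (current c (u t) (E t) (B t)) * ‖B t - Bbar t‖ * ‖u t - ubar t‖
          + sobolevConst * R * (‖errJ c u B E Bbar ε₀ t‖ + Real.exp (-c ^ 2 * t) * ‖ε₀‖)
              * ‖u t - ubar t‖
          + 3 * (sobolevConst * R) * ‖u t - ubar t‖ ^ 2
          + Real.exp (-c ^ 2 * t) * ‖curl ε₀‖ * ‖B t - Bbar t‖
          + (linf (B t) * ‖u t - ubar t‖ + sobolevConst * R * ‖B t - Bbar t‖)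
              * ‖errJ c u B E Bbar ε₀ t‖
          + 1 / c ^ 2 * eBarDerivBound R * (‖errJ c u B E Bbar ε₀ t‖
              + (linf (B t) * ‖u t - ubar t‖ + sobolevConst * R * ‖B t - Bbar t‖)))) := by
  have hS := sobolevConst_nonneg
  obtain ⟨pu, pB, pE, bu, bB⟩ := hem.bdd hm ht
  obtain ⟨u', -, -, hu, -⟩ := hem.euler
  obtain ⟨v', -, -, hv, -⟩ := hmhd.momentum
  obtain ⟨a', ha, -⟩ := hem.faraday
  have hb : HasDerivWithinAt Bbar (-curl (ohm (ubar t) (Bbar t))) (Icc 0 T) t :=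
    hmhd.deriv_B hR ru rB t ht
  obtain ⟨E', hE, eE⟩ := hem.ampere
  obtain ⟨e', he', hwe⟩ := hmhd.eBar_deriv hm hT hR ru rB ht
  set s := Real.exp (-c ^ 2 * t) with hs
  set w := u t - ubar t with hw
  set b := B t - Bbar t with hbdef
  set j := current c (u t) (E t) (B t) with hj
  set J := errJ c u B E Bbar ε₀ t with hJ
  set η := errE c E ubar Bbar ε₀ t with hη
  have hexp : HasDerivWithinAt (fun r => Real.exp (-c ^ 2 * r) • ε₀) ((s * -c ^ 2) • ε₀)
      (Icc 0 T) t := by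
    have h1 : HasDerivAt (fun r : ℝ => -c ^ 2 * r) (-c ^ 2) t := by
      simpa using (hasDerivAt_id t).const_mul (-c ^ 2)
    exact (h1.exp.smul_const ε₀).hasDerivWithinAt
  have hηd : HasWeakDerivWithinAt (errE c E ubar Bbar ε₀)
      (c • E' t - e' - (s * -c ^ 2) • ε₀) (Icc 0 T) t := by
    have h1 := ((hasWeakDerivWithinAt_of_hasDerivWithinAt ((hE t ht).const_smul c)).sub hwe).sub
      (hasWeakDerivWithinAt_of_hasDerivWithinAt hexp)
    have h2 : errE c E ubar Bbar ε₀ = fun r => (c • E) r - eBar (ubar r) (Bbar r)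
        - Real.exp (-c ^ 2 * r) • ε₀ := by
      funext r; simp only [errE, Pi.smul_apply]; abel
    rw [h2]; exact h1
  have hX : HasDerivWithinAt (modEnergy c u B E ubar Bbar ε₀)
      (2 * inner ℝ w (u' t - v' t) + 2 * inner ℝ b (a' t - -curl (ohm (ubar t) (Bbar t)))
        + 1 / c ^ 2 * (2 * inner ℝ η (c • E' t - e' - (s * -c ^ 2) • ε₀))) (Icc 0 T) t :=
    (((hu t ht).sub (hv t ht)).norm_sq.add ((ha t ht).sub hb).norm_sq).add
    (hηd.norm_sq.const_mul (1 / c ^ 2))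
  refine ⟨_, hX, fun bj => ?_⟩
  have k1 := velocity_work hT hem hmhd hm ru rB ht (hu t ht) (hv t ht)
  have k2 := magnetic_work hc hT hem hmhd hm hR ru rB ht (ha t ht) hb
  rw [← hw, ← hj, ← hbdef] at k1
  rw [← hbdef] at k2
  have pb : HasPd b := pB.sub (rB t ht).hasPd
  have hEt : (1 / c) • E' t = curl (B t) - j := by
    have := eE t ht
    rw [sub_eq_iff_eq_add] at this
    rw [this]; abel
  have hcb : curl (B t) = curl b + curl (Bbar t) := by
    rw [hbdef, curl_sub pB (rB t ht).hasPd, sub_add_cancel]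
  have hJj : j - curl (Bbar t) = J + s • ε₀ := by
    rw [hJ, errJ, ← hj, ← hs]; abel
  -- Ampère's law is here a relaxation of η: differentiating the layer gives exactly the sε₀ that
  -- turns j - ∇×B̄ into J.
  have k3 : 1 / c ^ 2 * inner ℝ η (c • E' t - e' - (s * -c ^ 2) • ε₀) =
      inner ℝ η (curl b) - inner ℝ η J - 1 / c ^ 2 * inner ℝ η e' := by
    have h1 : (1 / c ^ 2) • (c • E' t - e' - (s * -c ^ 2) • ε₀) =
        curl b - J - (1 / c ^ 2) • e' := by
      have h2 : (1 / c ^ 2) • (c • E' t) = (1 / c) • E' t := by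
        rw [smul_smul]; congr 1; field_simp
      have h3 : (1 / c ^ 2) • ((s * -c ^ 2) • ε₀) = -(s • ε₀) := by
        rw [smul_smul, ← neg_smul]; congr 1; field_simp
      have h4 : J = j - curl (Bbar t) - s • ε₀ := by rw [hJj]; abel
      rw [smul_sub, smul_sub, h2, h3, hEt, hcb, h4]; abel
    rw [← inner_smul_right, h1, inner_sub_right, inner_sub_right, inner_smul_right]
  have k4 : c • E t - eBar (ubar t) (Bbar t) = η + s • ε₀ := by
    rw [hη, errE, ← hs]; abel
  -- The term ⟨b, ∇×η⟩ cancels the one in `k3`; on the layer the curl falls on ε₀, whence the H¹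
  -- norm in the initial error.
  rw [k4, inner_add_right, inner_smul_right, inner_curl pb hε, real_inner_comm η] at k2
  have hN := norm_errJ_sub_errE_le (c := c) (E := E) (u := u) (ε₀ := ε₀) bB (ru t ht)
    (rB t ht).hasPd
  rw [← hJ, ← hη, ← hw, ← hbdef] at hN
  set N := J - η with hNdef
  have hηJ : η = J - N := by rw [hNdef]; abel
  set n := linf (B t) * ‖w‖ + sobolevConst * R * ‖b‖ with hn
  -- The dissipation: η = J - N, where N is controlled by w and b.
  have k5 : -inner ℝ η J ≤ -‖J‖ ^ 2 + n * ‖J‖ := by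
    rw [hηJ, inner_sub_left, real_inner_self_eq_norm_sq]
    have := real_inner_le_norm N J
    nlinarith [norm_nonneg J]
  have hcc : 0 ≤ 1 / c ^ 2 := by positivity
  have k6 : -(1 / c ^ 2 * inner ℝ η e') ≤ 1 / c ^ 2 * eBarDerivBound R * (‖J‖ + n) := by
    have h1 : ‖η‖ ≤ ‖J‖ + n := by
      rw [hηJ]; exact (norm_sub_le _ _).trans (by gcongr)
    have h2 := neg_le_of_abs_le (abs_real_inner_le_norm η e')
    have h3 : ‖η‖ * ‖e'‖ ≤ (‖J‖ + n) * eBarDerivBound R :=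
      mul_le_mul h1 he' (norm_nonneg _) ((norm_nonneg _).trans h1)
    have h4 : -inner ℝ η e' ≤ (‖J‖ + n) * eBarDerivBound R := by linarith
    calc -(1 / c ^ 2 * inner ℝ η e') = 1 / c ^ 2 * (-inner ℝ η e') := by ring
      _ ≤ 1 / c ^ 2 * ((‖J‖ + n) * eBarDerivBound R) := by gcongr
      _ = _ := by ring
  have k7 : inner ℝ w (cross j b) ≤ linf j * ‖b‖ * ‖w‖ := by
    refine (real_inner_le_norm _ _).trans ?_
    rw [mul_comm]
    gcongr
    exact bj.norm_cross_left_le b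
  have hs0 : 0 ≤ s := (Real.exp_pos _).le
  have k8 : inner ℝ w (cross (j - curl (Bbar t)) (Bbar t))
      ≤ sobolevConst * R * (‖J‖ + s * ‖ε₀‖) * ‖w‖ := by
    refine (real_inner_le_norm _ _).trans ?_
    rw [mul_comm]
    gcongr
    refine ((rB t ht).bdd.norm_cross_right_le _).trans ?_
    refine mul_le_mul (rB t ht).linf_le ?_ (norm_nonneg _) (by positivity)
    rw [hJj]
    refine (norm_add_le _ _).trans ?_
    rw [norm_smul, Real.norm_of_nonneg hs0]
  have k9 : -inner ℝ w (∑ k, prod (advB k) w (pd k (ubar t)))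
      ≤ 3 * (sobolevConst * R) * ‖w‖ ^ 2 := by
    refine ((neg_le_abs _).trans (abs_real_inner_le_norm _ _)).trans ?_
    have h1 : ‖∑ k, prod (advB k) w (pd k (ubar t))‖ ≤ 3 * (sobolevConst * R) * ‖w‖ := by
      refine (norm_sum_le _ _).trans ?_
      have : ∀ k, ‖prod (advB k) w (pd k (ubar t))‖ ≤ sobolevConst * R * ‖w‖ := fun k =>
        (((ru t ht).bdd_pd k).norm_advB_right_le k _).trans
          (mul_le_mul_of_nonneg_right ((ru t ht).linf_pd_le k) (norm_nonneg _))
      rw [Fin.sum_univ_three]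
      linarith [this 0, this 1, this 2]
    nlinarith [norm_nonneg w]
  have k10 : -(s * inner ℝ b (curl ε₀)) ≤ s * ‖curl ε₀‖ * ‖b‖ := by
    have := neg_le_of_abs_le (abs_real_inner_le_norm b (curl ε₀))
    nlinarith
  have hsum : ∀ x y z : ℝ, 2 * x + 2 * y + 1 / c ^ 2 * (2 * z) = 2 * (x + y + 1 / c ^ 2 * z) :=
    fun x y z => by ring
  rw [hsum, k1, k2, k3]
  linarith

end Energy

/-! ### Differential inequalities and time integrals -/

/-- A Grönwall inequality with an integrable coefficient and a dissipation term. -/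
theorem gronwall_dissipation {T e A : ℝ} (hT : 0 < T) (he : 0 < e) {X X' D a : ℝ → ℝ}
    (hX0 : ∀ t ∈ Icc 0 T, 0 ≤ X t) (hX : ∀ t ∈ Icc 0 T, HasDerivWithinAt X (X' t) (Icc 0 T) t)
    (hD : ContinuousOn D (Icc 0 T)) (hD0 : ∀ t, 0 ≤ D t)
    (ha : IntegrableOn a (Icc 0 T)) (ha0 : ∀ t, 0 ≤ a t) (hA : ∫ t in 0..T, a t ≤ A)
    (hin : ∀ᵐ t, t ∈ Ioo 0 T → X' t + D t ≤ a t * (X t + e ^ 2)) (hi : X 0 ≤ e ^ 2) :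
    (∀ t ∈ Icc 0 T, X t ≤ 2 * Real.exp A * e ^ 2) ∧
      ∫ t in 0..T, D t ≤ (1 + A * (2 * Real.exp A)) * e ^ 2 := by
  classical
  have he2 : 0 < e ^ 2 := by positivity
  have hcont : ContinuousOn X (Icc 0 T) := fun t ht => (hX t ht).continuousWithinAt
  have hright : ∀ t ∈ Ioo 0 T, HasDerivWithinAt X (X' t) (Ioi t) t := fun t ht =>
    ((hX t (Ioo_subset_Icc_self ht)).hasDerivAt (Icc_mem_nhds ht.1 ht.2)).hasDerivWithinAt
  -- The inequality holds only for almost every t, while the comparison theorem asks for a majorant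
  -- of the derivative at every interior point. On the null set of bad times the majorant is the
  -- derivative itself, which changes no integral.
  set good : ℝ → Prop := fun t => X' t + D t ≤ a t * (X t + e ^ 2) with hgood
  have haeT : ∀ t ∈ Icc 0 T, ∀ᵐ s ∂(volume.restrict (Icc 0 t)), good s := by
    intro t ht
    rw [ae_restrict_iff' measurableSet_Icc]
    have h0 : ∀ᵐ s : ℝ, s ≠ 0 := by simp [ae_iff]
    have h1 : ∀ᵐ s : ℝ, s ≠ T := by simp [ae_iff]
    filter_upwards [hin, h0, h1] with s hs h0 h1 hmem
    exact hs ⟨lt_of_le_of_ne hmem.1 (Ne.symm h0), lt_of_le_of_ne (hmem.2.trans ht.2) h1⟩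
  have integ_congr : ∀ t ∈ Icc 0 T, ∀ φ ψ : ℝ → ℝ, (∀ s, good s → φ s = ψ s) →
      IntegrableOn ψ (Icc 0 T) → IntegrableOn φ (Icc 0 t) ∧
        ∫ s in 0..t, φ s = ∫ s in 0..t, ψ s := by
    intro t ht φ ψ h hψ
    have hae : φ =ᵐ[volume.restrict (Icc 0 t)] ψ := (haeT t ht).mono h
    refine ⟨(hψ.mono_set (Icc_subset_Icc_right ht.2)).congr hae.symm, ?_⟩
    rw [intervalIntegral.integral_of_le ht.1, intervalIntegral.integral_of_le ht.1]
    exact integral_congr_ae (ae_restrict_of_ae_restrict_of_subset Ioc_subset_Icc_self hae)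
  have hmain : ∀ t ∈ Icc 0 T, X t ≤ 2 * Real.exp A * e ^ 2 - e ^ 2 := by
    intro t ht
    have hZ : ∀ s ∈ Icc 0 t, 0 < X s + e ^ 2 := fun s hs => by
      have := hX0 s ⟨hs.1, hs.2.trans ht.2⟩
      linarith
    set φ : ℝ → ℝ := fun s => if good s then a s else X' s / (X s + e ^ 2) with hφ
    obtain ⟨i1, i2⟩ := integ_congr t ht φ a (fun s hs => if_pos hs) ha
    -- Grönwall by way of log(X + e²); the summand e² > 0 keeps the argument positive, and the
    -- initial value is at most 2e².
    have h1 := intervalIntegral.sub_le_integral_of_hasDeriv_right_of_le ht.1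
      (g := fun s => Real.log (X s + e ^ 2)) (g' := fun s => X' s / (X s + e ^ 2)) (φ := φ)
      (ContinuousOn.log ((hcont.mono (Icc_subset_Icc_right ht.2)).add continuousOn_const)
        fun s hs => (hZ s hs).ne')
      (fun s hs => ((hright s ⟨hs.1, hs.2.trans_le ht.2⟩).add_const _).log
        (hZ s (Ioo_subset_Icc_self hs)).ne') i1
      (fun s hs => by
        simp only [hφ]
        split_ifs with hg
        · rw [div_le_iff₀ (hZ s (Ioo_subset_Icc_self hs))]
          linarith [hD0 s, hg]
        · exact le_rfl)
    rw [i2] at h1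
    have h2 : ∫ s in 0..t, a s ≤ A := by
      refine le_trans ?_ hA
      refine intervalIntegral.integral_mono_interval le_rfl ht.1 ht.2
        (Eventually.of_forall ha0) ?_
      rw [intervalIntegrable_iff_integrableOn_Icc_of_le hT.le]
      exact ha
    have hz0 : 0 < X 0 + e ^ 2 := hZ 0 ⟨le_rfl, ht.1⟩
    have h3 : Real.log (X t + e ^ 2) ≤ Real.log (2 * e ^ 2) + A := by
      have : Real.log (X 0 + e ^ 2) ≤ Real.log (2 * e ^ 2) := Real.log_le_log hz0 (by linarith)
      linarith
    have h4 : X t + e ^ 2 ≤ 2 * e ^ 2 * Real.exp A := by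
      have := Real.exp_le_exp.2 h3
      rwa [Real.exp_add, Real.exp_log (hZ t ⟨ht.1, le_rfl⟩), Real.exp_log (by positivity)] at this
    linarith
  refine ⟨fun t ht => (hmain t ht).trans (by linarith), ?_⟩
  set Z := 2 * Real.exp A * e ^ 2 with hZdef
  have hZ0 : 0 ≤ Z := by positivity
  -- A second integration, now with X + e² ≤ Z known, recovers the integral of D.
  set φ : ℝ → ℝ := fun s => if good s ∧ s ∈ Icc 0 T then a s * Z - D s else X' s with hφ
  have hTT : T ∈ Icc 0 T := ⟨hT.le, le_rfl⟩
  have hDi : IntegrableOn D (Icc 0 T) := hD.integrableOn_Icc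
  have hψ : IntegrableOn (fun s => a s * Z - D s) (Icc 0 T) := (ha.mul_const Z).sub hDi
  have hae : φ =ᵐ[volume.restrict (Icc 0 T)] fun s => a s * Z - D s := by
    filter_upwards [haeT T hTT, ae_restrict_mem measurableSet_Icc] with s h1 h2
    exact if_pos ⟨h1, h2⟩
  have h1 := intervalIntegral.sub_le_integral_of_hasDeriv_right_of_le hT.le (φ := φ) hcont hright
    (hψ.congr hae.symm) (fun s hs => by
      simp only [hφ]
      split_ifs with hg
      · have h2 := hg.1
        have h3 := hmain s hg.2
        have h4 : a s * (X s + e ^ 2) ≤ a s * Z :=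
          mul_le_mul_of_nonneg_left (by linarith) (ha0 s)
        simp only [hgood] at h2
        linarith
      · exact le_rfl)
  have h2 : ∫ s in 0..T, φ s = (∫ s in 0..T, a s) * Z - ∫ s in 0..T, D s := by
    have e1 : ∫ s in 0..T, φ s = ∫ s in 0..T, (a s * Z - D s) := by
      rw [intervalIntegral.integral_of_le hT.le, intervalIntegral.integral_of_le hT.le]
      exact integral_congr_ae (ae_restrict_of_ae_restrict_of_subset Ioc_subset_Icc_self hae)
    rw [e1, intervalIntegral.integral_sub, intervalIntegral.integral_mul_const]
    · rw [intervalIntegrable_iff_integrableOn_Icc_of_le hT.le]; exact ha.mul_const Z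
    · rw [intervalIntegrable_iff_integrableOn_Icc_of_le hT.le]; exact hDi
  have h3 : (∫ s in 0..T, a s) * Z ≤ A * Z := mul_le_mul_of_nonneg_right hA hZ0
  have h4 := hX0 T hTT
  have h5 : A * Z = A * (2 * Real.exp A) * e ^ 2 := by rw [hZdef]; ring
  linarith

/-- An L² limit is an almost everywhere limit along a subsequence, which preserves the bound. Thus
the L^∞ norm is lower semicontinuous on L², and it is measurable along L²-continuous curves such as
the current. -/
theorem isClosed_linfNorm_le (r : ℝ≥0∞) : IsClosed {f : L2 | linfNorm f ≤ r} := by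
  refine IsSeqClosed.isClosed fun f g hf hg => ?_
  obtain ⟨ns, -, hns⟩ := (tendstoInMeasure_of_tendsto_Lp hg).exists_seq_tendsto_ae
  have h1 : ∀ᵐ x, ∀ n, ‖f n x‖ₑ ≤ r := ae_all_iff.2 fun n => by
    have h2 : ∀ᵐ x, ‖f n x‖ₑ ≤ linfNorm (f n) := by
      simp only [linfNorm, eLpNorm_exponent_top]; exact ae_le_eLpNormEssSup
    exact h2.mono fun x hx => hx.trans (hf n)
  rw [mem_ofPred_eq, linfNorm, eLpNorm_exponent_top]
  refine eLpNormEssSup_le_of_ae_enorm_bound ?_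
  filter_upwards [h1, hns] with x hx hlim
  exact le_of_tendsto hlim.enorm (Eventually.of_forall fun i => hx _)

theorem aemeasurable_linfNorm {T : ℝ} (hT : 0 < T) {f : ℝ → L2} (hf : ContinuousOn f (Icc 0 T)) :
    AEMeasurable (fun t => linfNorm (f t)) (volume.restrict (Ioo 0 T)) := by
  set g : ℝ → L2 := IccExtend hT.le ((Icc 0 T).domRestrict f) with hg
  have hgc : Continuous g := (continuousOn_iff_continuous_domRestrict.1 hf).Icc_extend'
  have hm : Measurable fun t => linfNorm (g t) := by
    refine measurable_of_Iic fun r => ?_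
    exact ((isClosed_linfNorm_le r).preimage hgc).measurableSet
  refine ⟨_, hm, ?_⟩
  filter_upwards [ae_restrict_mem measurableSet_Ioo] with t ht
  rw [hg, IccExtend_of_mem _ _ (Ioo_subset_Icc_self ht)]
  rfl

theorem aestronglyMeasurable_of_continuousOn {T : ℝ} {f : ℝ → L2}
    (hf : ContinuousOn f (Icc 0 T)) : AEStronglyMeasurable f (volume.restrict (Ioo 0 T)) :=
  (hf.mono Ioo_subset_Icc_self).aestronglyMeasurable measurableSet_Ioo

theorem integral_exp_le {c T : ℝ} (hc : 0 < c) :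
    ∫ t in 0..T, Real.exp (-c ^ 2 * t) ≤ 1 / c ^ 2 := by
  have h1 : ∀ t ∈ uIcc 0 T, HasDerivAt (fun t : ℝ => -(Real.exp (-c ^ 2 * t) / c ^ 2))
      (Real.exp (-c ^ 2 * t)) t := by
    intro t _
    have h2 : HasDerivAt (fun r : ℝ => -c ^ 2 * r) (-c ^ 2) t := by
      simpa using (hasDerivAt_id t).const_mul (-c ^ 2)
    have h3 := (h2.exp.div_const (c ^ 2)).neg
    convert! h3 using 1
    field_simp
  rw [intervalIntegral.integral_eq_sub_of_hasDerivAt h1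
    (Continuous.intervalIntegrable (by fun_prop) _ _)]
  have : 0 < Real.exp (-c ^ 2 * T) / c ^ 2 := by positivity
  simp only [mul_zero, Real.exp_zero]
  linarith

/-- Bounds the powers of T from Hölder's inequality in time independently of p. -/
theorem rpow_le_one_add {T s : ℝ} (hT : 0 ≤ T) (h0 : 0 ≤ s) (h1 : s ≤ 1) :
    ENNReal.ofReal T ^ s ≤ ENNReal.ofReal (1 + T) := by
  rw [ENNReal.ofReal_rpow_of_nonneg hT h0]
  apply ENNReal.ofReal_le_ofReal
  calc T ^ s ≤ (1 + T) ^ s := Real.rpow_le_rpow hT (by linarith) h0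
    _ ≤ (1 + T) ^ (1 : ℝ) := Real.rpow_le_rpow_of_exponent_le (by linarith) h1
    _ = 1 + T := Real.rpow_one _

theorem inv_toReal_le_one {p : ℝ≥0∞} (hp : 1 ≤ p) : p.toReal⁻¹ ≤ 1 := by
  rcases eq_or_ne p ∞ with rfl | h
  · simp
  · refine inv_le_one_of_one_le₀ ?_
    rw [← ENNReal.toReal_one]
    exact ENNReal.toReal_mono h hp

theorem eLpNorm_le_of_bound {F : Type*} [NormedAddCommGroup F] {p : ℝ≥0∞} (hp : 1 ≤ p) {T a : ℝ}
    (hT : 0 ≤ T) {f : ℝ → F} (h : ∀ t ∈ Ioo 0 T, ‖f t‖ ≤ a) :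
    eLpNorm f p (volume.restrict (Ioo 0 T)) ≤ ENNReal.ofReal (1 + T) * ENNReal.ofReal a := by
  refine (eLpNorm_le_of_ae_bound (C := a) ?_).trans ?_
  · exact (ae_restrict_iff' measurableSet_Ioo).2 (ae_of_all _ h)
  · rw [Measure.restrict_apply_univ, Real.volume_Ioo, sub_zero]
    gcongr
    exact rpow_le_one_add hT (by positivity) (inv_toReal_le_one hp)

theorem rateFactor_pos {c : ℝ} (hc : 0 < c) (p : ℝ≥0∞) : 1 ≤ rateFactor c p := by
  have : 0 ≤ c ^ (1 - 2 * (p⁻¹).toReal) := Real.rpow_nonneg hc.le _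
  unfold rateFactor
  linarith

/-- Interpolation of `L^p(0,T)` between `L²` and `L^∞`. -/
theorem eLpNorm_le_rateFactor {p : ℝ≥0∞} (hp : 1 ≤ p) {T a c : ℝ} (hT : 0 < T) (ha : 0 ≤ a)
    (hc : 0 < c) {f : ℝ → L2} (hf : AEStronglyMeasurable f (volume.restrict (Ioo 0 T)))
    (h2 : ∫⁻ t in Ioo 0 T, ‖f t‖ₑ ^ 2 ≤ ENNReal.ofReal (a ^ 2))
    (hi : ∀ t ∈ Ioo 0 T, ‖f t‖ ≤ c * a) :
    eLpNorm f p (volume.restrict (Ioo 0 T)) ≤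
      ENNReal.ofReal ((1 + T) * rateFactor c p) * ENNReal.ofReal a := by
  have hrate := rateFactor_pos hc p
  rw [ENNReal.ofReal_mul (by linarith)]
  have one_le : 1 ≤ ENNReal.ofReal (1 + T) := by
    rw [← ENNReal.ofReal_one]; exact ENNReal.ofReal_le_ofReal (by linarith)
  have hL2 : eLpNorm f 2 (volume.restrict (Ioo 0 T)) ≤ ENNReal.ofReal a := by
    rw [eLpNorm_eq_lintegral_rpow_enorm_toReal (by norm_num) (by norm_num)]
    simp only [ENNReal.toReal_ofNat, ENNReal.rpow_ofNat]
    calc (∫⁻ t in Ioo 0 T, ‖f t‖ₑ ^ 2) ^ (1 / 2 : ℝ)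
        ≤ (ENNReal.ofReal (a ^ 2)) ^ (1 / 2 : ℝ) := by gcongr
      _ = ENNReal.ofReal a := by
        rw [ENNReal.ofReal_rpow_of_nonneg (by positivity) (by norm_num), ← Real.sqrt_eq_rpow,
          Real.sqrt_sq ha]
  -- For p ≤ 2, Hölder's inequality on a bounded interval suffices and no power of c is needed.
  rcases le_or_gt p 2 with hp2 | hp2
  · have hpt : p ≠ ∞ := ne_top_of_le_ne_top (by norm_num) hp2
    have hp0 : 1 ≤ p.toReal := by
      rw [← ENNReal.toReal_one]; exact ENNReal.toReal_mono hpt hp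
    refine (eLpNorm_le_eLpNorm_mul_rpow_measure_univ hp2 hf).trans ?_
    rw [Measure.restrict_apply_univ, Real.volume_Ioo, sub_zero, ENNReal.toReal_ofNat]
    have hp2' : p.toReal ≤ 2 := by
      have := ENNReal.toReal_mono (by norm_num) hp2
      simpa using this
    have e1 : 1 / 2 ≤ 1 / p.toReal := one_div_le_one_div_of_le (by linarith) hp2'
    have e2 : 1 / p.toReal ≤ 1 := by rw [div_le_one (by linarith)]; exact hp0
    have hr : 1 ≤ ENNReal.ofReal (rateFactor c p) := by
      rw [← ENNReal.ofReal_one]; exact ENNReal.ofReal_le_ofReal hrate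
    calc eLpNorm f 2 (volume.restrict (Ioo 0 T)) * ENNReal.ofReal T ^ (1 / p.toReal - 1 / 2)
        ≤ ENNReal.ofReal a * ENNReal.ofReal (1 + T) := by
          gcongr
          exact rpow_le_one_add hT.le (by linarith) (by linarith)
      _ = ENNReal.ofReal (1 + T) * 1 * ENNReal.ofReal a := by ring
      _ ≤ _ := by gcongr
  · suffices h : eLpNorm f p (volume.restrict (Ioo 0 T)) ≤
        ENNReal.ofReal (rateFactor c p) * ENNReal.ofReal a by
      refine h.trans ?_
      calc ENNReal.ofReal (rateFactor c p) * ENNReal.ofReal a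
          = 1 * ENNReal.ofReal (rateFactor c p) * ENNReal.ofReal a := by ring
        _ ≤ _ := by gcongr
    rcases eq_or_ne p ∞ with rfl | hpt
    · refine (eLpNorm_le_of_ae_bound (C := c * a)
        ((ae_restrict_iff' measurableSet_Ioo).2 (ae_of_all _ hi))).trans ?_
      rw [← ENNReal.ofReal_mul (by linarith)]
      simp only [ENNReal.toReal_top, inv_zero, ENNReal.rpow_zero, one_mul]
      apply ENNReal.ofReal_le_ofReal
      simp [rateFactor]
      nlinarith
    · set q := p.toReal with hq
      have hq2 : 2 < q := by
        have := ENNReal.toReal_strict_mono hpt hp2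
        simpa using this
      have hp0 : p ≠ 0 := (zero_lt_one.trans_le hp).ne'
      rw [eLpNorm_eq_lintegral_rpow_enorm_toReal hp0 hpt]
      -- The surplus power q - 2 is paid with the uniform bound; the q-th root turns c^{q-2} into
      -- c^{1-2/q}.
      have hpt2 : ∀ t ∈ Ioo 0 T, ‖f t‖ₑ ^ q ≤ ENNReal.ofReal (c * a) ^ (q - 2) * ‖f t‖ₑ ^ 2 := by
        intro t ht
        have h3 : ‖f t‖ₑ ≤ ENNReal.ofReal (c * a) := by
          rw [← ofReal_norm]; exact ENNReal.ofReal_le_ofReal (hi t ht)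
        have h4 : ‖f t‖ₑ ^ q = ‖f t‖ₑ ^ (q - 2) * ‖f t‖ₑ ^ 2 := by
          rw [← ENNReal.rpow_ofNat, ← ENNReal.rpow_add_of_nonneg _ _ (by linarith) (by norm_num)]
          congr 1; ring
        rw [h4]
        gcongr
      calc (∫⁻ t in Ioo 0 T, ‖f t‖ₑ ^ q) ^ (1 / q)
          ≤ (∫⁻ t in Ioo 0 T, ENNReal.ofReal (c * a) ^ (q - 2) * ‖f t‖ₑ ^ 2) ^ (1 / q) := by
            gcongr ?_ ^ _
            exact setLIntegral_mono' measurableSet_Ioo hpt2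
        _ = (ENNReal.ofReal (c * a) ^ (q - 2) * ∫⁻ t in Ioo 0 T, ‖f t‖ₑ ^ 2) ^ (1 / q) := by
            rw [lintegral_const_mul' _ _
              (ENNReal.rpow_lt_top_of_nonneg (by linarith) ENNReal.ofReal_ne_top).ne]
        _ ≤ (ENNReal.ofReal (c * a) ^ (q - 2) * ENNReal.ofReal (a ^ 2)) ^ (1 / q) := by
            gcongr
        _ = ENNReal.ofReal (((c * a) ^ (q - 2) * a ^ 2) ^ (1 / q)) := by
            rw [ENNReal.ofReal_rpow_of_nonneg (by positivity) (by linarith),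
              ← ENNReal.ofReal_mul (by positivity),
              ENNReal.ofReal_rpow_of_nonneg (by positivity) (by positivity)]
        _ ≤ _ := by
            rw [← ENNReal.ofReal_mul (by linarith)]
            apply ENNReal.ofReal_le_ofReal
            have e1 : (c * a) ^ (q - 2) * a ^ 2 = c ^ (q - 2) * a ^ q := by
              rw [Real.mul_rpow hc.le ha, mul_assoc, ← Real.rpow_natCast,
                ← Real.rpow_add_of_nonneg ha (by linarith) (by norm_num)]
              congr 2; push_cast; ring
            rw [e1, Real.mul_rpow (by positivity) (by positivity), ← Real.rpow_mul hc.le,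
              ← Real.rpow_mul ha, mul_one_div_cancel (by linarith), Real.rpow_one]
            have e2 : (q - 2) * (1 / q) = 1 - 2 * (p⁻¹).toReal := by
              rw [ENNReal.toReal_inv, ← hq]; field_simp
            rw [e2, rateFactor]
            nlinarith

/-! ### The energy estimate -/

/-- The constant part of the coefficient in Grönwall's inequality. -/
def growthConst (K₁ K₂ : ℝ) : ℝ := 2 * (2 * K₁ + K₂) ^ 2 + 6 * K₁ + K₂ ^ 2 + 2 * K₁ * K₂

theorem growthConst_nonneg {K₁ K₂ : ℝ} (h₁ : 0 ≤ K₁) (h₂ : 0 ≤ K₂) : 0 ≤ growthConst K₁ K₂ := by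
  unfold growthConst; positivity

/-- Here d = ‖J‖, z² = X + e², γ = ‖j‖_∞, β = ‖B‖_∞, q = c⁻², s is the layer, and n, k, h are the L²
norm of ε₀, the L² norm of its curl and its H¹ norm. Products d·z are absorbed by one of the two d².
-/
theorem absorb_dissipation {Y d w b z e s n k q γ β K₁ K₂ h : ℝ} (hd : 0 ≤ d) (hw0 : 0 ≤ w)
    (hb0 : 0 ≤ b) (he : 0 < e) (hs : 0 ≤ s) (hn : 0 ≤ n) 
    (hγ : 0 ≤ γ) (hβ : 0 ≤ β) (hK₁ : 0 ≤ K₁) (hK₂ : 0 ≤ K₂) (hw : w ≤ z) (hb : b ≤ z)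
    (hez : e ≤ z) (hq : q ≤ e) (hnh : n ≤ h) (hkh : k ≤ 3 * h)
    (hY : Y + 2 * d ^ 2 ≤ 2 * (γ * b * w + K₁ * (d + s * n) * w + 3 * K₁ * w ^ 2 + s * k * b
      + (β * w + K₁ * b) * d + q * K₂ * (d + (β * w + K₁ * b)))) :
    Y + d ^ 2 ≤ (2 * γ + 3 * β ^ 2 + growthConst K₁ K₂ + (2 * K₁ + 6) * (s * h / e)) * z ^ 2 := by
  have hz : 0 ≤ z := hw0.trans hw
  have hh : 0 ≤ h := hn.trans hnh
  have t1 : γ * b * w ≤ γ * z * z := by gcongr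
  have t2 : K₁ * (d + s * n) * w ≤ K₁ * (d + s * h) * z := by gcongr
  have t3 : 3 * K₁ * w ^ 2 ≤ 3 * K₁ * z ^ 2 := by gcongr
  have t4 : s * k * b ≤ s * (3 * h) * z := by gcongr
  have t5 : (β * w + K₁ * b) * d ≤ (β * z + K₁ * z) * d := by gcongr
  have t6 : q * K₂ * (d + (β * w + K₁ * b)) ≤ z * K₂ * (d + (β * z + K₁ * z)) := by
    gcongr; exact hq.trans hez
  -- Layer terms are only linear in z; the factor z/e ≥ 1 makes them quadratic, at the price of the
  -- coefficient sh/e.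
  have t7 : s * h * z ≤ s * h / e * z ^ 2 := by
    have : s * h / e * z ^ 2 = s * h * z * (z / e) := by field_simp
    rw [this]
    exact le_mul_of_one_le_right (by positivity) ((one_le_div he).2 hez)
  have t8 : (2 * K₁ + 6) * (s * h * z) ≤ (2 * K₁ + 6) * (s * h / e * z ^ 2) := by gcongr
  have t9 : 2 * (2 * K₁ + K₂ + β) * (d * z) ≤ d ^ 2 + (2 * K₁ + K₂ + β) ^ 2 * z ^ 2 := by
    nlinarith [sq_nonneg (d - (2 * K₁ + K₂ + β) * z)]
  have t10 : (2 * K₁ + K₂ + β) ^ 2 * z ^ 2 ≤ (2 * (2 * K₁ + K₂) ^ 2 + 2 * β ^ 2) * z ^ 2 := by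
    gcongr; nlinarith [sq_nonneg (2 * K₁ + K₂ - β)]
  have t11 : 2 * K₂ * β * z ^ 2 ≤ (K₂ ^ 2 + β ^ 2) * z ^ 2 := by
    gcongr; nlinarith [sq_nonneg (K₂ - β)]
  unfold growthConst
  linarith

theorem HasWeakDerivWithinAt.continuousWithinAt {H : Type*} [NormedAddCommGroup H]
    [InnerProductSpace ℝ H] {f : ℝ → H} {f' : H} {s : Set ℝ} {t : ℝ}
    (h : HasWeakDerivWithinAt f f' s t) : ContinuousWithinAt f s t := by
  have h1 : Tendsto (fun r => f r - f t) (𝓝[s] t) (𝓝 0) := by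
    refine h.isBigO.trans_tendsto ?_
    have : ContinuousWithinAt (fun r : ℝ => r - t) s t := by fun_prop
    simpa [ContinuousWithinAt] using this
  have h2 := h1.add_const (f t)
  simpa [ContinuousWithinAt] using h2

section Estimate

variable {m : ℕ} {c T M R : ℝ} {u B E ubar Bbar : ℝ → L2} {u₀c B₀c E₀c u₀ B₀ ε₀ : L2}

theorem IsEulerMaxwellSolution.continuousOn_current (hm : 3 ≤ m)
    (hem : IsEulerMaxwellSolution m c T u B E u₀c B₀c E₀c) :
    ContinuousOn (fun t => current c (u t) (E t) (B t)) (Icc 0 T) := by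
  obtain ⟨u', -, -, hu, -⟩ := hem.euler
  obtain ⟨B', hB, -⟩ := hem.faraday
  have h1 : ContinuousOn (fun t => cross (u t) (B t)) (Icc 0 T) := fun t ht =>
    (hasDerivWithinAt_cross ht (hu t ht) (hB t ht) (fun r hr => (hem.bdd hm hr).2.2.2.1)
      (fun r hr => (hem.bdd hm hr).2.2.2.2)
      (hem.cont_B.tendsto_linf (by exact_mod_cast (by omega : 2 ≤ m)) ht)).continuousWithinAt
  exact ((hem.cont_E.continuousOn (Nat.cast_nonneg m)).const_smul c).add
    (leray.continuous.comp_continuousOn h1)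

theorem IsMHDSolution.continuousOn_eBar (hmhd : IsMHDSolution m T ubar Bbar u₀ B₀) (hm : 3 ≤ m)
    (hT : 0 < T) (hR : 0 ≤ R) (ru : ∀ t ∈ Icc 0 T, Reg3 R (ubar t))
    (rB : ∀ t ∈ Icc 0 T, Reg3 R (Bbar t)) :
    ContinuousOn (fun t => eBar (ubar t) (Bbar t)) (Icc 0 T) := fun t ht => by
  obtain ⟨e', -, h⟩ := hmhd.eBar_deriv hm hT hR ru rB ht
  exact h.continuousWithinAt

/-- Read off from the limiting Ohm law: ∇×B̄ = Ē + ℙ(ū×B̄), both terms being continuous. -/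
theorem IsMHDSolution.continuousOn_curl (hmhd : IsMHDSolution m T ubar Bbar u₀ B₀) (hm : 3 ≤ m)
    (hT : 0 < T) (hR : 0 ≤ R) (ru : ∀ t ∈ Icc 0 T, Reg3 R (ubar t))
    (rB : ∀ t ∈ Icc 0 T, Reg3 R (Bbar t)) :
    ContinuousOn (fun t => curl (Bbar t)) (Icc 0 T) := by
  obtain ⟨u', -, -, hu, -⟩ := hmhd.momentum
  obtain ⟨B', hB, -⟩ := hmhd.induction_eq
  have h1 : ContinuousOn (fun t => cross (ubar t) (Bbar t)) (Icc 0 T) := fun t ht =>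
    (hasDerivWithinAt_cross ht (hu t ht) (hB t ht) (fun r hr => (ru r hr).bdd)
      (fun r hr => (rB r hr).bdd)
      (hmhd.cont_B.tendsto_linf (by exact_mod_cast (by omega : 2 ≤ m)) ht)).continuousWithinAt
  refine ((hmhd.continuousOn_eBar hm hT hR ru rB).add
    (leray.continuous.comp_continuousOn h1)).congr fun t ht => ?_
  change curl (Bbar t) = leray (curl (Bbar t) - cross (ubar t) (Bbar t))
    + leray (cross (ubar t) (Bbar t))
  rw [map_sub, sub_add_cancel, leray_eq_self (divg_curl (rB t ht).hasPd)]

theorem continuous_layer (c : ℝ) (ε₀ : L2) : Continuous fun t => Real.exp (-c ^ 2 * t) • ε₀ := by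
  fun_prop

theorem continuousOn_errE (hem : IsEulerMaxwellSolution m c T u B E u₀c B₀c E₀c)
    (hmhd : IsMHDSolution m T ubar Bbar u₀ B₀) (hm : 3 ≤ m) (hT : 0 < T) (hR : 0 ≤ R)
    (ru : ∀ t ∈ Icc 0 T, Reg3 R (ubar t)) (rB : ∀ t ∈ Icc 0 T, Reg3 R (Bbar t)) :
    ContinuousOn (errE c E ubar Bbar ε₀) (Icc 0 T) :=
  ((hem.cont_E.continuousOn (Nat.cast_nonneg m)).const_smul c).sub
    ((hmhd.continuousOn_eBar hm hT hR ru rB).add (continuous_layer c ε₀).continuousOn)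

theorem continuousOn_errJ (hem : IsEulerMaxwellSolution m c T u B E u₀c B₀c E₀c)
    (hmhd : IsMHDSolution m T ubar Bbar u₀ B₀) (hm : 3 ≤ m) (hT : 0 < T) (hR : 0 ≤ R)
    (ru : ∀ t ∈ Icc 0 T, Reg3 R (ubar t)) (rB : ∀ t ∈ Icc 0 T, Reg3 R (Bbar t)) :
    ContinuousOn (errJ c u B E Bbar ε₀) (Icc 0 T) :=
  (hem.continuousOn_current hm).sub
    ((hmhd.continuousOn_curl hm hT hR ru rB).add (continuous_layer c ε₀).continuousOn)

/-- The bound on the magnetic field and on the current, in terms of real integrals. -/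
theorem EMBound.integral_le (hb : EMBound c T M u B E) (hM : 0 ≤ M) (hm : 3 ≤ m) (hT : 0 < T)
    (hem : IsEulerMaxwellSolution m c T u B E u₀c B₀c E₀c) :
    IntegrableOn (fun t => linf (B t) ^ 2) (Ioo 0 T) ∧
      IntegrableOn (fun t => linf (current c (u t) (E t) (B t))) (Ioo 0 T) ∧
      (∀ᵐ t ∂volume.restrict (Ioo 0 T), Bdd (current c (u t) (E t) (B t))) ∧
      (∫ t in Ioo 0 T, linf (B t) ^ 2) + ∫ t in Ioo 0 T, linf (current c (u t) (E t) (B t)) ≤ M := by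
  have mB := (aemeasurable_linfNorm hT (hem.cont_B.continuousOn (Nat.cast_nonneg m))).pow_const 2
  have mj := aemeasurable_linfNorm hT (hem.continuousOn_current hm)
  have fin := (hb : _ ≤ _).trans_lt ENNReal.ofReal_lt_top
  obtain ⟨fB, fj⟩ := ENNReal.add_lt_top.1 fin
  have iB := integrable_toReal_of_lintegral_ne_top mB fB.ne
  have ij := integrable_toReal_of_lintegral_ne_top mj fj.ne
  have eB : ∀ t, (linfNorm (B t) ^ 2).toReal = linf (B t) ^ 2 := fun t => ENNReal.toReal_pow _ _
  have aj := ae_lt_top' mj fj.ne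
  have vB := integral_toReal mB (ae_lt_top' mB fB.ne)
  have vj := integral_toReal mj aj
  simp only [eB] at iB vB
  refine ⟨iB, ij, aj, ?_⟩
  unfold linf at vB ⊢
  rw [vB, vj, ← ENNReal.toReal_add fB.ne fj.ne]
  exact ENNReal.toReal_le_of_le_ofReal hM hb

/-- The bound on the integral of the coefficient in Grönwall's inequality. -/
def growthBound (T M R : ℝ) : ℝ :=
  3 * M + growthConst (sobolevConst * R) (eBarDerivBound R) * T + (2 * (sobolevConst * R) + 6)

theorem growthBound_nonneg (hT : 0 ≤ T) (hM : 0 ≤ M) (hR : 0 ≤ R) : 0 ≤ growthBound T M R := by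
  have hS := sobolevConst_nonneg
  have := growthConst_nonneg (mul_nonneg hS hR) (eBarDerivBound_nonneg hR)
  unfold growthBound; positivity

theorem norm_curl_le_hNorm {f : L2} (hf : MemH 1 f) : ‖curl f‖ ≤ 3 * (hNorm 1 f).toReal := by
  have hf' : MemH (0 + 1) f := by rwa [zero_add]
  have h1 : ∀ k, ‖pd k f‖ ≤ (hNorm 1 f).toReal := fun k => by
    have := ((hf'.memH_pd le_rfl k).norm_le le_rfl).trans (hf'.toReal_pd_le le_rfl k)
    rwa [zero_add] at this
  refine (norm_curl_le f).trans ?_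
  rw [Fin.sum_univ_three]
  linarith [h1 0, h1 1, h1 2]

/-- `hce` makes e dominate both c⁻², the size of the ∂ₜĒ source, and the time integral of the layer,
so the bounds depend on c through e alone. -/
theorem modEnergy_estimate (hc : 0 < c) (hT : 0 < T) (hM : 0 ≤ M) (hR : 0 ≤ R) (hm : 3 ≤ m)
    (hem : IsEulerMaxwellSolution m c T u B E u₀c B₀c E₀c)
    (hmhd : IsMHDSolution m T ubar Bbar u₀ B₀)
    (ru : ∀ t ∈ Icc 0 T, Reg3 R (ubar t)) (rB : ∀ t ∈ Icc 0 T, Reg3 R (Bbar t))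
    (hb : EMBound c T M u B E) (hε : MemH 1 ε₀) {e : ℝ} (he : 0 < e)
    (hce : 1 / c ^ 2 * ((hNorm 1 ε₀).toReal + 1) ≤ e)
    (h0 : modEnergy c u B E ubar Bbar ε₀ 0 ≤ e ^ 2) :
    (∀ t ∈ Icc 0 T, modEnergy c u B E ubar Bbar ε₀ t
      ≤ 2 * Real.exp (growthBound T M R) * e ^ 2) ∧
    ∫ t in 0..T, ‖errJ c u B E Bbar ε₀ t‖ ^ 2
      ≤ (1 + growthBound T M R * (2 * Real.exp (growthBound T M R))) * e ^ 2 := by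
  have hS := sobolevConst_nonneg
  have hK₁ : 0 ≤ sobolevConst * R := mul_nonneg hS hR
  have hK₂ := eBarDerivBound_nonneg hR
  obtain ⟨iB, ij, aj, hle⟩ := hb.integral_le hM hm hT hem
  set h := (hNorm 1 ε₀).toReal with hh
  have hh0 : 0 ≤ h := ENNReal.toReal_nonneg
  have hcc : 0 < 1 / c ^ 2 := by positivity
  set K₁ := sobolevConst * R with hK₁def
  set K₂ := eBarDerivBound R with hK₂def
  have hG := growthConst_nonneg hK₁ hK₂
  have hX : ∀ t ∈ Icc 0 T, 0 ≤ modEnergy c u B E ubar Bbar ε₀ t := fun t _ => by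
    unfold modEnergy; positivity
  have key := fun t (ht : t ∈ Icc 0 T) => energy_deriv hc hT hem hmhd hm hR ru rB hε.hasPd ht
  choose! X' hX' hin using key
  set a : ℝ → ℝ := fun t => 2 * linf (current c (u t) (E t) (B t)) + 3 * linf (B t) ^ 2
    + growthConst K₁ K₂ + (2 * K₁ + 6) * (Real.exp (-c ^ 2 * t) * h / e) with ha
  have iexp : IntegrableOn (fun t => (2 * K₁ + 6) * (Real.exp (-c ^ 2 * t) * h / e)) (Ioo 0 T) :=
    (Continuous.integrableOn_Icc (by fun_prop)).mono_set Ioo_subset_Icc_self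
  have iconst : IntegrableOn (fun _ : ℝ => growthConst K₁ K₂) (Ioo 0 T) :=
    integrableOn_const (by simp)
  have ia : IntegrableOn a (Ioo 0 T) :=
    (((ij.const_mul 2).add (iB.const_mul 3)).add iconst).add iexp
  -- The layer lasts for a time c⁻², so although its coefficient carries h/e, the integral stays
  -- bounded.
  have hsh : 1 / c ^ 2 * h / e ≤ 1 := by
    rw [div_le_one he]; nlinarith
  have hA : ∫ t in 0..T, a t ≤ growthBound T M R := by
    rw [intervalIntegral.integral_of_le hT.le, integral_Ioc_eq_integral_Ioo]
    have h1 : ∫ t in Ioo 0 T, a t = 2 * (∫ t in Ioo 0 T, linf (current c (u t) (E t) (B t)))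
        + 3 * (∫ t in Ioo 0 T, linf (B t) ^ 2) + growthConst K₁ K₂ * T
        + ∫ t in Ioo 0 T, (2 * K₁ + 6) * (Real.exp (-c ^ 2 * t) * h / e) := by
      have e1 := integral_add (((ij.const_mul 2).add (iB.const_mul 3)).add iconst) iexp
      have e2 := integral_add ((ij.const_mul 2).add (iB.const_mul 3)) iconst
      have e3 := integral_add (ij.const_mul 2) (iB.const_mul 3)
      simp only [Pi.add_apply] at e1 e2 e3
      rw [ha, e1, e2, e3, integral_const_mul, integral_const_mul, setIntegral_const]
      simp [hT.le, mul_comm]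
    have h2 : ∫ t in Ioo 0 T, (2 * K₁ + 6) * (Real.exp (-c ^ 2 * t) * h / e) ≤ 2 * K₁ + 6 := by
      have e1 : ∀ t, (2 * K₁ + 6) * (Real.exp (-c ^ 2 * t) * h / e)
          = (2 * K₁ + 6) * (h / e) * Real.exp (-c ^ 2 * t) := fun t => by ring
      simp only [e1]
      rw [← integral_Ioc_eq_integral_Ioo, ← intervalIntegral.integral_of_le hT.le,
        intervalIntegral.integral_const_mul]
      calc (2 * K₁ + 6) * (h / e) * ∫ t in 0..T, Real.exp (-c ^ 2 * t)
          ≤ (2 * K₁ + 6) * (h / e) * (1 / c ^ 2) := by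
            gcongr; exact integral_exp_le hc
        _ = (2 * K₁ + 6) * (1 / c ^ 2 * h / e) := by ring
        _ ≤ (2 * K₁ + 6) * 1 := by gcongr
        _ = _ := mul_one _
    have p1 : 0 ≤ ∫ t in Ioo 0 T, linf (current c (u t) (E t) (B t)) :=
      integral_nonneg fun t => linf_nonneg _
    have p2 : 0 ≤ ∫ t in Ioo 0 T, linf (B t) ^ 2 := integral_nonneg fun t => sq_nonneg _
    rw [h1, growthBound]
    linarith
  refine gronwall_dissipation hT he hX hX' (D := fun t => ‖errJ c u B E Bbar ε₀ t‖ ^ 2)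
    ((continuousOn_errJ hem hmhd hm hT hR ru rB).norm.pow 2) (fun t => sq_nonneg _)
    (a := a) ?_ (fun t => ?_) hA ?_ h0
  · exact (integrableOn_Icc_iff_integrableOn_Ioo ..).2 ia
  · have := linf_nonneg (current c (u t) (E t) (B t))
    simp only [ha]; positivity
  · filter_upwards [(ae_restrict_iff' measurableSet_Ioo).1 aj] with t hj ht
    have ht' := Ioo_subset_Icc_self ht
    have hX0 := hX t ht'
    have hz0 : 0 ≤ modEnergy c u B E ubar Bbar ε₀ t + e ^ 2 := by positivity
    -- The role of z in `absorb_dissipation` is played by √(X + e²).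
    rw [← Real.sq_sqrt hz0]
    have e0 : 0 ≤ 1 / c ^ 2 * ‖errE c E ubar Bbar ε₀ t‖ ^ 2 := by positivity
    have hXle : modEnergy c u B E ubar Bbar ε₀ t = ‖u t - ubar t‖ ^ 2 + ‖B t - Bbar t‖ ^ 2
      + 1 / c ^ 2 * ‖errE c E ubar Bbar ε₀ t‖ ^ 2 := rfl
    refine absorb_dissipation (q := 1 / c ^ 2) (norm_nonneg _) (norm_nonneg (u t - ubar t))
      (norm_nonneg (B t - Bbar t)) he (Real.exp_pos _).le (norm_nonneg ε₀)
      (linf_nonneg _) (linf_nonneg _) hK₁ hK₂ ?_ ?_ ?_ ?_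
      (hε.norm_le zero_le_one) (norm_curl_le_hNorm hε) (hin t ht' (hj ht))
    · exact Real.le_sqrt_of_sq_le (by rw [hXle]; nlinarith [sq_nonneg ‖B t - Bbar t‖])
    · exact Real.le_sqrt_of_sq_le (by rw [hXle]; nlinarith [sq_nonneg ‖u t - ubar t‖])
    · exact Real.le_sqrt_of_sq_le (by linarith)
    · nlinarith

end Estimate

/-! ### The difference estimates -/

/-- The constant in the uniform bound of `(u, B)`. -/
def unifConst (T M R : ℝ) : ℝ := Real.sqrt (2 * Real.exp (growthBound T M R))

/-- The constant in the bound of the electric field in `L²(0,T; L²)`. -/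
def electricConst (T M R : ℝ) : ℝ :=
  Real.sqrt (2 * (1 + growthBound T M R * (2 * Real.exp (growthBound T M R)))
    + 4 * (M + (sobolevConst * R) ^ 2 * T) * unifConst T M R ^ 2) + unifConst T M R

theorem unifConst_nonneg (T M R : ℝ) : 0 ≤ unifConst T M R := Real.sqrt_nonneg _

theorem electricConst_nonneg (T M R : ℝ) : 0 ≤ electricConst T M R :=
  add_nonneg (Real.sqrt_nonneg _) (Real.sqrt_nonneg _)

section Estimate

variable {m : ℕ} {c T M R : ℝ} {u B E ubar Bbar : ℝ → L2} {u₀c B₀c E₀c u₀ B₀ ε₀ : L2}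

/-- The weight c⁻² in the energy costs a factor c in the uniform bound on η. -/
theorem pointwise_estimate (hc : 0 < c) {e : ℝ} (he : 0 ≤ e) {t : ℝ}
    (h : modEnergy c u B E ubar Bbar ε₀ t ≤ 2 * Real.exp (growthBound T M R) * e ^ 2) :
    Real.sqrt (‖u t - ubar t‖ ^ 2 + ‖B t - Bbar t‖ ^ 2) ≤ unifConst T M R * e ∧
      ‖u t - ubar t‖ ≤ unifConst T M R * e ∧ ‖B t - Bbar t‖ ≤ unifConst T M R * e ∧
      ‖errE c E ubar Bbar ε₀ t‖ ≤ c * (unifConst T M R * e) := by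
  have hr : 0 ≤ unifConst T M R * e := mul_nonneg (unifConst_nonneg T M R) he
  have hsq : (unifConst T M R * e) ^ 2 = 2 * Real.exp (growthBound T M R) * e ^ 2 := by
    rw [mul_pow, unifConst, Real.sq_sqrt (by positivity)]
  rw [← hsq, modEnergy] at h
  have p1 := sq_nonneg ‖u t - ubar t‖
  have p2 := sq_nonneg ‖B t - Bbar t‖
  have p3 : 1 / c ^ 2 * ‖errE c E ubar Bbar ε₀ t‖ ^ 2
      = (‖errE c E ubar Bbar ε₀ t‖ / c) ^ 2 := by ring
  have p4 := sq_nonneg (‖errE c E ubar Bbar ε₀ t‖ / c)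
  rw [p3] at h
  refine ⟨Real.sqrt_le_iff.2 ⟨hr, by linarith⟩, abs_le_of_sq_le_sq' (by linarith) hr |>.2,
    abs_le_of_sq_le_sq' (by linarith) hr |>.2, ?_⟩
  rw [mul_comm, ← div_le_iff₀ hc]
  exact (abs_le_of_sq_le_sq' (by linarith) hr).2

/-- Dissipation controls J, not η; the gap is at most (‖B‖_∞ + const)·r, which is square integrable
in time. The constants come from (x + y + z)² ≤ 2x² + 4y² + 4z². -/
theorem lintegral_errE_le (hT : 0 < T) (hM : 0 ≤ M) (hR : 0 ≤ R) (hm : 3 ≤ m)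
    (hem : IsEulerMaxwellSolution m c T u B E u₀c B₀c E₀c)
    (hmhd : IsMHDSolution m T ubar Bbar u₀ B₀)
    (ru : ∀ t ∈ Icc 0 T, Reg3 R (ubar t)) (rB : ∀ t ∈ Icc 0 T, Reg3 R (Bbar t))
    (hb : EMBound c T M u B E) {r K : ℝ}
    (hw : ∀ t ∈ Icc 0 T, ‖u t - ubar t‖ ≤ r ∧ ‖B t - Bbar t‖ ≤ r)
    (hJ : ∫ t in 0..T, ‖errJ c u B E Bbar ε₀ t‖ ^ 2 ≤ K) :
    ∫⁻ t in Ioo 0 T, ‖errE c E ubar Bbar ε₀ t‖ₑ ^ 2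
      ≤ ENNReal.ofReal (2 * K + 4 * (M + (sobolevConst * R) ^ 2 * T) * r ^ 2) := by
  have hS := sobolevConst_nonneg
  obtain ⟨iB, ij, -, hle⟩ := hb.integral_le hM hm hT hem
  have iJ : IntegrableOn (fun t => ‖errJ c u B E Bbar ε₀ t‖ ^ 2) (Ioo 0 T) :=
    ((continuousOn_errJ hem hmhd hm hT hR ru rB).norm.pow 2).integrableOn_Icc.mono_set
      Ioo_subset_Icc_self
  have iK : IntegrableOn (fun _ : ℝ => 4 * (sobolevConst * R) ^ 2 * r ^ 2) (Ioo 0 T) :=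
    integrableOn_const (by simp)
  have i1 := (iJ.const_mul 2).add (iB.const_mul (4 * r ^ 2))
  have hpt : ∀ t ∈ Ioo 0 T, ‖errE c E ubar Bbar ε₀ t‖ₑ ^ 2 ≤
      ENNReal.ofReal (2 * ‖errJ c u B E Bbar ε₀ t‖ ^ 2 + 4 * r ^ 2 * linf (B t) ^ 2
        + 4 * (sobolevConst * R) ^ 2 * r ^ 2) := by
    intro t ht
    have ht' := Ioo_subset_Icc_self ht
    rw [← ofReal_norm, ← ENNReal.ofReal_pow (norm_nonneg _)]
    refine ENNReal.ofReal_le_ofReal ?_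
    have h1 := norm_errJ_sub_errE_le (c := c) (E := E) (u := u) (ε₀ := ε₀) (hem.bdd hm ht').2.2.2.2
      (ru t ht') (rB t ht').hasPd
    have h2 : ‖errE c E ubar Bbar ε₀ t‖ ≤ ‖errJ c u B E Bbar ε₀ t‖
        + (linf (B t) * r + sobolevConst * R * r) := by
      have h3 := norm_sub_norm_le (errE c E ubar Bbar ε₀ t) (errJ c u B E Bbar ε₀ t)
      rw [norm_sub_rev] at h3
      have h4 : linf (B t) * ‖u t - ubar t‖ ≤ linf (B t) * r :=
        mul_le_mul_of_nonneg_left (hw t ht').1 (linf_nonneg _)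
      have h5 : sobolevConst * R * ‖B t - Bbar t‖ ≤ sobolevConst * R * r :=
        mul_le_mul_of_nonneg_left (hw t ht').2 (mul_nonneg hS hR)
      linarith
    refine (pow_le_pow_left₀ (norm_nonneg _) h2 2).trans ?_
    nlinarith [sq_nonneg (‖errJ c u B E Bbar ε₀ t‖ - (linf (B t) * r + sobolevConst * R * r)),
      sq_nonneg (linf (B t) * r - sobolevConst * R * r)]
  refine (setLIntegral_mono' measurableSet_Ioo hpt).trans ?_
  refine (ofReal_integral_eq_lintegral_ofReal (i1.add iK) (ae_of_all _ fun t => by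
    simp only [Pi.zero_apply, Pi.add_apply]; positivity)).ge.trans ?_
  refine ENNReal.ofReal_le_ofReal ?_
  have e1 := integral_add i1 iK
  have e2 := integral_add (iJ.const_mul 2) (iB.const_mul (4 * r ^ 2))
  simp only [Pi.add_apply] at e1 e2 ⊢
  rw [e1, e2, integral_const_mul, integral_const_mul, setIntegral_const]
  rw [intervalIntegral.integral_of_le hT.le, integral_Ioc_eq_integral_Ioo] at hJ
  have p1 : 0 ≤ ∫ t in Ioo 0 T, linf (current c (u t) (E t) (B t)) :=
    integral_nonneg fun t => linf_nonneg _
  have p2 : 4 * r ^ 2 * ∫ t in Ioo 0 T, linf (B t) ^ 2 ≤ 4 * r ^ 2 * M := by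
    gcongr; linarith
  simp only [Real.volume_real_Ioo_of_le hT.le, sub_zero, smul_eq_mul]
  linarith

/-- The gap contains ‖B‖_∞ times the velocity error, so L^p in time of the current needs L^p in time
of ‖B‖_∞. -/
theorem eLpNorm_errJ_sub_errE_le {p : ℝ≥0∞} (hp : 1 ≤ p) (hT : 0 < T) (hM : 0 ≤ M) (hR : 0 ≤ R)
    (hm : 3 ≤ m) (hem : IsEulerMaxwellSolution m c T u B E u₀c B₀c E₀c)
    (ru : ∀ t ∈ Icc 0 T, Reg3 R (ubar t)) (rB : ∀ t ∈ Icc 0 T, Reg3 R (Bbar t))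
    (hB : lpLinfNorm p T B ≤ ENNReal.ofReal M) {r : ℝ} (hr : 0 ≤ r)
    (hw : ∀ t ∈ Icc 0 T, ‖u t - ubar t‖ ≤ r ∧ ‖B t - Bbar t‖ ≤ r) :
    eLpNorm (fun t => errJ c u B E Bbar ε₀ t - errE c E ubar Bbar ε₀ t) p
        (volume.restrict (Ioo 0 T))
      ≤ ENNReal.ofReal ((M + (1 + T) * (sobolevConst * R)) * r) := by
  have hS := sobolevConst_nonneg
  set μ := volume.restrict (Ioo 0 T)
  have mB : AEMeasurable (fun t => linf (B t)) μ :=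
    (aemeasurable_linfNorm hT (hem.cont_B.continuousOn (Nat.cast_nonneg m))).ennreal_toReal
  have h1 : eLpNorm (fun t => linf (B t)) p μ ≤ ENNReal.ofReal M := by
    refine le_trans (eLpNorm_mono_enorm fun t => ?_) hB
    rw [Real.enorm_of_nonneg (linf_nonneg _), enorm_eq_self]
    exact ENNReal.ofReal_toReal_le
  have h2 : eLpNorm (fun t => r * linf (B t)) p μ ≤ ENNReal.ofReal (r * M) := by
    refine (eLpNorm_const_smul_le (c := r) (f := fun t => linf (B t))).trans ?_
    rw [Real.enorm_of_nonneg hr, ENNReal.ofReal_mul hr]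
    gcongr
  have h3 : eLpNorm (fun _ : ℝ => sobolevConst * R * r) p μ
      ≤ ENNReal.ofReal ((1 + T) * (sobolevConst * R * r)) := by
    rw [ENNReal.ofReal_mul (by linarith)]
    exact eLpNorm_le_of_bound hp hT.le fun t _ =>
      (Real.norm_of_nonneg (by positivity)).le
  calc eLpNorm (fun t => errJ c u B E Bbar ε₀ t - errE c E ubar Bbar ε₀ t) p μ
      ≤ eLpNorm ((fun t => r * linf (B t)) + fun _ => sobolevConst * R * r) p μ := by
        refine eLpNorm_mono_ae_real ((ae_restrict_iff' measurableSet_Ioo).2 (ae_of_all _ ?_))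
        intro t ht
        have ht' := Ioo_subset_Icc_self ht
        refine (norm_errJ_sub_errE_le (hem.bdd hm ht').2.2.2.2 (ru t ht') (rB t ht').hasPd).trans ?_
        have h4 : linf (B t) * ‖u t - ubar t‖ ≤ linf (B t) * r :=
          mul_le_mul_of_nonneg_left (hw t ht').1 (linf_nonneg _)
        have h5 : sobolevConst * R * ‖B t - Bbar t‖ ≤ sobolevConst * R * r :=
          mul_le_mul_of_nonneg_left (hw t ht').2 (mul_nonneg hS hR)
        simp only [Pi.add_apply]
        linarith
    _ ≤ eLpNorm (fun t => r * linf (B t)) p μ + eLpNorm (fun _ : ℝ => sobolevConst * R * r) p μ :=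
        eLpNorm_add_le (mB.const_mul r).aestronglyMeasurable aestronglyMeasurable_const hp
    _ ≤ ENNReal.ofReal (r * M) + ENNReal.ofReal ((1 + T) * (sobolevConst * R * r)) :=
        add_le_add h2 h3
    _ = _ := by
        rw [← ENNReal.ofReal_add (by positivity) (by positivity)]
        congr 1; ring

/-- The constant of the difference estimates. -/
def differenceConst (T M R : ℝ) : ℝ :=
  1 + (1 + T) * unifConst T M R + (1 + T) * electricConst T M R
    + (M + (1 + T) * (sobolevConst * R)) * unifConst T M R

theorem differenceConst_pos (hT : 0 ≤ T) (hM : 0 ≤ M) (hR : 0 ≤ R) :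
    0 < differenceConst T M R := by
  have hS := sobolevConst_nonneg
  have h1 := unifConst_nonneg T M R
  have h2 := electricConst_nonneg T M R
  unfold differenceConst; positivity

theorem difference_estimates (hc : 0 < c) (hT : 0 < T) (hM : 0 ≤ M) (hR : 0 ≤ R) (hm : 3 ≤ m)
    (hem : IsEulerMaxwellSolution m c T u B E u₀c B₀c E₀c)
    (hmhd : IsMHDSolution m T ubar Bbar u₀ B₀)
    (ru : ∀ t ∈ Icc 0 T, Reg3 R (ubar t)) (rB : ∀ t ∈ Icc 0 T, Reg3 R (Bbar t))
    (hb : EMBound c T M u B E) (hε : MemH 1 ε₀) {e : ℝ} (he : 0 < e)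
    (hce : 1 / c ^ 2 * ((hNorm 1 ε₀).toReal + 1) ≤ e)
    (h0 : modEnergy c u B E ubar Bbar ε₀ 0 ≤ e ^ 2) {p : ℝ≥0∞} (hp : 1 ≤ p) :
    lpL2PairNorm p T (fun t => u t - ubar t) (fun t => B t - Bbar t)
        ≤ ENNReal.ofReal (differenceConst T M R) * ENNReal.ofReal e ∧
      lpL2Norm p T (errE c E ubar Bbar ε₀)
        ≤ ENNReal.ofReal (differenceConst T M R * rateFactor c p) * ENNReal.ofReal e ∧
      (lpLinfNorm p T B ≤ ENNReal.ofReal M → lpL2Norm p T (errJ c u B E Bbar ε₀)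
        ≤ ENNReal.ofReal (differenceConst T M R * rateFactor c p) * ENNReal.ofReal e) := by
  have hS := sobolevConst_nonneg
  have hK₁ : 0 ≤ sobolevConst * R := mul_nonneg hS hR
  have hU := unifConst_nonneg T M R
  have hL := electricConst_nonneg T M R
  have hG := growthBound_nonneg hT.le hM hR
  have hrate := rateFactor_pos hc p
  have hrate0 : 0 ≤ rateFactor c p := by linarith
  have hMK : 0 ≤ (M + (1 + T) * (sobolevConst * R)) * unifConst T M R := by positivity
  have hTU : 0 ≤ (1 + T) * unifConst T M R := by positivity
  have hTL : 0 ≤ (1 + T) * electricConst T M R := by positivity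
  obtain ⟨hX, hJ⟩ := modEnergy_estimate hc hT hM hR hm hem hmhd ru rB hb hε he hce h0
  have hpt := fun t (ht : t ∈ Icc 0 T) => pointwise_estimate hc he.le (hX t ht)
  have hw : ∀ t ∈ Icc 0 T, ‖u t - ubar t‖ ≤ unifConst T M R * e ∧
      ‖B t - Bbar t‖ ≤ unifConst T M R * e := fun t ht => ⟨(hpt t ht).2.1, (hpt t ht).2.2.1⟩
  have cE := continuousOn_errE (ε₀ := ε₀) hem hmhd hm hT hR ru rB
  have cJ := continuousOn_errJ (ε₀ := ε₀) hem hmhd hm hT hR ru rB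
  have hE : lpL2Norm p T (errE c E ubar Bbar ε₀)
      ≤ ENNReal.ofReal ((1 + T) * electricConst T M R * rateFactor c p) * ENNReal.ofReal e := by
    have h1 := eLpNorm_le_rateFactor hp hT (a := electricConst T M R * e) (by positivity) hc
      (aestronglyMeasurable_of_continuousOn cE)
      ((lintegral_errE_le hT hM hR hm hem hmhd ru rB hb hw hJ).trans ?_)
      (fun t ht => (hpt t (Ioo_subset_Icc_self ht)).2.2.2.trans ?_)
    · refine h1.trans_eq ?_
      rw [← ENNReal.ofReal_mul (by positivity), ← ENNReal.ofReal_mul (by positivity)]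
      congr 1; ring
    · refine ENNReal.ofReal_le_ofReal ?_
      set Q := 2 * (1 + growthBound T M R * (2 * Real.exp (growthBound T M R)))
        + 4 * (M + (sobolevConst * R) ^ 2 * T) * unifConst T M R ^ 2 with hQ
      have hQ0 : 0 ≤ Q := by positivity
      have h2 : Q ≤ electricConst T M R ^ 2 := by
        have h3 := Real.sq_sqrt hQ0
        have h4 := Real.sqrt_nonneg Q
        rw [electricConst, ← hQ]
        nlinarith
      calc _ = Q * e ^ 2 := by rw [hQ]; ring
        _ ≤ electricConst T M R ^ 2 * e ^ 2 := by gcongr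
        _ = _ := by ring
    -- The interpolation uses the same constant for its L² and its uniform hypothesis; this is why
    -- `unifConst` is a summand of `electricConst`.
    · gcongr
      exact le_add_of_nonneg_left (Real.sqrt_nonneg _)
  refine ⟨?_, hE.trans ?_, fun hB => ?_⟩
  · refine (eLpNorm_le_of_bound hp hT.le fun t ht => ?_).trans
      (b := ENNReal.ofReal (1 + T) * ENNReal.ofReal (unifConst T M R * e)) ?_
    · rw [Real.norm_of_nonneg (Real.sqrt_nonneg _)]
      exact (hpt t (Ioo_subset_Icc_self ht)).1
    · rw [ENNReal.ofReal_mul hU, ← mul_assoc, ← ENNReal.ofReal_mul (by linarith)]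
      gcongr
      unfold differenceConst; linarith
  · gcongr
    unfold differenceConst; linarith
  · have h1 : errJ c u B E Bbar ε₀ = errE c E ubar Bbar ε₀
        + fun t => errJ c u B E Bbar ε₀ t - errE c E ubar Bbar ε₀ t := by
      funext t; simp
    have h2 := eLpNorm_errJ_sub_errE_le (ε₀ := ε₀) hp hT hM hR hm hem ru rB hB (by positivity) hw
    have h3 : lpL2Norm p T (errJ c u B E Bbar ε₀) ≤ lpL2Norm p T (errE c E ubar Bbar ε₀)
        + ENNReal.ofReal ((M + (1 + T) * (sobolevConst * R)) * (unifConst T M R * e)) := by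
      refine le_trans ?_ (add_le_add_right h2 _)
      conv_lhs => rw [h1]
      exact eLpNorm_add_le (aestronglyMeasurable_of_continuousOn cE)
        (aestronglyMeasurable_of_continuousOn (cJ.sub cE)) hp
    refine (h3.trans (add_le_add_left hE _)).trans ?_
    rw [← ENNReal.ofReal_mul (by positivity), ← ENNReal.ofReal_add (by positivity) (by positivity),
      ← ENNReal.ofReal_mul (mul_nonneg (differenceConst_pos hT.le hM hR).le hrate0)]
    refine ENNReal.ofReal_le_ofReal ?_
    rw [← mul_assoc, ← add_mul]
    gcongr
    unfold differenceConst
    nlinarith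

end Estimate

theorem MHDBound.n3_le {m : ℕ} {T M : ℝ} {u B : ℝ → L2} (h : MHDBound m T M u B) (hM : 0 ≤ M)
    (hm : 3 ≤ m) {t : ℝ} (ht : t ∈ Icc 0 T) : n3 (u t) ≤ M ∧ n3 (B t) ≤ M := by
  have h1 : hNorm m (u t) + hNorm m (B t) ≤ ENNReal.ofReal M :=
    ((le_iSup₂ (f := fun t _ => hNorm m (u t) + hNorm m (B t)) t ht).trans
      (le_add_of_nonneg_right zero_le)).trans h
  have h3 : (3 : ℝ) ≤ m := by exact_mod_cast hm
  exact ⟨ENNReal.toReal_le_of_le_ofReal hM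
      ((hNorm_mono h3 _).trans ((le_add_of_nonneg_right zero_le).trans h1)),
    ENNReal.toReal_le_of_le_ofReal hM
      ((hNorm_mono h3 _).trans ((le_add_of_nonneg_left zero_le).trans h1))⟩

/-- The bounds contained in the finiteness of the initial error. -/
theorem initialError_bounds {c : ℝ} {u₀c B₀c E₀c u₀ B₀ : L2} (hc : 0 < c)
    (h : initialError c u₀c B₀c E₀c u₀ B₀ ≠ ∞) :
    MemH 1 (c • E₀c - eBar u₀ B₀) ∧
      ‖u₀c - u₀‖ + ‖B₀c - B₀‖ + 1 / c ^ 2 * ((hNorm 1 (c • E₀c - eBar u₀ B₀)).toReal + 1)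
        = (initialError c u₀c B₀c E₀c u₀ B₀).toReal := by
  have hcc : 0 < 1 / c ^ 2 := by positivity
  have hmem : hNorm 1 (c • E₀c - eBar u₀ B₀) ≠ ∞ := by
    intro hI
    refine h ?_
    rw [initialError, hI, top_add, ENNReal.mul_top (by simpa using hc.ne'), add_top]
  refine ⟨hmem.lt_top, ?_⟩
  have h1 : hNorm 1 (c • E₀c - eBar u₀ B₀) + 1 ≠ ∞ := by finiteness
  rw [initialError, ENNReal.toReal_add (by finiteness) (by finiteness),
    ENNReal.toReal_add (by finiteness) (by finiteness), ENNReal.toReal_mul,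
    ENNReal.toReal_add hmem ENNReal.one_ne_top, ENNReal.toReal_ofReal hcc.le, toReal_enorm,
    toReal_enorm, ENNReal.toReal_one]

theorem difference_estimates_of_solution {m : ℕ} {c T M R : ℝ} {u B E ubar Bbar : ℝ → L2}
    {u₀c B₀c E₀c u₀ B₀ : L2} (hc : 0 < c) (hT : 0 < T) (hM : 0 ≤ M) (hR : 0 ≤ R) (hm : 3 ≤ m)
    (hem : IsEulerMaxwellSolution m c T u B E u₀c B₀c E₀c)
    (hmhd : IsMHDSolution m T ubar Bbar u₀ B₀) (hb : EMBound c T M u B E)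
    (hR' : MHDBound m T R ubar Bbar) {p : ℝ≥0∞} (hp : 1 ≤ p) :
    lpL2PairNorm p T (fun t => u t - ubar t) (fun t => B t - Bbar t)
        ≤ ENNReal.ofReal (differenceConst T M R) * initialError c u₀c B₀c E₀c u₀ B₀ ∧
      lpL2Norm p T (errE c E ubar Bbar (c • E₀c - eBar (ubar 0) (Bbar 0)))
        ≤ ENNReal.ofReal (differenceConst T M R * rateFactor c p)
          * initialError c u₀c B₀c E₀c u₀ B₀ ∧
      (lpLinfNorm p T B ≤ ENNReal.ofReal M →
        lpL2Norm p T (errJ c u B E Bbar (c • E₀c - eBar (ubar 0) (Bbar 0)))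
        ≤ ENNReal.ofReal (differenceConst T M R * rateFactor c p)
          * initialError c u₀c B₀c E₀c u₀ B₀) := by
  have hC := differenceConst_pos hT.le hM hR
  have hrate := rateFactor_pos hc p
  -- An infinite error makes every bound trivial, the constants being positive; otherwise ε₀ lies in
  -- H¹.
  by_cases htop : initialError c u₀c B₀c E₀c u₀ B₀ = ∞
  · rw [htop, ENNReal.mul_top (by simpa using hC), ENNReal.mul_top]
    · exact ⟨le_top, le_top, fun _ => le_top⟩
    · have : 0 < differenceConst T M R * rateFactor c p := by positivity
      simpa using this
  obtain ⟨hε, hsum⟩ := initialError_bounds hc htop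
  set e := (initialError c u₀c B₀c E₀c u₀ B₀).toReal with he
  have hcc : 0 < 1 / c ^ 2 := by positivity
  have hh : 0 < 1 / c ^ 2 * ((hNorm 1 (c • E₀c - eBar u₀ B₀)).toReal + 1) := by
    have := ENNReal.toReal_nonneg (a := hNorm 1 (c • E₀c - eBar u₀ B₀))
    positivity
  have n1 := norm_nonneg (u₀c - u₀)
  have n2 := norm_nonneg (B₀c - B₀)
  rw [← ENNReal.ofReal_toReal htop, ← he, hmhd.init_u, hmhd.init_B]
  have h3 : (3 : ℝ) ≤ m := by exact_mod_cast hm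
  refine difference_estimates hc hT hM hR hm hem hmhd
    (fun t ht => ((hmhd.cont_u t ht).1.mono h3).reg3 (hR'.n3_le hR hm ht).1)
    (fun t ht => ((hmhd.cont_B t ht).1.mono h3).reg3 (hR'.n3_le hR hm ht).2) hb hε
    (by linarith) (by linarith) ?_ hp
  -- The layer is chosen to match the initial data, so the energy starts with the errors of u and B
  -- only.
  have hE0 : errE c E ubar Bbar (c • E₀c - eBar u₀ B₀) 0 = 0 := by
    simp [errE, hem.init_E, hmhd.init_u, hmhd.init_B]
  rw [modEnergy, hE0, hem.init_u, hem.init_B, hmhd.init_u, hmhd.init_B, norm_zero]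
  nlinarith

end EulerMaxwell

end

theorem theorem1p1 (T M Mbar : ℝ) (hT : 0 < T) (hM : 0 < M) (hMbar : 0 < Mbar) :
    ∃ C : ℝ, 0 < C ∧
      ∀ (m : ℕ) (c₀ : ℝ) (u B E : ℝ → ℝ → L2) (ubar Bbar : ℝ → L2)
        (u₀c B₀c E₀c : ℝ → L2) (u₀ B₀ : L2),
        (5 / 2 : ℝ) < m → 0 < c₀ →
        InitialCondition m c₀ u₀c B₀c E₀c u₀ B₀ →
        (∀ c, c₀ ≤ c →
          IsEulerMaxwellSolution m c T (u c) (B c) (E c) (u₀c c) (B₀c c) (E₀c c)) →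
        IsMHDSolution m T ubar Bbar u₀ B₀ →
        (∀ c, c₀ ≤ c → EMBound c T M (u c) (B c) (E c)) →
        MHDBound m T Mbar ubar Bbar →
        ∀ p : ℝ≥0∞, 1 ≤ p →
          (∀ c, c₀ ≤ c →
            lpL2PairNorm p T (fun t => u c t - ubar t) (fun t => B c t - Bbar t)
              ≤ ENNReal.ofReal C * initialError c (u₀c c) (B₀c c) (E₀c c) u₀ B₀) ∧
          (∀ c, c₀ ≤ c →
            lpL2Norm p T (fun t => c • E c t - (eBar (ubar t) (Bbar t)
                + Real.exp (-c ^ 2 * t) • (c • E₀c c - eBar (ubar 0) (Bbar 0))))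
              ≤ ENNReal.ofReal (C * rateFactor c p)
                  * initialError c (u₀c c) (B₀c c) (E₀c c) u₀ B₀) ∧
          ((∀ c, c₀ ≤ c → lpLinfNorm p T (B c) ≤ ENNReal.ofReal M) →
            ∀ c, c₀ ≤ c →
              lpL2Norm p T (fun t => current c (u c t) (E c t) (B c t) - (curl (Bbar t)
                  + Real.exp (-c ^ 2 * t) • (c • E₀c c - eBar (ubar 0) (Bbar 0))))
                ≤ ENNReal.ofReal (C * rateFactor c p)
                    * initialError c (u₀c c) (B₀c c) (E₀c c) u₀ B₀) := by
  refine ⟨differenceConst T M Mbar, differenceConst_pos hT.le hM.le hMbar.le, ?_⟩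
  intro m c₀ u B E ubar Bbar u₀c B₀c E₀c u₀ B₀ hm hc₀ _ hem hmhd hb hbar p hp
  -- An integer above 5/2 is at least 3, which makes first derivatives bounded and third derivatives
  -- square integrable.
  have hm3 : 3 ≤ m := by
    by_contra! h
    have h2 : (m : ℝ) ≤ 2 := by exact_mod_cast (by omega : m ≤ 2)
    linarith
  have key := fun c (hc : c₀ ≤ c) => difference_estimates_of_solution (hc₀.trans_le hc) hT hM.le
    hMbar.le hm3 (hem c hc) hmhd (hb c hc) hbar hp
  exact ⟨fun c hc => (key c hc).1, fun c hc => (key c hc).2.1,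
    fun hB c hc => (key c hc).2.2 (hB c hc)⟩
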